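/- Let $\Gamma$ be a discrete group and $\Sigma\subseteq\Gamma$ a finite subset. Let $\mathrm{C}^*(\Gamma)$ be the full group C*-algebra, with canonical unitary generators $\delta_g$, $g\in\Gamma$. For a Hilbert space $H$, a $\mathcal B(H)$-valued Toeplitz matrix over $\Sigma$ is a matrix $T=(T_{s,t})_{s,t\in\Sigma}$ with entries in $\mathcal B(H)$ such that $T_{s_1,t_1}=T_{s_2,t_2}$ whenever $s_1t_1^{-1}=s_2t_2^{-1}$; it is positive semi-definite if it is a positive operator on $\ell^2(\Sigma)\otimes H$. A function $u:\Gamma\to\mathcal B(H)$ is positive semi-definite if $(u(st^{-1}))_{s,t\in F}$ is a positive operator on $\ell^2(F)\otimes H$ for every finite $F\subseteq\Gamma$; $\mathrm B(\Gamma,H)$ denotes the linear span of these functions, and for $u\in \mathrm B(\Gamma,H)$ we write $\phi_u:\mathrm{C}^*(\Gamma)\to\mathcal B(H)$ for the completely bounded map with $\phi_u(\delta_g)=u(g)$, $g\in\Gamma$. Let $\mathrm{SOS}(\Sigma)$ be the operator system with underlying space $\mathrm{span}\{\delta_{st^{-1}}: s,t\in\Sigma\}$, unit $\delta_e$, and positive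 cone in $M_n(\mathrm{SOS}(\Sigma))$ consisting of the finite sums $\sum_i y_iy_i^*$ with $y_i=\sum_{s\in\Sigma}B^i_s\otimes\delta_s$, $B^i_s\in M_n(\mathbb C)$. For a $\mathcal B(H)$-valued Toeplitz matrix $T$ over $\Sigma$ let $\phi_T:\mathrm{SOS}(\Sigma)\to\mathcal B(H)$ be the linear map with $\phi_T(\delta_{st^{-1}})=T_{s,t}$, and let $\|T\|_{\mathrm d}:=\|\phi_T\|_{\mathrm{cb}}$ be the norm of $T$ in the operator space dual of $\mathrm{SOS}(\Sigma)$. Let the Toeplitz system $\mathrm{C}^*(\Gamma)^{(\Sigma)}\subseteq M_\Sigma(\mathbb C)$ be the space of $\mathbb C$-valued Toeplitz matrices, with the matrix order inherited from $M_\Sigma(\mathbb C)$, and let the Fourier system $\mathrm{C}^*(\Gamma)_{(\Sigma\Sigma^{-1})}$ be the space $\mathrm{span}\{\delta_{st^{-1}}:s,t\in\Sigma\}$ with the matrix order inherited from $\mathrm{C}^*(\Gamma)$. The dual $X^{\mathrm d}$ of a finite-dimensional operator system $X$ is its linear dual, where $(f_{ij})\in M_n(X^{\mathrm d})$ is positive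 iff $x\mapsto (f_{ij}(x))_{i,j}$ is a completely positive map $X\to M_n(\mathbb C)$. Two matrix ordered spaces are completely order isomorphic if there is a linear bijection between them that is completely positive together with its inverse. The following statements are equivalent. (i) ($\Sigma$ has the positive operator extension property.) For every Hilbert space $H$ and every positive semi-definite $\mathcal B(H)$-valued Toeplitz matrix $T$ over $\Sigma$ there is a positive semi-definite function $u:\Gamma\to\mathcal B(H)$ with $T_{s,t}=u(st^{-1})$ for all $s,t\in\Sigma$. (ii) ($\Sigma$ has the bounded operator extension property.) For every Hilbert space $H$ and every $\mathcal B(H)$-valued Toeplitz matrix $T$ over $\Sigma$ there is $u\in \mathrm B(\Gamma,H)$ with $T_{s,t}=u(st^{-1})$ for all $s,t\in\Sigma$ and $\|\phi_u\|_{\mathrm{cb}}=\|T\|_{\mathrm d}$. (iii) ($\Sigma$ has the complete Fejér–Riesz property.) For every $n\in\mathbb N$, every positive $x\in M_n(\mathrm{C}^*(\Gamma))$ of the form $x=\sum_{s,t\in\Sigma}A_{s,t}\otimes\delta_{st^{-1}}$ with $A_{s,t}\in M_n(\mathbb C)$ is a finite sum $x=\sum_{i=1}^r y_iy_i^*$ with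 each $y_i$ of the form $\sum_{s\in\Sigma}B^i_s\otimes\delta_s$, $B^i_s\in M_n(\mathbb C)$. (iv) The Toeplitz system $\mathrm{C}^*(\Gamma)^{(\Sigma)}$ is completely order isomorphic to the dual operator system of the Fourier system $\mathrm{C}^*(\Gamma)_{(\Sigma\Sigma^{-1})}$. -/

import Mathlib

open scoped ENNReal ComplexOrder

universe u v

noncomputable section

/-! ### The full group C*-algebra of a discrete group -/

/-- A unitary representation of the (discrete) group `G` on a non-zero complex Hilbert space. -/
structure UnitaryRep (G : Type u) [Group G] : Type (u + 1) where
  /-- the representation space -/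
  space : Type u
  [instNormed : NormedAddCommGroup space]
  [instInner : InnerProductSpace ℂ space]
  [instComplete : CompleteSpace space]
  [instNontrivial : Nontrivial space]
  /-- the action by unitary operators -/
  toHom : G →* unitary (space →L[ℂ] space)

namespace UnitaryRep

attribute [instance] instNormed instInner instComplete instNontrivial

end UnitaryRep

/-- The C*-algebra of bounded families of operators `(T_π)_π`, with `T_π` acting on the space of
the unitary representation `π`, where `π` runs through all unitary representations of `G`. -/
abbrev UniversalProduct (G : Type u) [Group G] : Type (u + 1) :=
  lp (fun π : UnitaryRep G => π.space →L[ℂ] π.space) ∞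

instance (G : Type u) [Group G] : CStarAlgebra (UniversalProduct G) where

/-- The universal representation: `g` is sent to the family `(π(g))_π`. -/
def universalRep {G : Type u} [Group G] (g : G) : UniversalProduct G :=
  ⟨fun π => (π.toHom g : π.space →L[ℂ] π.space), memℓp_infty ⟨1, by
    rintro _ ⟨π, rfl⟩
    exact (CStarRing.norm_coe_unitary (π.toHom g)).le⟩⟩

/-- The closed unital *-subalgebra generated by the image of the universal representation. -/
def groupCStarSubalgebra (G : Type u) [Group G] : StarSubalgebra ℂ (UniversalProduct G) :=
  (StarAlgebra.adjoin ℂ (Set.range (universalRep (G := G)))).topologicalClosure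

instance (G : Type u) [Group G] :
    IsClosed (groupCStarSubalgebra G : Set (UniversalProduct G)) :=
  StarSubalgebra.isClosed_topologicalClosure _

/-- The full (universal) group C*-algebra `C*(G)`: the completion of the group algebra in the norm
`‖a‖ = sup_π ‖π(a)‖`, realised as the C*-algebra generated by the universal representation. -/
def GroupCStar (G : Type u) [Group G] : Type (u + 1) := groupCStarSubalgebra G

instance (G : Type u) [Group G] : CStarAlgebra (GroupCStar G) :=
  inferInstanceAs (CStarAlgebra (groupCStarSubalgebra G))

/-- The usual order of a C*-algebra: `0 ≤ a` iff `a` is self-adjoint with nonnegative spectrum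
(iff `a = b* b` for some `b`). -/
instance (G : Type u) [Group G] : PartialOrder (GroupCStar G) := CStarAlgebra.spectralOrder _

instance (G : Type u) [Group G] : StarOrderedRing (GroupCStar G) :=
  CStarAlgebra.spectralOrderedRing _

/-- The canonical unitary generators `δ_g` of `C*(G)`. -/
def GroupCStar.delta {G : Type u} [Group G] (g : G) : GroupCStar G :=
  ⟨universalRep g, StarSubalgebra.le_topologicalClosure _
    (StarAlgebra.subset_adjoin ℂ _ ⟨g, rfl⟩)⟩

/-! ### Operator matrices, Toeplitz matrices, positive semi-definite functions -/

section Operators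

variable {H : Type v} [NormedAddCommGroup H] [InnerProductSpace ℂ H]

/-- The bounded operator on the Hilbert space `ℓ²(ι, H) = ℓ²(ι) ⊗ H` with operator matrix `T`,
that is, `(T ξ)_i = ∑_j T_{i,j} ξ_j`. -/
def blockOp {ι : Type*} [Fintype ι] (T : Matrix ι ι (H →L[ℂ] H)) :
    PiLp 2 (fun _ : ι => H) →L[ℂ] PiLp 2 (fun _ : ι => H) :=
  (PiLp.continuousLinearEquiv 2 ℂ (fun _ : ι => H)).symm.toContinuousLinearMap ∘L
    ContinuousLinearMap.pi fun i => ∑ j, T i j ∘L PiLp.proj 2 (fun _ : ι => H) j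

theorem blockOp_apply {ι : Type*} [Fintype ι] (T : Matrix ι ι (H →L[ℂ] H))
    (ξ : PiLp 2 (fun _ : ι => H)) (i : ι) : blockOp T ξ i = ∑ j, T i j (ξ j) := by
  simp [blockOp]

/-- A function `u : G → B(H)` is positive semi-definite if the operator matrix
`(u(s t⁻¹))_{s,t ∈ F}` is positive for every finite `F ⊆ G`. -/
def IsPosSemidefFun {G : Type u} [Group G] (u : G → H →L[ℂ] H) : Prop :=
  ∀ F : Finset G, (blockOp (Matrix.of fun s t : F => u ((s : G) * (t : G)⁻¹))).IsPositive

/-- The completely bounded norm `sup_n sup_{‖x‖ ≤ 1} ‖φ⁽ⁿ⁾(x)‖` of a map `φ : C*(G) → B(H)`, where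
`M_n(C*(G))` carries its C*-norm and `M_n(B(H))` is identified with `B(H^n)`. -/
def cbNorm {G : Type u} [Group G] (φ : GroupCStar G →L[ℂ] (H →L[ℂ] H)) : ℝ≥0∞ :=
  ⨆ (n : ℕ) (x : CStarMatrix (Fin n) (Fin n) (GroupCStar G)) (_ : ‖x‖ ≤ 1),
    ‖blockOp (Matrix.of fun i j : Fin n => φ (x i j))‖ₑ

end Operators

/-- The `B(H)`-valued Fourier-Stieltjes algebra `B(G, H)`: the linear span of the positive
semi-definite functions. -/
def fourierStieltjes (G : Type u) [Group G] (H : Type v) [NormedAddCommGroup H]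
    [InnerProductSpace ℂ H] : Submodule ℂ (G → H →L[ℂ] H) :=
  Submodule.span ℂ {u | IsPosSemidefFun u}

/-- A matrix indexed by a finite set `S ⊆ G` is Toeplitz if its `(s,t)` entry only depends on
`s t⁻¹`. -/
def IsToeplitz {G : Type u} [Group G] {S : Finset G} {B : Type*} (T : Matrix S S B) : Prop :=
  ∀ s₁ t₁ s₂ t₂ : S, (s₁ : G) * (t₁ : G)⁻¹ = (s₂ : G) * (t₂ : G)⁻¹ → T s₁ t₁ = T s₂ t₂

/-! ### Sums of squares and the complete Fejér-Riesz property -/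

section SumsOfSquares

variable {G : Type u} [Group G] {ι : Type} [Fintype ι]

/-- The elementary tensor `A ⊗ δ_g`, as an element of `M_ι(C*(G)) = M_ι ⊗ C*(G)`. -/
def tensorDelta (A : Matrix ι ι ℂ) (g : G) : CStarMatrix ι ι (GroupCStar G) :=
  CStarMatrix.ofMatrix (Matrix.of fun i j => A i j • GroupCStar.delta g)

/-- `y ∈ M_ι(C*(G))` is supported on `S` if `y = ∑_{s ∈ S} B_s ⊗ δ_s`. -/
def IsSupportedOn (S : Finset G) (y : CStarMatrix ι ι (GroupCStar G)) : Prop :=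
  ∃ B : S → Matrix ι ι ℂ, y = ∑ s : S, tensorDelta (B s) (s : G)

/-- The element `∑_{s,t ∈ S} A_{s,t} ⊗ δ_{st⁻¹}` of `M_ι(C*(G))`. -/
def stretch (S : Finset G) (A : S → S → Matrix ι ι ℂ) : CStarMatrix ι ι (GroupCStar G) :=
  ∑ s : S, ∑ t : S, tensorDelta (A s t) ((s : G) * (t : G)⁻¹)

/-- `x ∈ M_ι(C*(G))` stretches over `S` if `x = ∑_{s,t ∈ S} A_{s,t} ⊗ δ_{st⁻¹}` for some scalar
matrices `A_{s,t}`. -/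
def StretchesOver (S : Finset G) (x : CStarMatrix ι ι (GroupCStar G)) : Prop :=
  ∃ A : S → S → Matrix ι ι ℂ, x = stretch S A

/-- The finite sums of squares `∑_i y_i y_i*` of elements `y_i ∈ M_ι(C*(G))` supported on `S`. These
are the matrix cones of the sums-of-squares operator system `SOS(S)`. -/
def sosCone (S : Finset G) : Set (CStarMatrix ι ι (GroupCStar G)) :=
  {x | ∃ (r : ℕ) (y : Fin r → CStarMatrix ι ι (GroupCStar G)),
    (∀ i, IsSupportedOn S (y i)) ∧ x = ∑ i, y i * star (y i)}

/-- The complete Fejér-Riesz property of a finite set `S`. -/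
def CompleteFejerRieszProperty (S : Finset G) : Prop :=
  ∀ (n : ℕ) (x : CStarMatrix (Fin n) (Fin n) (GroupCStar G)),
    0 ≤ x → StretchesOver S x → x ∈ sosCone S

variable [DecidableEq ι]

/-- The closed unit ball of `M_ι(SOS(S))`. As in every operator system, an element `x` has norm at
most `1` iff the `2 × 2` block matrix with diagonal entries `1` and off-diagonal entries `x`, `x*`
is positive. -/
def sosUnitBall (S : Finset G) : Set (CStarMatrix ι ι (GroupCStar G)) :=
  {x | CStarMatrix.ofMatrix (Matrix.fromBlocks (1 : Matrix ι ι (GroupCStar G))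
    (CStarMatrix.ofMatrix.symm x) (CStarMatrix.ofMatrix.symm (star x)) 1) ∈
      sosCone (ι := ι ⊕ ι) S}

end SumsOfSquares

/-- The norm of a `B(H)`-valued Toeplitz matrix `T` in the operator space dual of `SOS(S)`: the
completely bounded norm of the map `φ_T : SOS(S) → B(H)`, `δ_{st⁻¹} ↦ T_{s,t}`, whose amplification
sends `∑ A_{s,t} ⊗ δ_{st⁻¹}` to `∑ A_{s,t} ⊗ T_{s,t}`. -/
def toeplitzCbNorm {G : Type u} [Group G] {S : Finset G} {H : Type v} [NormedAddCommGroup H]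
    [InnerProductSpace ℂ H] (T : Matrix S S (H →L[ℂ] H)) : ℝ≥0∞ :=
  ⨆ (n : ℕ) (A : S → S → Matrix (Fin n) (Fin n) ℂ) (_ : stretch S A ∈ sosUnitBall S),
    ‖blockOp (Matrix.of fun i j : Fin n => ∑ s : S, ∑ t : S, A s t i j • T s t)‖ₑ

/-! ### The operator extension properties -/

/-- The positive operator extension property of a finite set `S` (for Hilbert spaces `H` in an
arbitrary universe). -/
def PositiveOperatorExtensionProperty {G : Type u} [Group G] (S : Finset G) : Prop :=
  ∀ (H : Type v) [NormedAddCommGroup H] [InnerProductSpace ℂ H] [CompleteSpace H]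
    (T : Matrix S S (H →L[ℂ] H)), IsToeplitz T → (blockOp T).IsPositive →
    ∃ u : G → H →L[ℂ] H, IsPosSemidefFun u ∧ ∀ s t : S, T s t = u ((s : G) * (t : G)⁻¹)

/-- The bounded operator extension property of a finite set `S`. The map `φ` below, being bounded
with `φ(δ_g) = u(g)` for all `g`, is the unique map `φ_u : C*(G) → B(H)` associated with `u`. -/
def BoundedOperatorExtensionProperty {G : Type u} [Group G] (S : Finset G) : Prop :=
  ∀ (H : Type v) [NormedAddCommGroup H] [InnerProductSpace ℂ H] [CompleteSpace H]
    (T : Matrix S S (H →L[ℂ] H)), IsToeplitz T →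
    ∃ u ∈ fourierStieltjes G H, (∀ s t : S, T s t = u ((s : G) * (t : G)⁻¹)) ∧
      ∃ φ : GroupCStar G →L[ℂ] (H →L[ℂ] H),
        (∀ g : G, φ (GroupCStar.delta g) = u g) ∧ cbNorm φ = toeplitzCbNorm T

/-! ### Matrix orderings, duals, complete order isomorphisms -/

/-- A family of subsets `C_n ⊆ M_n(V)`, `n ∈ ℕ`, the positive matrix cones of `V`. -/
abbrev MatrixCones (V : Type*) := (n : ℕ) → Set (Matrix (Fin n) (Fin n) V)

/-- The matrix cones of the dual: `F = (F_{ij}) ∈ M_n(V^d)` is positive iff the corresponding map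
`V → M_n(ℂ)`, `v ↦ (F_{ij}(v))_{i,j}`, is completely positive. For a finite-dimensional operator
system `V` every linear functional is a combination of positive ones, so that `V^d` is the whole
algebraic dual. -/
def dualCones {V : Type*} [AddCommGroup V] [Module ℂ V] (C : MatrixCones V) :
    MatrixCones (Module.Dual ℂ V) :=
  fun n => {F | ∀ (k : ℕ), ∀ x ∈ C k,
    (Matrix.of fun p q : Fin k × Fin n => F p.2 q.2 (x p.1 q.1)).PosSemidef}

/-- `V` and `W` are completely order isomorphic: there is a linear bijection `f : V → W` such that
`f` and its inverse are completely positive. -/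
def CompletelyOrderIsomorphic {V W : Type*} [AddCommGroup V] [Module ℂ V] [AddCommGroup W]
    [Module ℂ W] (C : MatrixCones V) (D : MatrixCones W) : Prop :=
  ∃ f : V ≃ₗ[ℂ] W, (∀ n, ∀ x ∈ C n, x.map f ∈ D n) ∧ (∀ n, ∀ y ∈ D n, y.map f.symm ∈ C n)

/-- The underlying space of the Toeplitz system `C*(G)^{(S)}`: all complex Toeplitz matrices. -/
def toeplitzSystem {G : Type u} [Group G] (S : Finset G) : Submodule ℂ (Matrix S S ℂ) where
  carrier := {T | IsToeplitz T}
  add_mem' {A B} hA hB s₁ t₁ s₂ t₂ h := by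
    simp [hA s₁ t₁ s₂ t₂ h, hB s₁ t₁ s₂ t₂ h]
  zero_mem' _ _ _ _ _ := rfl
  smul_mem' c A hA s₁ t₁ s₂ t₂ h := by
    simp [hA s₁ t₁ s₂ t₂ h]

/-- The matrix cones of the Toeplitz system, inherited from the matrix algebra `M_S`: an element of
`M_n(C*(G)^{(S)})` is positive if it is positive semi-definite as a block matrix. -/
def toeplitzCones {G : Type u} [Group G] (S : Finset G) : MatrixCones (toeplitzSystem S) :=
  fun n => {x | (Matrix.of fun p q : Fin n × S =>
    (x p.1 q.1 : Matrix S S ℂ) p.2 q.2).PosSemidef}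

/-- The underlying space of the Fourier system `C*(G)_{(SS⁻¹)}`: the span of the elements
`δ_{st⁻¹}`, `s, t ∈ S`, in `C*(G)`. -/
def fourierSystem {G : Type u} [Group G] (S : Finset G) : Submodule ℂ (GroupCStar G) :=
  Submodule.span ℂ {a | ∃ s ∈ S, ∃ t ∈ S, a = GroupCStar.delta (s * t⁻¹)}

/-- The matrix cones of the Fourier system, inherited from `C*(G)`. -/
def fourierCones {G : Type u} [Group G] (S : Finset G) : MatrixCones (fourierSystem S) :=
  fun n => {x | 0 ≤ (CStarMatrix.ofMatrix (x.map (fun a => (a : GroupCStar G))) :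
    CStarMatrix (Fin n) (Fin n) (GroupCStar G))}

end

/-! Every implication passes through (iii), and the mechanism is a duality between coefficients and
kernels. A coefficient family `A` pairs with a matrix valued function `K` on the group through
`symbPair`. Sums of squares over `S` are the images of positive semi-definite matrices indexed by `S
× ι` (`mem_sosCone_iff`). These images form a closed convex cone, because the trace of the matrix
can be read off from the coefficients at the unit. By Hahn–Banach this cone is polar to the positive
semi-definite Toeplitz matrices over `S` (`exists_posSemidef_symb`). Positive elements of
M_n(C*(G)), by GNS, pair nonnegatively with kernels that are positive semi-definite on all of G
(`symbPair_nonneg_of_nonneg`). Hence (i) gives (iii) at once. Conversely, under (iii) a positive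
Toeplitz matrix defines a functional that is nonnegative on all sums of squares with coefficients in
SS⁻¹. M. Riesz's extension theorem (`exists_posSemidef_extension`) extends it to a global kernel,
and a Hamel basis of H turns the scalar kernel into operators (`exists_operators_of_kernel`).

(ii) gives (iii) because a unital complete contraction is completely positive: a positive Toeplitz
kernel is perturbed and normalised to be unital, extended, and denormalised. (iii) gives (ii) by
Paulsen's off-diagonal method: T and T* are placed off the diagonal of a 2 × 2 kernel whose diagonal
blocks are prescribed only at the unit, as multiples of the identity by the dual norm
(`re_offDiagKernel_nonneg`). The extension theorem fills in the rest, and a corner of the resulting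
dilation is the required map.

(iii) gives (iv) by evaluating functionals at the δ_{st⁻¹}. For (iv) ⇒ (iii) the isomorphism f is
arbitrary, and this is the hard direction. Put Ψ(g) = f⁻¹(coefficient functional at g), and let R ⊇
S be maximal with RR⁻¹ ⊆ SS⁻¹. Complete positivity of f yields Kraus operators U_k from ℂ^R to ℂ^S
with ∑ U_k* Ψ(g) U_k = shift_R(g) (`exists_factorization`). Positivity of Ψ together with maximality
of R forces Ψ(g) U_k = Ψ(1) U_k shift_R(g) (`mul_eq_mul_shift`). So Ψ(1)⁻¹Ψ(g) ↦ shift_R(g) extends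
to a surjection of the algebra generated by the Toeplitz matrices over S onto that over R, and a
dimension count gives R = S and bijectivity (`eq_of_surjective_algHom`). The inverse homomorphism
carries shift_S(g) to Ψ(1)⁻¹Ψ(g). Homomorphisms do not enlarge spectra, so positivity of ∑
shift_S(h) ⊗ K(h) passes to ∑ Ψ(h) ⊗ K(h) (`posSemidef_sum_of_algHom`), and applying f shows that K
is positive on the Fourier system. -/

noncomputable section

/-! ### Positive semi-definite kernels and the GNS construction -/

section Kernel

/-- A positive semi-definite kernel is the Gram matrix of a total family in a Hilbert space. -/
theorem exists_hilbert_of_posSemidef {X : Type u} (M : Matrix X X ℂ) (hM : M.PosSemidef) :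
    ∃ (E : Type u) (_ : NormedAddCommGroup E) (_ : InnerProductSpace ℂ E) (_ : CompleteSpace E)
      (e : X → E), (∀ x y, inner ℂ (e x) (e y) = M x y) ∧
        Dense (Submodule.span ℂ (Set.range e) : Set E) := by
  -- The scalar kernel is regarded as an operator valued kernel on ℂ; the kernel functions of its
  -- reproducing kernel Hilbert space, evaluated at 1, are the required vectors.
  let K : Matrix X X (ℂ →L[ℂ] ℂ) := Matrix.of fun x y => M x y • ContinuousLinearMap.id ℂ ℂ
  have hK : K.PosSemidef := by
    have htfae := (RKHS.posSemidef_tfae (K := K)).out 0 2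
    refine htfae.2 ⟨?_, fun w => ?_⟩
    · ext1 x y
      refine ContinuousLinearMap.ext_ring ?_
      simp only [K, Matrix.conjTranspose_apply, Matrix.of_apply, star_smul]
      rw [hM.1.apply]
      have : star (ContinuousLinearMap.id ℂ ℂ) = ContinuousLinearMap.id ℂ ℂ := star_one _
      simp [this]
    · have := (Complex.le_def.1 (hM.2 w)).1
      refine this.trans_eq (congrArg Complex.re ?_)
      refine Finsupp.sum_congr fun x _ => Finsupp.sum_congr fun y _ => ?_
      simp only [K, Matrix.of_apply, smul_apply, ContinuousLinearMap.id_apply,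
        RCLike.inner_apply, smul_eq_mul, map_mul]
      rw [show (starRingEnd ℂ) (M y x) = M x y from hM.1.apply x y]
      simp only [RCLike.star_def]; ring
  have : Fact K.PosSemidef := ⟨hK⟩
  have key : ∀ x y, inner ℂ (RKHS.kerFun (RKHS.OfKernel K) x (1 : ℂ))
      (RKHS.kerFun (RKHS.OfKernel K) y (1 : ℂ)) = M x y := fun x y => by
    rw [← RKHS.kernel_inner, RKHS.OfKernel.kernel_ofKernel]
    simp only [K, Matrix.of_apply, smul_apply, ContinuousLinearMap.id_apply,
      RCLike.inner_apply, smul_eq_mul, one_mul, mul_one]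
    exact hM.1.apply x y
  refine ⟨RKHS.OfKernel K, inferInstance, inferInstance, inferInstance,
    fun x => RKHS.kerFun (RKHS.OfKernel K) x (1 : ℂ), key, ?_⟩
  have h := RKHS.kerFun_dense (H := RKHS.OfKernel K)
  rw [← Submodule.dense_iff_topologicalClosure_eq_top] at h
  refine h.mono (Submodule.span_le.2 ?_)
  rintro _ ⟨x, c, rfl⟩
  have : RKHS.kerFun (RKHS.OfKernel K) x c = c • RKHS.kerFun (RKHS.OfKernel K) x (1 : ℂ) := by
    rw [← map_smul]; simp
  rw [this]
  exact Submodule.smul_mem _ _ (Submodule.subset_span ⟨x, rfl⟩)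

/-- A family of vectors with the same Gram matrix as a total family is its image under a bounded
operator. -/
theorem exists_clm_of_gram_eq {X : Type*} {E : Type*} [NormedAddCommGroup E] [InnerProductSpace ℂ E]
    [CompleteSpace E] {e f : X → E} (he : Dense (Submodule.span ℂ (Set.range e) : Set E))
    (hef : ∀ x y, inner ℂ (f x) (f y) = inner ℂ (e x) (e y)) :
    ∃ U : E →L[ℂ] E, ∀ x, U (e x) = f x := by
  have hnorm : ∀ c : X →₀ ℂ, ‖Finsupp.linearCombination ℂ f c‖ =
      ‖Finsupp.linearCombination ℂ e c‖ := fun c => by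
    have : ∀ g : X → E, (‖Finsupp.linearCombination ℂ g c‖ : ℝ) ^ 2 =
        RCLike.re (c.sum fun x a => c.sum fun y b => b * (star a * inner ℂ (g x) (g y))) :=
      fun g => by
      rw [← inner_self_eq_norm_sq (𝕜 := ℂ), Finsupp.linearCombination_apply, Finsupp.sum, sum_inner]
      simp only [inner_sum, inner_smul_left, inner_smul_right, Finsupp.sum,
        RCLike.star_def]
    have h2 := this f
    simp only [hef] at h2
    rw [← this e] at h2
    exact (sq_eq_sq₀ (norm_nonneg _) (norm_nonneg _)).1 h2
  have hd : DenseRange (Finsupp.linearCombination ℂ e) := by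
    rw [DenseRange]
    convert he
    rw [← Finsupp.range_linearCombination]; rfl
  refine ⟨LinearMap.extendOfNorm (Finsupp.linearCombination ℂ f) (Finsupp.linearCombination ℂ e),
    fun x => ?_⟩
  have := LinearMap.extendOfNorm_eq (f := Finsupp.linearCombination ℂ f) hd
    ⟨1, fun c => by rw [one_mul]; exact (hnorm c).le⟩ (Finsupp.single x 1)
  simpa using this

end Kernel

section Representations

variable {G : Type u} [Group G]

namespace UnitaryRep

/-- The operator `π(g)`. -/
def op (π : UnitaryRep G) (g : G) : π.space →L[ℂ] π.space := π.toHom g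

theorem op_mul (π : UnitaryRep G) (g h : G) : π.op (g * h) = π.op g * π.op h := by simp [op]

theorem op_one (π : UnitaryRep G) : π.op 1 = 1 := by simp [op]

theorem inner_op_left (π : UnitaryRep G) (g : G) (ξ η : π.space) :
    inner ℂ (π.op g ξ) η = inner ℂ ξ (π.op g⁻¹ η) := by
  have h := ContinuousLinearMap.inner_map_map_of_mem_unitary (π.toHom g).2 ξ (π.op g⁻¹ η)
  have h2 : π.op g (π.op g⁻¹ η) = η := by
    rw [← mul_apply_eq_comp, ← op_mul]; simp [op_one]
  rw [← h]
  exact congrArg _ h2.symm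

end UnitaryRep

/-- The GNS construction: a positive semi-definite matrix valued function on `G` is a matrix
coefficient of a unitary representation. -/
theorem exists_unitaryRep {J : Type} (K : G → J → J → ℂ)
    (hK : (Matrix.of fun p q : G × J => K (p.1 * q.1⁻¹) p.2 q.2).PosSemidef) :
    ∃ (π : UnitaryRep G) (ξ : J → π.space), ∀ g i j, inner ℂ (ξ i) (π.op g (ξ j)) = K g i j := by
  obtain ⟨E, _, _, _, e, he, hd⟩ := exists_hilbert_of_posSemidef _ hK
  simp only [Matrix.of_apply] at he
  by_cases hE : Nontrivial E
  swap
  -- A zero GNS space means that `K` vanishes. Representation spaces must be non-zero, so the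
  -- trivial representation with zero vectors serves.
  · rw [not_nontrivial_iff_subsingleton] at hE
    refine ⟨⟨EuclideanSpace ℂ PUnit.{u+1}, 1⟩, fun _ => 0, fun g i j => ?_⟩
    have := he (g, i) (1, j)
    rw [Subsingleton.elim (e (g, i)) 0] at this
    simp only [inner_zero_left, inv_one, mul_one] at this ⊢
    exact this
  have hext : ∀ A B : E →L[ℂ] E, (∀ x, A (e x) = B (e x)) → A = B := fun A B h =>
    ContinuousLinearMap.ext_on hd (by rintro _ ⟨x, rfl⟩; exact h x)
  -- The kernel depends only on `p.1 * q.1⁻¹`, so right translation by `g⁻¹` preserves Gram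
  -- matrices.
  have : ∀ g : G, ∃ U : E →L[ℂ] E, ∀ x, U (e x) = e (x.1 * g⁻¹, x.2) := fun g =>
    exists_clm_of_gram_eq hd (fun x y => by rw [he, he]; simp [mul_assoc])
  choose U hU using this
  have hmul : ∀ g h, U (g * h) = U g * U h := fun g h => hext _ _ fun x => by
    simp [hU, mul_assoc]
  have hone : U 1 = 1 := hext _ _ fun x => by simp [hU]
  have hstar : ∀ g, star (U g) = U g⁻¹ := fun g => hext _ _ fun x => by
    rw [ContinuousLinearMap.star_eq_adjoint]
    have : ∀ z : E, inner ℂ z ((ContinuousLinearMap.adjoint (U g)) (e x)) =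
        inner ℂ z (U g⁻¹ (e x)) := fun z => by
      rw [ContinuousLinearMap.adjoint_inner_right]
      have := ContinuousLinearMap.ext_on hd (f := (innerSL ℂ (e x)) ∘L U g)
        (g := innerSL ℂ (U g⁻¹ (e x))) (by
          rintro _ ⟨y, rfl⟩
          simp [hU, he, mul_assoc])
      have h3 := congrArg (starRingEnd ℂ) (DFunLike.congr_fun this z)
      simpa using h3
    exact ext_inner_left ℂ this
  let ρ : G →* unitary (E →L[ℂ] E) :=
    { toFun := fun g => ⟨U g, by
        rw [Unitary.mem_iff, hstar, ← hmul, ← hmul]; simp [hone]⟩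
      map_one' := Subtype.ext hone
      map_mul' := fun g h => Subtype.ext (hmul g h) }
  refine ⟨⟨E, ρ⟩, fun j => e (1, j), fun g i j => ?_⟩
  have : (UnitaryRep.mk E ρ).op g (e (1, j)) = e (g⁻¹, j) := by
    have := hU g (1, j)
    rw [one_mul] at this
    exact this
  rw [this]
  have := he (1, i) (g⁻¹, j)
  simpa using this

end Representations

/-! ### Positive semi-definite scalar matrices and quadratic forms. -/

section PosSemidef

/-- Positive semi-definiteness may be checked on finite submatrices. -/
theorem posSemidef_of_finset {X : Type*} {M : Matrix X X ℂ}
    (h : ∀ F : Finset X, (M.submatrix ((↑) : F → X) (↑)).PosSemidef) : M.PosSemidef := by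
  classical
  refine ⟨?_, fun c => ?_⟩
  · ext x y
    exact (h {x, y}).1.apply ⟨x, by simp⟩ ⟨y, by simp⟩
  · have := (h c.support).dotProduct_mulVec_nonneg (fun x => c x)
    refine this.trans_eq ?_
    simp only [dotProduct, Matrix.mulVec, Finsupp.sum, Matrix.submatrix_apply, Finset.mul_sum,
      Pi.star_apply]
    rw [← Finset.sum_coe_sort c.support]
    refine Finset.sum_congr rfl fun x _ => ?_
    rw [← Finset.sum_coe_sort c.support]
    exact Finset.sum_congr rfl fun y _ => by ring

theorem posSemidef_gram_family {X : Type*} {E : Type*} [NormedAddCommGroup E]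
    [InnerProductSpace ℂ E] (w : X → E) :
    (Matrix.of fun x y => inner ℂ (w x) (w y)).PosSemidef :=
  posSemidef_of_finset fun F => Matrix.posSemidef_gram ℂ (fun x : F => w x)

theorem Matrix.PosSemidef.sum_nonneg {X : Type*} [Fintype X] {M : Matrix X X ℂ}
    (h : M.PosSemidef) : 0 ≤ ∑ x, ∑ y, M x y := by
  have := h.dotProduct_mulVec_nonneg (fun _ => 1)
  simpa [dotProduct, Matrix.mulVec] using this

theorem Matrix.PosSemidef.sum_mul_nonneg {X : Type*} [Fintype X] {M : Matrix X X ℂ}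
    (h : M.PosSemidef) (c : X → ℂ) : 0 ≤ ∑ x, ∑ y, star (c x) * c y * M x y := by
  refine (h.dotProduct_mulVec_nonneg c).trans_eq ?_
  simp only [dotProduct, Matrix.mulVec, Finset.mul_sum, Pi.star_apply]
  exact Finset.sum_congr rfl fun _ _ => Finset.sum_congr rfl fun _ _ => by ring

/-- Over ℂ a real quadratic form already forces the matrix to be Hermitian, so no symmetry need be
assumed. -/
theorem Matrix.posSemidef_of_forall_nonneg {X : Type*} [Fintype X] {M : Matrix X X ℂ}
    (h : ∀ c : X → ℂ, 0 ≤ ∑ x, ∑ y, star (c x) * c y * M x y) : M.PosSemidef := by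
  classical
  have key : ∀ c : X → ℂ, 0 ≤ star c ⬝ᵥ (M.mulVec c) := fun c => by
    refine (h c).trans_eq ?_
    simp only [dotProduct, Matrix.mulVec, Finset.mul_sum, Pi.star_apply]
    exact Finset.sum_congr rfl fun _ _ => Finset.sum_congr rfl fun _ _ => by ring
  refine Matrix.PosSemidef.of_dotProduct_mulVec_nonneg ?_ key
  have hE : (Matrix.toEuclideanLin M).IsSymmetric := by
    rw [LinearMap.isSymmetric_iff_inner_map_self_real]
    intro c
    have h2 := key c.ofLp
    have h3 : inner ℂ ((Matrix.toEuclideanLin M) c) c = star (star c.ofLp ⬝ᵥ M.mulVec c.ofLp) := by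
      rw [← inner_conj_symm]
      simp [Matrix.toEuclideanLin, PiLp.inner_apply, dotProduct, Matrix.toLin'_apply, mul_comm]
    rw [h3]
    simp only [RCLike.star_def, Complex.conj_conj]
    exact (Complex.conj_eq_iff_im.2 (Complex.le_def.1 h2).2.symm).symm
  exact Matrix.isSymmetric_toEuclideanLin_iff.1 hE

end PosSemidef

/-! ### The group C*-algebra: representations, vector functionals, coefficients. -/

section GroupCStar

variable {G : Type u} [Group G]

namespace GroupCStar

theorem delta_mul (g h : G) : delta (g * h) = delta g * delta h := by
  refine Subtype.ext (Subtype.ext (funext fun π => ?_))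
  change ((π.toHom (g * h) : π.space →L[ℂ] π.space)) = (π.toHom g : π.space →L[ℂ] π.space) *
    (π.toHom h : π.space →L[ℂ] π.space)
  simp

theorem delta_one : delta (1 : G) = 1 := by
  refine Subtype.ext (Subtype.ext (funext fun π => ?_))
  change ((π.toHom (1 : G) : π.space →L[ℂ] π.space)) = 1
  simp

theorem star_delta (g : G) : star (delta g) = delta g⁻¹ := by
  refine Subtype.ext (Subtype.ext (funext fun π => ?_))
  change star ((π.toHom g : π.space →L[ℂ] π.space)) = π.toHom g⁻¹
  rw [map_inv]; rfl

/-- The representation of the group C*-algebra induced by a unitary representation. -/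
def rep (π : UnitaryRep G) : GroupCStar G →⋆ₐ[ℂ] (π.space →L[ℂ] π.space) where
  toFun x := (x.1 : UniversalProduct G) π
  map_one' := rfl
  map_mul' _ _ := rfl
  map_zero' := rfl
  map_add' _ _ := rfl
  commutes' _ := rfl
  map_star' _ := rfl

theorem rep_delta (π : UnitaryRep G) (g : G) : rep π (delta g) = π.op g := rfl

theorem continuous_rep (π : UnitaryRep G) : Continuous (rep π) :=
  AddMonoidHomClass.continuous_of_bound (rep π) 1 fun x => by
    rw [one_mul]
    exact lp.norm_apply_le_norm ENNReal.top_ne_zero (x.1 : UniversalProduct G) π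

/-- The generators are closed under products and adjoints, so their linear span is already the
*-algebra whose closure is C*(G). -/
theorem dense_span_delta :
    Dense (Submodule.span ℂ (Set.range (delta (G := G))) : Set (GroupCStar G)) := by
  have hr : ∀ g h : G, universalRep (g * h) = universalRep g * universalRep h := fun g h =>
    congrArg Subtype.val (delta_mul g h)
  have hs : ∀ g : G, star (universalRep g) = universalRep g⁻¹ := fun g =>
    congrArg Subtype.val (star_delta g)
  have hspan : (StarAlgebra.adjoin ℂ (Set.range (universalRep (G := G))) :
      Set (UniversalProduct G)) = Submodule.span ℂ (Set.range (universalRep (G := G))) := by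
    have h1 : Set.range (universalRep (G := G)) ∪ star (Set.range (universalRep (G := G))) =
        Set.range (universalRep (G := G)) := by
      refine Set.union_eq_self_of_subset_right ?_
      rintro x ⟨g, hg⟩
      exact ⟨g⁻¹, by rw [← hs, hg, star_star]⟩
    have h2 : (Algebra.adjoin ℂ (Set.range (universalRep (G := G)))).toSubmodule =
        Submodule.span ℂ (Set.range (universalRep (G := G))) := by
      rw [Algebra.adjoin_eq_span]
      congr 1
      refine subset_antisymm ?_ Submonoid.subset_closure
      have : Submonoid.closure (Set.range (universalRep (G := G))) ≤
          { carrier := Set.range (universalRep (G := G))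
            one_mem' := ⟨1, congrArg Subtype.val (delta_one (G := G))⟩
            mul_mem' := by rintro _ _ ⟨g, rfl⟩ ⟨h, rfl⟩; exact ⟨g * h, hr g h⟩ } :=
        Submonoid.closure_le.2 subset_rfl
      exact this
    rw [← h2]
    have h3 : (StarAlgebra.adjoin ℂ (Set.range (universalRep (G := G))) :
        Set (UniversalProduct G)) = (Subalgebra.toSubmodule (Algebra.adjoin ℂ
          (Set.range (universalRep (G := G)) ∪ star (Set.range (universalRep (G := G))))) :
        Set (UniversalProduct G)) := rfl
    rw [h3, h1]
  intro x
  rw [Metric.mem_closure_iff]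
  intro ε hε
  have hx : (x.1 : UniversalProduct G) ∈ closure
      (Submodule.span ℂ (Set.range (universalRep (G := G))) : Set (UniversalProduct G)) := by
    rw [← hspan]; exact x.2
  obtain ⟨b, hb, hxb⟩ := Metric.mem_closure_iff.1 hx ε hε
  have : b ∈ Submodule.map (groupCStarSubalgebra G).toSubalgebra.toSubmodule.subtype
      (Submodule.span ℂ (Set.range (delta (G := G)))) := by
    rw [Submodule.map_span]
    refine Submodule.span_mono ?_ hb
    rintro _ ⟨g, rfl⟩
    exact ⟨delta g, ⟨g, rfl⟩, rfl⟩
  obtain ⟨c, hc, rfl⟩ := this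
  exact ⟨c, hc, hxb⟩

theorem ext_clm {E : Type*} [AddCommMonoid E] [Module ℂ E] [TopologicalSpace E] [T2Space E]
    {φ ψ : GroupCStar G →L[ℂ] E} (h : ∀ g, φ (delta g) = ψ (delta g)) : φ = ψ :=
  ContinuousLinearMap.ext_on dense_span_delta (by rintro _ ⟨g, rfl⟩; exact h g)

/-- The vector functional `x ↦ ⟪η, π(x) ξ⟫`. -/
def vecFun (π : UnitaryRep G) (η ξ : π.space) : GroupCStar G →L[ℂ] ℂ where
  toFun x := inner ℂ η (rep π x ξ)
  map_add' x y := by simp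
  map_smul' c x := by simp
  cont := by
    have := continuous_rep π
    fun_prop

theorem vecFun_apply (π : UnitaryRep G) (η ξ : π.space) (x : GroupCStar G) :
    vecFun π η ξ x = inner ℂ η (rep π x ξ) := rfl

theorem _root_.CStarAlgebra.exists_star_mul_self_of_nonneg {A : Type*} [NonUnitalCStarAlgebra A]
    [PartialOrder A] [StarOrderedRing A] {a : A} (ha : 0 ≤ a) : ∃ b, a = star b * b :=
  CStarAlgebra.nonneg_iff_eq_star_mul_self.1 ha

/-- Writing the positive element as y*y exhibits the entries as inner products of the vectors
(π(y_{k,a}) ξ)_k. -/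
theorem posSemidef_vecFun {ι : Type*} [Fintype ι] {X : Type*} {x : CStarMatrix ι ι (GroupCStar G)}
    (hx : 0 ≤ x) (π : UnitaryRep G) (a : X → ι) (ξ : X → π.space) :
    (Matrix.of fun p q : X => vecFun π (ξ p) (ξ q) (x (a p) (a q))).PosSemidef := by
  obtain ⟨y, rfl⟩ := CStarAlgebra.exists_star_mul_self_of_nonneg hx
  have : (Matrix.of fun p q : X => vecFun π (ξ p) (ξ q) ((star y * y) (a p) (a q))) =
      Matrix.of fun p q : X => inner ℂ
        (WithLp.toLp 2 fun k => rep π (y k (a p)) (ξ p) : PiLp 2 fun _ : ι => π.space)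
        (WithLp.toLp 2 fun k => rep π (y k (a q)) (ξ q) : PiLp 2 fun _ : ι => π.space) := by
    ext p q
    simp only [Matrix.of_apply, PiLp.inner_apply, CStarMatrix.mul_apply,
      CStarMatrix.star_apply, map_sum]
    refine Finset.sum_congr rfl fun k _ => ?_
    rw [vecFun_apply, map_mul, map_star, mul_apply_eq_comp, ContinuousLinearMap.star_eq_adjoint,
      ContinuousLinearMap.adjoint_inner_right]
  rw [this]
  exact posSemidef_gram_family _

/-- This is the canonical trace as a vector state, obtained from the kernel of the standard
orthonormal family of ℓ²(G). It is what makes the δ_g linearly independent. -/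
theorem exists_trace : ∃ (π : UnitaryRep G) (ξ : π.space), ∀ g : G,
    inner ℂ ξ (π.op g ξ) = Set.indicator {1} 1 g := by
  classical
  obtain ⟨π, ξ, h⟩ := exists_unitaryRep (J := Unit)
    (fun g _ _ => Set.indicator {(1 : G)} (1 : G → ℂ) g) (by
      have := posSemidef_gram_family (fun p : G × Unit => lp.single (E := fun _ : G => ℂ) 2 p.1 1)
      convert this using 1
      ext p q
      simp [lp.inner_single_left, Set.indicator_apply, mul_inv_eq_one, Pi.single_apply])
  exact ⟨π, ξ (), fun g => h g () ()⟩

/-- The coefficient functional `∑ a_h δ_h ↦ a_g`. -/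
def coef (g : G) : GroupCStar G →L[ℂ] ℂ :=
  let π := (exists_trace (G := G)).choose
  let ξ : π.space := (exists_trace (G := G)).choose_spec.choose
  vecFun π (π.op g ξ) ξ

open Classical in
theorem coef_delta (g h : G) : coef g (delta h) = if h = g then 1 else 0 := by
  have := (exists_trace (G := G)).choose_spec.choose_spec
  rw [coef, vecFun_apply, rep_delta, UnitaryRep.inner_op_left, ← mul_apply_eq_comp,
    ← UnitaryRep.op_mul, this, Set.indicator_apply]
  simp [inv_mul_eq_one, eq_comm]

/-- With ξ the trace vector, `coef (p * q⁻¹)` is the functional x ↦ ⟪π(p)ξ, π(x)π(q)ξ⟫. Thus the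
coefficient functionals form a positive kernel with values in the dual of C*(G). -/
theorem posSemidef_coef {ι : Type*} [Fintype ι] {x : CStarMatrix ι ι (GroupCStar G)}
    (hx : 0 ≤ x) :
    (Matrix.of fun p q : G × ι => coef (p.1 * q.1⁻¹) (x p.2 q.2)).PosSemidef := by
  have hs := (exists_trace (G := G)).choose_spec.choose_spec
  let π := (exists_trace (G := G)).choose
  let ξ : π.space := (exists_trace (G := G)).choose_spec.choose
  have := posSemidef_vecFun hx π (fun p : G × ι => p.2) (fun p => π.op p.1 ξ)
  convert this using 1
  ext p q
  have : coef (p.1 * q.1⁻¹) = vecFun π (π.op p.1 ξ) (π.op q.1 ξ) := ext_clm fun h => by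
    classical
    rw [coef_delta, vecFun_apply, rep_delta, UnitaryRep.inner_op_left, ← mul_apply_eq_comp,
      ← mul_apply_eq_comp, ← UnitaryRep.op_mul, ← UnitaryRep.op_mul, hs, Set.indicator_apply]
    have : h = p.1 * q.1⁻¹ ↔ p.1⁻¹ * h * q.1 = 1 := by
      rw [mul_assoc, inv_mul_eq_one, eq_mul_inv_iff_mul_eq, eq_comm]
    simp [this]
  simp [this]

end GroupCStar

end GroupCStar

/-! ### Factorisation, trace bounds and compactness. -/

section PosSemidef

variable {X : Type*} [Fintype X]

open scoped MatrixOrder in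
theorem Matrix.PosSemidef.exists_eq_sum {Q : Matrix X X ℂ} (h : Q.PosSemidef) :
    ∃ B : Matrix X X ℂ, ∀ p q, Q p q = ∑ k, B p k * star (B q k) := by
  classical
  obtain ⟨B, hB⟩ := CStarAlgebra.nonneg_iff_eq_mul_star_self.1
    h.nonneg
  exact ⟨B, fun p q => by rw [hB]; rfl⟩

/-- A factorisation Q = BB* turns the pairing into a sum of quadratic forms of K, one for each
column of B. -/
theorem Matrix.PosSemidef.sum_mul_nonneg_of_posSemidef {Q K : Matrix X X ℂ} (hQ : Q.PosSemidef)
    (hK : K.PosSemidef) : 0 ≤ ∑ p, ∑ q, Q p q * K p q := by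
  obtain ⟨B, hB⟩ := hQ.exists_eq_sum
  have : ∑ p, ∑ q, Q p q * K p q =
      ∑ k, ∑ p, ∑ q, star (star (B p k)) * star (B q k) * K p q := by
    simp only [hB, Finset.sum_mul, star_star]
    refine Eq.trans (Finset.sum_congr rfl fun p _ => Finset.sum_comm) ?_
    rw [Finset.sum_comm]
  rw [this]
  exact Finset.sum_nonneg fun k _ => hK.sum_mul_nonneg _

/-- Follows from Q = BB* and 2ab ≤ a² + b². This bound makes the trace-bounded part of the positive
cone compact. -/
theorem Matrix.PosSemidef.norm_apply_le_trace {Q : Matrix X X ℂ} (h : Q.PosSemidef) (p q : X) :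
    ‖Q p q‖ ≤ Q.trace.re := by
  classical
  obtain ⟨B, hB⟩ := h.exists_eq_sum
  have htr : Q.trace.re = ∑ i, ∑ k, ‖B i k‖ ^ 2 := by
    simp only [Matrix.trace, Matrix.diag_apply, hB, Complex.re_sum]
    refine Finset.sum_congr rfl fun i _ => Finset.sum_congr rfl fun k _ => ?_
    rw [RCLike.star_def, Complex.mul_conj, Complex.ofReal_re, Complex.normSq_eq_norm_sq]
  have hle : ∀ i, ∑ k, ‖B i k‖ ^ 2 ≤ Q.trace.re := fun i => by
    rw [htr]
    exact Finset.single_le_sum (f := fun i => ∑ k, ‖B i k‖ ^ 2)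
      (fun i _ => Finset.sum_nonneg fun k _ => by positivity) (Finset.mem_univ i)
  rw [hB]
  refine (norm_sum_le _ _).trans ?_
  have : ∀ k, ‖B p k * star (B q k)‖ ≤ (‖B p k‖ ^ 2 + ‖B q k‖ ^ 2) / 2 := fun k => by
    rw [norm_mul, norm_star]
    nlinarith [sq_nonneg (‖B p k‖ - ‖B q k‖)]
  refine (Finset.sum_le_sum fun k _ => this k).trans ?_
  rw [← Finset.sum_div, Finset.sum_add_distrib]
  linarith [hle p, hle q]

theorem Matrix.isClosed_posSemidef : IsClosed {Q : Matrix X X ℂ | Q.PosSemidef} := by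
  have : {Q : Matrix X X ℂ | Q.PosSemidef} =
      ⋂ c : X → ℂ, {Q | 0 ≤ ∑ x, ∑ y, star (c x) * c y * Q x y} := by
    ext Q
    simp only [Set.mem_ofPred_eq, Set.mem_iInter]
    exact ⟨fun h c => h.sum_mul_nonneg c, Matrix.posSemidef_of_forall_nonneg⟩
  rw [this]
  refine isClosed_iInter fun c => isClosed_le continuous_const ?_
  exact continuous_finsetSum _ fun x _ => continuous_finsetSum _ fun y _ =>
    continuous_const.mul (continuous_id.matrix_elem x y)

theorem Matrix.isCompact_posSemidef_trace_le (c : ℝ) :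
    IsCompact {Q : Matrix X X ℂ | Q.PosSemidef ∧ Q.trace.re ≤ c} := by
  have hK : IsCompact (Set.pi Set.univ fun _ : X => Set.pi Set.univ fun _ : X =>
      Metric.closedBall (0 : ℂ) c) :=
    isCompact_univ_pi fun _ => isCompact_univ_pi fun _ => isCompact_closedBall _ _
  have hc : IsClosed {Q : Matrix X X ℂ | Q.PosSemidef ∧ Q.trace.re ≤ c} := by
    have : IsClosed {Q : Matrix X X ℂ | Q.trace.re ≤ c} :=
      isClosed_le (Complex.continuous_re.comp continuous_id.matrix_trace) continuous_const
    exact Matrix.isClosed_posSemidef.inter this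
  refine hK.of_isClosed_subset hc ?_
  rintro Q ⟨h1, h2⟩ i - j -
  simpa using (h1.norm_apply_le_trace i j).trans h2

open scoped Matrix.Norms.L2Operator MatrixOrder in
/-- A Hermitian matrix becomes positive semi-definite after adding a large multiple of `1`. -/
theorem Matrix.IsHermitian.exists_add_posSemidef [DecidableEq X] {R : Matrix X X ℂ}
    (h : R.IsHermitian) : ∃ c : ℝ, (R + (c : ℂ) • (1 : Matrix X X ℂ)).PosSemidef := by
  refine ⟨‖R‖, ?_⟩
  have h1 := IsSelfAdjoint.neg_algebraMap_norm_le_self (a := R) h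
  rw [neg_le_iff_add_nonneg, Matrix.nonneg_iff_posSemidef] at h1
  have h2 : R + (‖R‖ : ℂ) • (1 : Matrix X X ℂ) = R + algebraMap ℝ (Matrix X X ℂ) ‖R‖ := by
    rw [Algebra.algebraMap_eq_smul_one]
    ext i j
    simp
  rw [h2]
  exact h1

end PosSemidef

/-! ### Coefficients, their pairing with kernels, and the bipolar theorem. -/

section Stretch

variable {G : Type u} [Group G] {ι : Type*} [Fintype ι] {S : Finset G}

/-- The coefficients of `∑ A_{s,t} ⊗ δ_{st⁻¹}`. -/
def symb (A : S → S → Matrix ι ι ℂ) : G × ι × ι →₀ ℂ :=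
  ∑ s : S, ∑ t : S, ∑ i, ∑ j, Finsupp.single ((s : G) * (t : G)⁻¹, i, j) (A s t i j)

/-- The pairing of coefficient matrices with a function on the group. -/
def symbPair {M : Type*} [AddCommMonoid M] [Module ℂ M] (A : S → S → Matrix ι ι ℂ)
    (K : G → ι → ι → M) : M :=
  ∑ s : S, ∑ t : S, ∑ i, ∑ j, A s t i j • K ((s : G) * (t : G)⁻¹) i j

theorem symbPair_eq {M : Type*} [AddCommMonoid M] [Module ℂ M] (A : S → S → Matrix ι ι ℂ)
    (K : G → ι → ι → M) :
    symbPair A K = Finsupp.linearCombination ℂ (fun p : G × ι × ι => K p.1 p.2.1 p.2.2)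
      (symb A) := by
  simp [symbPair, symb, map_sum]

theorem symbPair_eq_of_symb_eq {M : Type*} [AddCommMonoid M] [Module ℂ M]
    {A B : S → S → Matrix ι ι ℂ} (h : symb A = symb B) (K : G → ι → ι → M) :
    symbPair A K = symbPair B K := by
  rw [symbPair_eq, symbPair_eq, h]

open Classical in
theorem symb_apply (A : S → S → Matrix ι ι ℂ) (p : G × ι × ι) :
    symb A p = symbPair A fun g i j => if (g, i, j) = p then 1 else 0 := by
  simp [symbPair, symb, Finsupp.finsetSum_apply, Finsupp.single_apply]

open Classical in
theorem map_coe_symb {M : Type*} [AddCommMonoid M] [Module ℂ M] (A : S → S → Matrix ι ι ℂ)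
    (F : (G × ι × ι → ℂ) →ₗ[ℂ] M) :
    F (symb A) = symbPair A fun g i j => F (Pi.single (g, i, j) 1) := by
  rw [symbPair_eq]
  have : F ∘ₗ Finsupp.lcoeFun = Finsupp.linearCombination ℂ
      (fun p : G × ι × ι => F (Pi.single (p.1, p.2.1, p.2.2) 1)) :=
    Finsupp.lhom_ext' fun p => LinearMap.ext_ring (by
      simp [Finsupp.lcoeFun, Finsupp.single_eq_pi_single])
  exact LinearMap.congr_fun this (symb A)

/-- The blocks of a matrix indexed by `S × ι`. -/
def blocks (Q : Matrix (S × ι) (S × ι) ℂ) : S → S → Matrix ι ι ℂ :=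
  fun s t => Matrix.of fun i j => Q (s, i) (t, j)

/-- The Toeplitz matrix `(K(st⁻¹)_{ij})` indexed by `S × ι`. -/
def toeplitzMatrix (S : Finset G) (K : G → ι → ι → ℂ) : Matrix (S × ι) (S × ι) ℂ :=
  Matrix.of fun p q => K ((p.1 : G) * (q.1 : G)⁻¹) p.2 q.2

theorem symbPair_blocks (Q : Matrix (S × ι) (S × ι) ℂ) (K : G → ι → ι → ℂ) :
    symbPair (blocks Q) K = ∑ p, ∑ q, Q p q * toeplitzMatrix S K p q := by
  simp only [symbPair, blocks, toeplitzMatrix, Matrix.of_apply, smul_eq_mul, Fintype.sum_prod_type]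
  exact Finset.sum_congr rfl fun s _ => Finset.sum_comm

theorem symbPair_add {M : Type*} [AddCommMonoid M] [Module ℂ M] (A : S → S → Matrix ι ι ℂ)
    (K L : G → ι → ι → M) : symbPair A (K + L) = symbPair A K + symbPair A L := by
  simp [symbPair, Finset.sum_add_distrib]

theorem symbPair_smul (A : S → S → Matrix ι ι ℂ) (c : ℂ) (K : G → ι → ι → ℂ) :
    symbPair A (c • K) = c * symbPair A K := by
  simp [symbPair, Finset.mul_sum, mul_left_comm]

theorem symb_blocks_add (Q R : Matrix (S × ι) (S × ι) ℂ) :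
    symb (blocks (Q + R)) = symb (blocks Q) + symb (blocks R) := by
  simp [symb, blocks, Finset.sum_add_distrib]

theorem symb_blocks_smul (c : ℂ) (Q : Matrix (S × ι) (S × ι) ℂ) :
    symb (blocks (c • Q)) = c • symb (blocks Q) := by
  simp [symb, blocks, Finset.smul_sum]

open Classical in
/-- The kernel of the identity matrix. -/
def kerOne (G : Type*) [Group G] (ι : Type*) : G → ι → ι → ℂ :=
  fun g i j => if g = 1 ∧ i = j then 1 else 0

open Classical in
theorem toeplitzMatrix_kerOne : toeplitzMatrix S (kerOne G ι) = 1 := by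
  ext ⟨s, i⟩ ⟨t, j⟩
  simp only [toeplitzMatrix, kerOne, Matrix.of_apply, Matrix.one_apply, mul_inv_eq_one,
    Prod.mk.injEq, Subtype.ext_iff]

section Bipolar

/-- The trace of Q equals a continuous function of its coefficients, namely the sum of the diagonal
ones at the unit. Near a given limit point only Q of bounded trace matter; these form a compact set,
whose image is closed. -/
theorem isClosed_symb_posSemidef (S : Finset G) : IsClosed {z : G × ι × ι → ℂ |
    ∃ Q : Matrix (S × ι) (S × ι) ℂ, Q.PosSemidef ∧ z = symb (blocks Q)} := by
  classical
  let L : Matrix (S × ι) (S × ι) ℂ → G × ι × ι → ℂ := fun Q => symb (blocks Q)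
  have hLc : Continuous L := by
    refine continuous_pi fun p => ?_
    simp only [L, symb_apply, symbPair]
    refine continuous_finsetSum _ fun s _ => continuous_finsetSum _ fun t _ =>
      continuous_finsetSum _ fun i _ => continuous_finsetSum _ fun j _ => ?_
    exact (continuous_id.matrix_elem (s, i) (t, j)).smul continuous_const
  let tr : (G × ι × ι → ℂ) → ℝ := fun z => ∑ i, (z (1, i, i)).re
  have htrc : Continuous tr := by fun_prop
  have htr : ∀ Q : Matrix (S × ι) (S × ι) ℂ, Q.trace.re = tr (L Q) := fun Q => by
    let F : (G × ι × ι → ℂ) →ₗ[ℂ] ℂ := ∑ i, LinearMap.proj (1, i, i)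
    have h1 := map_coe_symb (blocks Q) F
    have h2 : (fun g i j => F (Pi.single (g, i, j) 1)) = kerOne G ι := by
      funext g i j
      simp only [F, LinearMap.sum_apply, LinearMap.proj_apply, Pi.single_apply, kerOne,
        Prod.mk.injEq]
      rw [Finset.sum_eq_single i]
      · simp [eq_comm]
      · intro k _ hk; simp [hk]
      · simp
    rw [h2, symbPair_blocks, toeplitzMatrix_kerOne] at h1
    have h3 : tr (L Q) = (F (symb (blocks Q))).re := by simp [tr, F, L]
    rw [h3, h1]
    simp [Matrix.trace, Matrix.one_apply]
  rw [← closure_subset_iff_isClosed]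
  intro z hz
  have hz2 : z ∈ closure (L '' {Q | Q.PosSemidef ∧ Q.trace.re ≤ tr z + 1}) := by
    have ho : IsOpen {w | tr w < tr z + 1} := isOpen_lt htrc continuous_const
    refine closure_mono ?_ (ho.inter_closure ⟨lt_add_one (tr z), hz⟩)
    rintro _ ⟨hw, Q, hQ, rfl⟩
    exact ⟨Q, ⟨hQ, by rw [htr]; exact le_of_lt hw⟩, rfl⟩
  have hcl : IsClosed (L '' {Q | Q.PosSemidef ∧ Q.trace.re ≤ tr z + 1}) :=
    ((Matrix.isCompact_posSemidef_trace_le _).image hLc).isClosed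
  rw [hcl.closure_eq] at hz2
  obtain ⟨Q, hQ, rfl⟩ := hz2
  exact ⟨Q, hQ.1, rfl⟩

/-- The conjugate transpose of a matrix valued function on `G`. -/
def kerStar (K : G → ι → ι → ℂ) : G → ι → ι → ℂ := fun g i j => star (K g⁻¹ j i)

theorem toeplitzMatrix_kerStar (K : G → ι → ι → ℂ) :
    toeplitzMatrix S (kerStar K) = (toeplitzMatrix S K).conjTranspose := by
  ext p q
  simp [toeplitzMatrix, kerStar]

/-- The bipolar theorem for sums of squares: if the coefficients of `A` pair nonnegatively with all
positive semi-definite Toeplitz matrices, then they are those of a positive semi-definite matrix. -/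
theorem exists_posSemidef_symb {A : S → S → Matrix ι ι ℂ}
    (hA : ∀ K : G → ι → ι → ℂ, (toeplitzMatrix S K).PosSemidef → 0 ≤ symbPair A K) :
    ∃ Q : Matrix (S × ι) (S × ι) ℂ, Q.PosSemidef ∧ symb (blocks Q) = symb A := by
  classical
  by_contra hcon
  let C : Set (G × ι × ι → ℂ) := {z | ∃ Q : Matrix (S × ι) (S × ι) ℂ, Q.PosSemidef ∧
    z = symb (blocks Q)}
  have hconv : Convex ℝ C := by
    rintro _ ⟨Q, hQ, rfl⟩ _ ⟨R, hR, rfl⟩ a b ha hb -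
    refine ⟨(a : ℂ) • Q + (b : ℂ) • R, (hQ.smul (Complex.zero_le_real.2 ha)).add
      (hR.smul (Complex.zero_le_real.2 hb)), ?_⟩
    rw [symb_blocks_add, symb_blocks_smul, symb_blocks_smul]
    funext p
    simp
  have hnot : (symb A : G × ι × ι → ℂ) ∉ C := by
    rintro ⟨Q, hQ, h⟩
    exact hcon ⟨Q, hQ, DFunLike.coe_injective h.symm⟩
  obtain ⟨F, c, hF, hc⟩ := RCLike.geometric_hahn_banach_closed_point (𝕜 := ℂ) hconv
    (isClosed_symb_posSemidef S) hnot
  simp only [RCLike.re_to_complex] at hF hc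
  -- The separating functional, with its sign reversed, read as a kernel.
  let K : G → ι → ι → ℂ := fun g i j => -F (Pi.single (g, i, j) 1)
  have hFK : ∀ B : S → S → Matrix ι ι ℂ, symbPair B K = -F (symb B) := fun B => by
    have := map_coe_symb B F.toLinearMap
    have h2 : K = (-1 : ℂ) • fun g i j => F (Pi.single (g, i, j) 1) := by
      funext g i j; simp [K]
    rw [h2, symbPair_smul, neg_one_mul]
    exact congrArg _ this.symm
  -- The bound `c` holds on a whole cone; scaling Q by large `n` shows that the functional is
  -- nonpositive there.
  have hpos : ∀ Q : Matrix (S × ι) (S × ι) ℂ, Q.PosSemidef →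
      0 ≤ (symbPair (blocks Q) K).re := fun Q hQ => by
    rw [hFK, Complex.neg_re, Left.nonneg_neg_iff]
    by_contra! hr
    obtain ⟨n, hn⟩ := Archimedean.arch c hr
    have hmul : (F (symb (blocks ((n : ℂ) • Q)))).re = n * (F (symb (blocks Q))).re := by
      rw [symb_blocks_smul, Finsupp.coe_smul, map_smul]
      simp
    have := hF _ ⟨(n : ℂ) • Q, hQ.smul (by positivity), rfl⟩
    rw [hmul] at this
    rw [nsmul_eq_mul] at hn
    linarith
  have hneg : (symbPair A K).re < 0 := by
    have h0 := hF 0 ⟨0, Matrix.PosSemidef.zero, by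
      funext p; rw [symb_apply]; simp [symbPair, blocks]⟩
    rw [hFK, Complex.neg_re]
    simp only [map_zero, Complex.zero_re] at h0
    linarith
  -- A Hermitian Toeplitz matrix is the difference of a positive one and a real multiple of the
  -- identity, and `hA` makes the pairings with both real.
  have hherm : ∀ R : G → ι → ι → ℂ, (toeplitzMatrix S R).IsHermitian → (symbPair A R).im = 0 :=
    fun R hR => by
    obtain ⟨c, hc⟩ := hR.exists_add_posSemidef
    have h1 := hA (kerOne G ι) (by rw [toeplitzMatrix_kerOne]; exact Matrix.PosSemidef.one)
    have h2 := hA (R + (c : ℂ) • kerOne G ι) (by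
      have : toeplitzMatrix S (R + (c : ℂ) • kerOne G ι) = toeplitzMatrix S R +
        (c : ℂ) • toeplitzMatrix S (kerOne G ι) := by ext; simp [toeplitzMatrix]
      rw [this, toeplitzMatrix_kerOne]; exact hc)
    rw [symbPair_add, symbPair_smul, Complex.le_def] at h2
    rw [Complex.le_def] at h1
    have := h2.2
    simp only [Complex.add_im, Complex.mul_im, Complex.ofReal_re, Complex.ofReal_im, Complex.zero_im] at this h1
    rw [← h1.2] at this
    linarith
  -- K = Kh + i Ks with both parts Hermitian. The pairing with Ks is real, so only Kh contributes to
  -- the real part. Since Kh is positive on S by `hpos`, this contradicts `hneg`.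
  let Kh : G → ι → ι → ℂ := (1 / 2 : ℂ) • (K + kerStar K)
  let Ks : G → ι → ι → ℂ := (-Complex.I / 2) • (K + (-1 : ℂ) • kerStar K)
  have hKs : (symbPair A Ks).im = 0 := hherm _ (by
    have : toeplitzMatrix S Ks = (-Complex.I / 2) •
        (toeplitzMatrix S K + (-1 : ℂ) • toeplitzMatrix S (kerStar K)) := by
      ext; simp [toeplitzMatrix, Ks]; ring
    rw [this, toeplitzMatrix_kerStar, Matrix.IsHermitian]
    ext p q
    simp only [Matrix.conjTranspose_apply, Matrix.smul_apply, Matrix.add_apply, smul_eq_mul,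
      star_mul', star_add, star_star, star_div₀, star_neg]
    simp
    ring)
  have hKh : 0 ≤ symbPair A Kh := hA _ (by
    refine Matrix.posSemidef_of_forall_nonneg fun v => ?_
    have h1 := hpos _ (Matrix.posSemidef_vecMulVec_star_self v)
    rw [symbPair_blocks] at h1
    simp only [Matrix.vecMulVec_apply, Pi.star_apply] at h1
    set z := ∑ p, ∑ q, star (v p) * v q * toeplitzMatrix S K p q with hz
    have h2 : ∑ p, ∑ q, star (v p) * v q * toeplitzMatrix S (kerStar K) p q = star z := by
      rw [toeplitzMatrix_kerStar, hz, Finset.sum_comm, star_sum]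
      refine Finset.sum_congr rfl fun p _ => ?_
      rw [star_sum]
      refine Finset.sum_congr rfl fun q _ => ?_
      simp [mul_comm]
    have h3 : ∑ p, ∑ q, star (v p) * v q * toeplitzMatrix S Kh p q = (1 / 2) * (z + star z) := by
      rw [← h2, hz, ← Finset.sum_add_distrib, Finset.mul_sum]
      refine Finset.sum_congr rfl fun p _ => ?_
      rw [← Finset.sum_add_distrib, Finset.mul_sum]
      refine Finset.sum_congr rfl fun q _ => ?_
      simp only [toeplitzMatrix, Kh, Matrix.of_apply, Pi.smul_apply, Pi.add_apply, smul_eq_mul]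
      ring
    rw [h3, RCLike.star_def, Complex.add_conj, Complex.le_def]
    simp [h1])
  have hsum : K = Kh + Complex.I • Ks := by
    funext g i j
    simp only [Kh, Ks, Pi.add_apply, Pi.smul_apply, smul_eq_mul]
    linear_combination ((1 / 2) * (K g i j - kerStar K g i j)) * Complex.I_mul_I
  have := (Complex.le_def.1 hKh).1
  rw [hsum, symbPair_add, symbPair_smul A Complex.I Ks, Complex.add_re, Complex.mul_re] at hneg
  simp only [hKs, Complex.I_re, Complex.I_im, Complex.zero_re] at hneg this
  linarith

end Bipolar

end Stretch

/-! ### Sums of squares as Gram matrices. -/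

section SumsOfSquares

variable {G : Type u} [Group G] {ι : Type} [Fintype ι] {S : Finset G}

theorem tensorDelta_apply (A : Matrix ι ι ℂ) (g : G) (i j : ι) :
    tensorDelta A g i j = A i j • GroupCStar.delta g := rfl

theorem CStarMatrix.sum_apply {κ m n A : Type*} [AddCommMonoid A] (F : Finset κ)
    (f : κ → CStarMatrix m n A) (i : m) (j : n) : (∑ k ∈ F, f k) i j = ∑ k ∈ F, f k i j := by
  classical
  induction F using Finset.induction_on with
  | empty => simp
  | insert a s ha ih => rw [Finset.sum_insert ha, Finset.sum_insert ha, CStarMatrix.add_apply, ih]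

theorem stretch_apply (A : S → S → Matrix ι ι ℂ) (i j : ι) :
    stretch S A i j = ∑ s : S, ∑ t : S, A s t i j • GroupCStar.delta ((s : G) * (t : G)⁻¹) := by
  simp only [stretch, CStarMatrix.sum_apply, tensorDelta_apply]

open Classical in
theorem stretch_apply_eq_symbPair (A : S → S → Matrix ι ι ℂ) (i j : ι) :
    stretch S A i j = symbPair A fun g i' j' =>
      if i' = i then if j' = j then GroupCStar.delta g else 0 else 0 := by
  simp [stretch_apply, symbPair]

theorem coef_stretch (A : S → S → Matrix ι ι ℂ) (g : G) (i j : ι) :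
    GroupCStar.coef g (stretch S A i j) = symb A (g, i, j) := by
  classical
  rw [stretch_apply_eq_symbPair, symb_apply]
  simp only [symbPair, map_sum, map_smul]
  refine Finset.sum_congr rfl fun s _ => Finset.sum_congr rfl fun t _ =>
    Finset.sum_congr rfl fun i' _ => Finset.sum_congr rfl fun j' _ => ?_
  congr 1
  by_cases hi : i' = i <;> by_cases hj : j' = j <;> simp [hi, hj, GroupCStar.coef_delta]

/-- The δ_g are linearly independent, as the coefficient functionals show. The family `A` itself is
not determined, since different pairs may have the same quotient. -/
theorem stretch_eq_iff {A B : S → S → Matrix ι ι ℂ} :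
    stretch S A = stretch S B ↔ symb A = symb B := by
  refine ⟨fun h => Finsupp.ext fun p => ?_, fun h => CStarMatrix.ext fun i j => ?_⟩
  · rw [← coef_stretch A p.1 p.2.1 p.2.2, h, coef_stretch]
  · rw [stretch_apply_eq_symbPair, stretch_apply_eq_symbPair, symbPair_eq_of_symb_eq h]

theorem supported_apply (B : S → Matrix ι ι ℂ) (i j : ι) :
    (∑ s : S, tensorDelta (B s) (s : G)) i j = ∑ s : S, B s i j • GroupCStar.delta (s : G) := by
  simp only [CStarMatrix.sum_apply, tensorDelta_apply]

theorem supported_mul_star (B : S → Matrix ι ι ℂ) :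
    (∑ s : S, tensorDelta (B s) (s : G)) * star (∑ s : S, tensorDelta (B s) (s : G)) =
      stretch S (fun s t => B s * (B t).conjTranspose) := by
  refine CStarMatrix.ext fun i j => ?_
  rw [CStarMatrix.mul_apply, stretch_apply]
  simp only [CStarMatrix.star_apply, supported_apply, star_sum, star_smul, GroupCStar.star_delta,
    Finset.sum_mul, Finset.mul_sum, smul_mul_smul_comm, ← GroupCStar.delta_mul, Matrix.mul_apply,
    Matrix.conjTranspose_apply, Finset.sum_smul]
  rw [Finset.sum_comm]
  refine Eq.trans ?_ Finset.sum_comm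
  refine Finset.sum_congr rfl fun s _ => ?_
  rw [Finset.sum_comm]

theorem stretch_sum {κ : Type*} (F : Finset κ) (A : κ → S → S → Matrix ι ι ℂ) :
    ∑ k ∈ F, stretch S (A k) = stretch S (fun s t => ∑ k ∈ F, A k s t) := by
  refine CStarMatrix.ext fun i j => ?_
  rw [CStarMatrix.sum_apply]
  simp only [stretch_apply, Matrix.sum_apply, Finset.sum_smul]
  rw [Finset.sum_comm]
  refine Finset.sum_congr rfl fun s _ => ?_
  rw [Finset.sum_comm]

/-- The Gram matrix method: the coefficients of the y_i, put side by side as columns, form a matrix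
C with Q = CC*. Conversely a square factor of Q, cut into `S` groups of columns, gives one square
per group. -/
theorem mem_sosCone_iff {x : CStarMatrix ι ι (GroupCStar G)} : x ∈ sosCone S ↔
    ∃ Q : Matrix (S × ι) (S × ι) ℂ, Q.PosSemidef ∧ x = stretch S (blocks Q) := by
  classical
  constructor
  · rintro ⟨r, y, hy, rfl⟩
    choose B hB using hy
    let C : Matrix (S × ι) (Fin r × ι) ℂ := Matrix.of fun p k => B k.1 p.1 p.2 k.2
    refine ⟨C * C.conjTranspose, Matrix.posSemidef_self_mul_conjTranspose C, ?_⟩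
    simp only [hB, supported_mul_star]
    rw [stretch_sum]
    congr 1
    funext s t
    ext i j
    simp [Matrix.sum_apply, blocks, Matrix.mul_apply, C, Fintype.sum_prod_type]
  · rintro ⟨Q, hQ, rfl⟩
    obtain ⟨B, hB⟩ := hQ.exists_eq_sum
    let e := Fintype.equivFin S
    let y : S → S → Matrix ι ι ℂ := fun k s => Matrix.of fun i j => B (s, i) (k, j)
    refine ⟨Fintype.card S, fun k => ∑ s : S, tensorDelta (y (e.symm k) s) (s : G),
      fun k => ⟨_, rfl⟩, ?_⟩
    simp only [supported_mul_star]
    rw [stretch_sum]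
    congr 1
    funext s t
    ext i j
    rw [Equiv.sum_comp e.symm (fun k => y k s * (y k t).conjTranspose)]
    simp [Matrix.sum_apply, blocks, Matrix.mul_apply, y, hB, Fintype.sum_prod_type]

theorem nonneg_of_mem_sosCone {x : CStarMatrix ι ι (GroupCStar G)} (hx : x ∈ sosCone S) :
    0 ≤ x := by
  obtain ⟨r, y, -, rfl⟩ := hx
  exact Finset.sum_nonneg fun i _ => mul_star_self_nonneg (y i)

theorem symbPair_nonneg_of_mem_sosCone {A : S → S → Matrix ι ι ℂ} (hA : stretch S A ∈ sosCone S)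
    {K : G → ι → ι → ℂ} (hK : (toeplitzMatrix S K).PosSemidef) : 0 ≤ symbPair A K := by
  obtain ⟨Q, hQ, h⟩ := mem_sosCone_iff.1 hA
  rw [symbPair_eq_of_symb_eq (stretch_eq_iff.1 h), symbPair_blocks]
  exact hQ.sum_mul_nonneg_of_posSemidef hK

theorem mem_sosCone_of_forall_symbPair {A : S → S → Matrix ι ι ℂ}
    (hA : ∀ K : G → ι → ι → ℂ, (toeplitzMatrix S K).PosSemidef → 0 ≤ symbPair A K) :
    stretch S A ∈ sosCone S := by
  obtain ⟨Q, hQ, h⟩ := exists_posSemidef_symb hA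
  exact mem_sosCone_iff.2 ⟨Q, hQ, (stretch_eq_iff.2 h).symm⟩

/-- By GNS the kernel has the form ⟪ξ_i, π(g) ξ_j⟫, so the pairing is ∑ ⟪ξ_i, π(x_{ij}) ξ_j⟫ for the
positive matrix x. -/
theorem symbPair_nonneg_of_nonneg {A : S → S → Matrix ι ι ℂ} (hA : 0 ≤ stretch S A)
    {K : G → ι → ι → ℂ}
    (hK : (Matrix.of fun p q : G × ι => K (p.1 * q.1⁻¹) p.2 q.2).PosSemidef) :
    0 ≤ symbPair A K := by
  obtain ⟨π, ξ, h⟩ := exists_unitaryRep K hK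
  refine (GroupCStar.posSemidef_vecFun hA π id ξ).sum_nonneg.trans_eq ?_
  simp only [Matrix.of_apply, id, stretch_apply, map_sum, map_smul, GroupCStar.vecFun_apply,
    GroupCStar.rep_delta, h, symbPair]
  simp only [← Finset.sum_product', Finset.univ_product_univ]
  let e : ι × ι × S × S ≃ S × S × ι × ι :=
    ⟨fun p => (p.2.2.1, p.2.2.2, p.1, p.2.1), fun p => (p.2.2.1, p.2.2.2, p.1, p.2.1),
      fun _ => rfl, fun _ => rfl⟩
  exact Fintype.sum_equiv e _ _ fun _ => rfl

end SumsOfSquares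

/-! ### Positivity of block operators in terms of scalar matrices. -/

section BlockOp

variable {H : Type*} [NormedAddCommGroup H] [InnerProductSpace ℂ H]

theorem inner_blockOp {κ : Type*} [Fintype κ] (T : Matrix κ κ (H →L[ℂ] H))
    (ξ η : PiLp 2 (fun _ : κ => H)) :
    inner ℂ ξ (blockOp T η) = ∑ k, ∑ l, inner ℂ (ξ k) (T k l (η l)) := by
  simp [PiLp.inner_apply, blockOp_apply, inner_sum]

theorem isPositive_iff_inner_nonneg {T : H →L[ℂ] H} :
    T.IsPositive ↔ ∀ ξ, 0 ≤ inner ℂ ξ (T ξ) := by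
  rw [ContinuousLinearMap.isPositive_iff_complex]
  refine forall_congr' fun ξ => ?_
  rw [← inner_conj_symm ξ (T ξ), Complex.le_def, Complex.ext_iff]
  simp only [RCLike.re_to_complex, Complex.ofReal_re, Complex.ofReal_im, Complex.zero_re,
    Complex.zero_im, Complex.conj_re, Complex.conj_im, true_and, zero_eq_neg]
  exact ⟨fun h => ⟨h.2, h.1.symm⟩, fun h => ⟨h.2.symm, h.1⟩⟩

theorem blockOp_isPositive_iff {κ : Type*} [Fintype κ] {T : Matrix κ κ (H →L[ℂ] H)} :
    (blockOp T).IsPositive ↔ ∀ ξ : κ → H, 0 ≤ ∑ k, ∑ l, inner ℂ (ξ k) (T k l (ξ l)) := by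
  rw [isPositive_iff_inner_nonneg]
  simp only [inner_blockOp]
  exact ⟨fun h ξ => h (WithLp.toLp 2 ξ), fun h ξ => h ξ⟩

/-- The matrix is the compression of the block operator to the vectors having `h p` in coordinate `a
p` and zero elsewhere. -/
theorem posSemidef_of_blockOp_isPositive {κ : Type*} [Fintype κ] {T : Matrix κ κ (H →L[ℂ] H)}
    (hT : (blockOp T).IsPositive) {X : Type*} (a : X → κ) (h : X → H) :
    (Matrix.of fun p q : X => inner ℂ (h p) (T (a p) (a q) (h q))).PosSemidef := by
  classical
  let v : X → PiLp 2 (fun _ : κ => H) := fun p => WithLp.toLp 2 (Pi.single (a p) (h p))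
  have hv : ∀ p q, inner ℂ (h p) (T (a p) (a q) (h q)) = inner ℂ (v p) (blockOp T (v q)) :=
    fun p q => by
    rw [inner_blockOp, Finset.sum_eq_single (a p), Finset.sum_eq_single (a q)]
    · simp [v]
    · intro l _ hl; simp [v, Pi.single_eq_of_ne hl]
    · simp
    · intro k _ hk; simp [v, Pi.single_eq_of_ne hk]
    · simp
  refine posSemidef_of_finset fun F => Matrix.posSemidef_of_forall_nonneg fun c => ?_
  refine (isPositive_iff_inner_nonneg.1 hT (∑ p : F, c p • v p)).trans_eq ?_
  simp only [map_sum, sum_inner, inner_sum, map_smul, inner_smul_left, inner_smul_right,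
    Matrix.submatrix_apply, Matrix.of_apply, hv]
  rw [Finset.sum_comm]
  refine Finset.sum_congr rfl fun p _ => ?_
  rw [Finset.mul_sum]
  exact Finset.sum_congr rfl fun q _ => by rw [RCLike.star_def]; ring

/-- An algebraically spanning family suffices: each vector uses finitely many `b j`, so the
quadratic form is one of a finite submatrix. -/
theorem blockOp_isPositive_of_posSemidef {κ : Type*} [Fintype κ] {T : Matrix κ κ (H →L[ℂ] H)}
    {J : Type*} (b : J → H) (hb : Submodule.span ℂ (Set.range b) = ⊤)
    (hT : (Matrix.of fun p q : κ × J => inner ℂ (b p.2) (T p.1 q.1 (b q.2))).PosSemidef) :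
    (blockOp T).IsPositive := by
  rw [blockOp_isPositive_iff]
  intro ξ
  have : ∀ k, ∃ c : J →₀ ℂ, ξ k = Finsupp.linearCombination ℂ b c := fun k => by
    have : ξ k ∈ Submodule.span ℂ (Set.range b) := hb ▸ Submodule.mem_top
    obtain ⟨c, hc⟩ := (Finsupp.mem_span_range_iff_exists_finsupp).1 this
    exact ⟨c, hc.symm⟩
  choose c hc using this
  classical
  let F : Finset J := Finset.univ.biUnion fun k => (c k).support
  have hc2 : ∀ k, ξ k = ∑ j : F, c k j • b j := fun k => by
    rw [hc, Finsupp.linearCombination_apply, Finset.sum_coe_sort F fun j => c k j • b j]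
    exact Finsupp.sum_of_support_subset _
      (Finset.subset_biUnion_of_mem (fun k => (c k).support) (Finset.mem_univ k)) _ (by simp)
  have := (hT.submatrix (fun p : κ × F => (p.1, (p.2 : J)))).sum_mul_nonneg fun p => c p.1 p.2
  refine this.trans_eq ?_
  simp only [hc2, Fintype.sum_prod_type, Matrix.submatrix_apply, Matrix.of_apply, map_sum,
    sum_inner, inner_sum, map_smul, inner_smul_left, inner_smul_right]
  refine Finset.sum_congr rfl fun k _ => ?_
  rw [Finset.sum_comm]
  refine Finset.sum_congr rfl fun l _ => ?_
  rw [Finset.sum_comm]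
  refine Finset.sum_congr rfl fun i _ => ?_
  rw [Finset.mul_sum]
  exact Finset.sum_congr rfl fun j _ => by rw [RCLike.star_def]; ring

end BlockOp

section Kernels

variable {G : Type u} [Group G] {H : Type*} [NormedAddCommGroup H] [InnerProductSpace ℂ H]

theorem posSemidef_of_isPosSemidefFun {u : G → H →L[ℂ] H} (hu : IsPosSemidefFun u) {J : Type*}
    (h : J → H) :
    (Matrix.of fun p q : G × J => inner ℂ (h p.2) (u (p.1 * q.1⁻¹) (h q.2))).PosSemidef := by
  classical
  refine posSemidef_of_finset fun F => ?_
  exact posSemidef_of_blockOp_isPositive (hu (F.image Prod.fst))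
    (fun p : F => ⟨p.1.1, Finset.mem_image_of_mem _ p.2⟩) (fun p : F => h p.1.2)

end Kernels

/-! ### Positive extension implies Fejér–Riesz. -/

section PositiveExtension

variable {G : Type u} [Group G] {S : Finset G}

/-- Realises an n × n scalar kernel by operators on ℂⁿ. The index set is lifted so that this Hilbert
space lies in the universe quantified over by the extension properties. -/
theorem exists_operator_kernel {X : Type u} {n : ℕ} (K : X → Fin n → Fin n → ℂ) :
    ∃ (T : X → EuclideanSpace ℂ (ULift.{v} (Fin n)) →L[ℂ] EuclideanSpace ℂ (ULift.{v} (Fin n)))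
      (e : Fin n → EuclideanSpace ℂ (ULift.{v} (Fin n))),
      (∀ g i j, inner ℂ (e i) (T g (e j)) = K g i j) ∧ Submodule.span ℂ (Set.range e) = ⊤ := by
  refine ⟨fun g => Matrix.toEuclideanCLM (𝕜 := ℂ) (Matrix.of fun i j => K g i.down j.down),
    fun i => EuclideanSpace.single (ULift.up i) 1, fun g i j => ?_, ?_⟩
  · rw [EuclideanSpace.inner_single_left, Matrix.ofLp_toEuclideanCLM]
    simp
  · have := (EuclideanSpace.basisFun (ULift.{v} (Fin n)) ℂ).toBasis.span_eq
    rw [← this]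
    congr 1
    ext x
    simp

/-- By the bipolar theorem it suffices to pair with positive Toeplitz matrices over `S`. Once
extended to G, such a kernel is nonnegative on all positive elements. -/
theorem completeFejerRiesz_of_pos (h : PositiveOperatorExtensionProperty.{u, v} S) :
    CompleteFejerRieszProperty S := by
  rintro n _ hx ⟨A, rfl⟩
  refine mem_sosCone_of_forall_symbPair fun K hK => ?_
  obtain ⟨T, e, he, hs⟩ := exists_operator_kernel K
  obtain ⟨u, hu, huT⟩ := h _ (Matrix.of fun s t : S => T ((s : G) * (t : G)⁻¹))
    (fun s₁ t₁ s₂ t₂ h => by simp [h]) (blockOp_isPositive_of_posSemidef e hs (by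
      convert hK using 1
      ext p q
      simp [toeplitzMatrix, he]))
  refine (symbPair_nonneg_of_nonneg (K := fun g i j => inner ℂ (e i) (u g (e j))) hx
    (posSemidef_of_isPosSemidefFun hu e)).trans_eq ?_
  simp only [symbPair, ← huT, Matrix.of_apply, he]

end PositiveExtension

/-! ### 2 × 2 block coefficients and the unit ball of SOS(S). -/

section StretchBlocks

variable {G : Type u} [Group G] {ι : Type} [Fintype ι] {S : Finset G}

theorem star_stretch (A : S → S → Matrix ι ι ℂ) :
    star (stretch S A) = stretch S (fun s t => (A t s).conjTranspose) := by
  refine CStarMatrix.ext fun i j => ?_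
  simp only [CStarMatrix.star_apply, stretch_apply, star_sum, star_smul, GroupCStar.star_delta,
    mul_inv_rev, inv_inv, Matrix.conjTranspose_apply]
  rw [Finset.sum_comm]

/-- The coefficients of the unit. -/
def unitCoeff [DecidableEq G] [DecidableEq ι] (s₀ : S) : S → S → Matrix ι ι ℂ :=
  fun s t => if s = s₀ ∧ t = s₀ then 1 else 0

theorem symbPair_unitCoeff [DecidableEq G] [DecidableEq ι] (s₀ : S) {M : Type*} [AddCommMonoid M]
    [Module ℂ M] (K : G → ι → ι → M) : symbPair (unitCoeff s₀) K = ∑ i, K 1 i i := by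
  rw [symbPair, Finset.sum_eq_single s₀, Finset.sum_eq_single s₀]
  · simp [unitCoeff, Matrix.one_apply]
  · intro t _ ht; simp [unitCoeff, ht]
  · simp
  · intro t _ ht; simp [unitCoeff, ht]
  · simp

theorem stretch_unitCoeff [DecidableEq G] [DecidableEq ι] (s₀ : S) :
    stretch S (unitCoeff s₀) = (1 : CStarMatrix ι ι (GroupCStar G)) := by
  refine CStarMatrix.ext fun i j => ?_
  rw [stretch_apply_eq_symbPair, symbPair_unitCoeff, CStarMatrix.one_apply]
  simp [GroupCStar.delta_one]

/-- Block matrices of coefficients. -/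
def blockCoeff (a A B b : S → S → Matrix ι ι ℂ) : S → S → Matrix (ι ⊕ ι) (ι ⊕ ι) ℂ :=
  fun s t => Matrix.fromBlocks (a s t) (A s t) (B s t) (b s t)

theorem stretch_blockCoeff (a A B b : S → S → Matrix ι ι ℂ) :
    stretch S (blockCoeff a A B b) = CStarMatrix.ofMatrix (Matrix.fromBlocks
      (CStarMatrix.ofMatrix.symm (stretch S a)) (CStarMatrix.ofMatrix.symm (stretch S A))
      (CStarMatrix.ofMatrix.symm (stretch S B)) (CStarMatrix.ofMatrix.symm (stretch S b))) := by
  refine CStarMatrix.ext fun i j => ?_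
  rcases i with i | i <;> rcases j with j | j <;>
    simp [stretch_apply, blockCoeff]

theorem symbPair_blockCoeff {M : Type*} [AddCommMonoid M] [Module ℂ M]
    (a A B b : S → S → Matrix ι ι ℂ) (K : G → ι ⊕ ι → ι ⊕ ι → M) :
    symbPair (blockCoeff a A B b) K = symbPair a (fun g i j => K g (.inl i) (.inl j)) +
      symbPair A (fun g i j => K g (.inl i) (.inr j)) +
      (symbPair B (fun g i j => K g (.inr i) (.inl j)) +
      symbPair b (fun g i j => K g (.inr i) (.inr j))) := by
  simp only [symbPair, blockCoeff, Fintype.sum_sum_type, Finset.sum_add_distrib,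
    Matrix.fromBlocks_apply₁₁, Matrix.fromBlocks_apply₁₂, Matrix.fromBlocks_apply₂₁,
    Matrix.fromBlocks_apply₂₂]
  rw [add_add_add_comm]

theorem symbPair_congr (A : S → S → Matrix ι ι ℂ) {K L : G → ι → ι → ℂ}
    (h : toeplitzMatrix S K = toeplitzMatrix S L) : symbPair A K = symbPair A L :=
  Finset.sum_congr rfl fun s _ => Finset.sum_congr rfl fun t _ =>
    Finset.sum_congr rfl fun i _ => Finset.sum_congr rfl fun j _ =>
      congrArg _ (congrFun (congrFun h (s, i)) (t, j))

theorem star_symbPair (A : S → S → Matrix ι ι ℂ) (K : G → ι → ι → ℂ) :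
    star (symbPair A K) = symbPair (fun s t => (A t s).conjTranspose) (kerStar K) := by
  simp only [symbPair, star_sum, kerStar, Matrix.conjTranspose_apply, mul_inv_rev, inv_inv,
    smul_eq_mul, star_mul']
  rw [Finset.sum_comm]
  refine Finset.sum_congr rfl fun s _ => Finset.sum_congr rfl fun t _ => ?_
  rw [Finset.sum_comm]

/-- Since 1 = δ_{s₀s₀⁻¹}, any chosen `s₀` supplies coefficients for the diagonal blocks; this is
where `S` must be non-empty. -/
theorem mem_sosUnitBall_iff [DecidableEq G] [DecidableEq ι] (s₀ : S) (A : S → S → Matrix ι ι ℂ) :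
    stretch S A ∈ sosUnitBall S ↔ stretch S (blockCoeff (unitCoeff s₀) A
      (fun s t => (A t s).conjTranspose) (unitCoeff s₀)) ∈ sosCone S := by
  rw [stretch_blockCoeff, stretch_unitCoeff, ← star_stretch]
  rfl

theorem symbPair_im_eq_zero {A : S → S → Matrix ι ι ℂ} (hA : IsSelfAdjoint (stretch S A))
    {K : G → ι → ι → ℂ} (hK : (toeplitzMatrix S K).IsHermitian) : (symbPair A K).im = 0 := by
  rw [← Complex.conj_eq_iff_im]
  have h1 := star_symbPair A K
  rw [symbPair_eq_of_symb_eq (stretch_eq_iff.1 ((star_stretch A).symm.trans hA))] at h1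
  exact h1.trans (symbPair_congr A ((toeplitzMatrix_kerStar K).trans hK))

end StretchBlocks

/-! ### Norm bounds from positivity. -/

section Contraction

variable {H : Type*} [NormedAddCommGroup H] [InnerProductSpace ℂ H]

/-- The choice η = −Xξ gives ‖Xξ‖² ≤ M²‖ξ‖². -/
theorem norm_le_of_re_inner_nonneg {X : H →L[ℂ] H} {M : ℝ} (hM : 0 ≤ M)
    (h : ∀ η ξ, 0 ≤ ‖η‖ ^ 2 + M ^ 2 * ‖ξ‖ ^ 2 + 2 * (inner ℂ η (X ξ) : ℂ).re) : ‖X‖ ≤ M := by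
  refine X.opNorm_le_bound hM fun ξ => ?_
  have h1 := h (-(X ξ)) ξ
  rw [inner_neg_left, norm_neg, Complex.neg_re] at h1
  have h2 : (inner ℂ (X ξ) (X ξ) : ℂ).re = ‖X ξ‖ ^ 2 := inner_self_eq_norm_sq (𝕜 := ℂ) (X ξ)
  rw [h2] at h1
  exact (sq_le_sq₀ (norm_nonneg _) (by positivity)).1 (by rw [mul_pow]; linarith)

theorem CStarAlgebra.norm_norm_smul_one_sub_le {A : Type*} [CStarAlgebra A] [PartialOrder A]
    [StarOrderedRing A] {x : A} (hx : 0 ≤ x) : ‖algebraMap ℝ A ‖x‖ - x‖ ≤ ‖x‖ := by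
  have h1 : x ≤ algebraMap ℝ A ‖x‖ := IsSelfAdjoint.le_algebraMap_norm_self (.of_nonneg hx)
  rw [CStarAlgebra.norm_le_iff_le_algebraMap _ (norm_nonneg x) (sub_nonneg.2 h1)]
  exact sub_le_self _ hx

end Contraction

/-! ### Bounded extension implies Fejér–Riesz. -/

section Unital

variable {G : Type u} [Group G] {S : Finset G} {H : Type v} [NormedAddCommGroup H]
  [InnerProductSpace ℂ H]

/-- The amplification of a linear map to matrices. -/
def amplify (φ : GroupCStar G →L[ℂ] (H →L[ℂ] H)) (n : ℕ) :
    CStarMatrix (Fin n) (Fin n) (GroupCStar G) →ₗ[ℂ]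
      (PiLp 2 (fun _ : Fin n => H) →L[ℂ] PiLp 2 (fun _ : Fin n => H)) where
  toFun x := blockOp (Matrix.of fun i j : Fin n => φ (x i j))
  map_add' x y := by
    ext ξ i
    simp [blockOp_apply, Finset.sum_add_distrib]
  map_smul' c x := by
    ext ξ i
    simp [blockOp_apply, Finset.smul_sum]

theorem norm_clm_smul {E : Type*} [NormedAddCommGroup E] [NormedSpace ℂ E] (c : ℂ) (X : E →L[ℂ] E) :
    ‖c • X‖ = ‖c‖ * ‖X‖ := norm_smul c X

theorem norm_amplify_le {φ : GroupCStar G →L[ℂ] (H →L[ℂ] H)} (h : cbNorm φ ≤ 1) {n : ℕ}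
    (x : CStarMatrix (Fin n) (Fin n) (GroupCStar G)) : ‖amplify φ n x‖ ≤ ‖x‖ := by
  have h1 : ∀ y : CStarMatrix (Fin n) (Fin n) (GroupCStar G), ‖y‖ ≤ 1 → ‖amplify φ n y‖ ≤ 1 :=
    fun y hy => by
    rw [cbNorm] at h
    have := (iSup_le_iff.1 (iSup_le_iff.1 (iSup_le_iff.1 h n) y) hy)
    rw [← enorm_one (G := ℝ), enorm_le_iff_norm_le] at this
    rwa [norm_one] at this
  by_cases hx : ‖x‖ = 0
  · rw [norm_eq_zero.1 hx, map_zero]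
    exact (norm_zero (E := PiLp 2 (fun _ : Fin n => H) →L[ℂ] PiLp 2 (fun _ : Fin n => H))).le.trans
      (norm_nonneg _)
  · have h2 := h1 (((‖x‖⁻¹ : ℝ) : ℂ) • x) (by
      rw [norm_smul, Complex.norm_real, norm_inv, norm_norm, inv_mul_cancel₀ hx])
    have h3 : ‖((‖x‖⁻¹ : ℝ) : ℂ) • amplify φ n x‖ = ‖x‖⁻¹ * ‖amplify φ n x‖ := by
      refine (norm_clm_smul _ _).trans ?_
      rw [Complex.norm_real, norm_inv, norm_norm]
    rwa [map_smul, h3, inv_mul_le_one₀ ((norm_nonneg x).lt_of_ne' hx)] at h2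

/-- A unital complete contraction is completely positive: for positive x the element ‖x‖ − x has
norm at most ‖x‖. Its image ‖x‖ − φ(x) has the same bound, which is incompatible with a negative
real part of ⟪ξ, φ(x)ξ⟫. -/
theorem re_inner_amplify_nonneg {φ : GroupCStar G →L[ℂ] (H →L[ℂ] H)} (h : cbNorm φ ≤ 1)
    (h1 : φ 1 = 1) {n : ℕ} {x : CStarMatrix (Fin n) (Fin n) (GroupCStar G)} (hx : 0 ≤ x)
    (ξ : PiLp 2 (fun _ : Fin n => H)) : 0 ≤ (inner ℂ ξ (amplify φ n x ξ) : ℂ).re := by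
  have h2 := (norm_amplify_le h (algebraMap ℝ _ ‖x‖ - x)).trans
    (CStarAlgebra.norm_norm_smul_one_sub_le hx)
  have h3 : amplify φ n (algebraMap ℝ _ ‖x‖ - x) ξ = (‖x‖ : ℂ) • ξ - amplify φ n x ξ := by
    have h4 : algebraMap ℝ (CStarMatrix (Fin n) (Fin n) (GroupCStar G)) ‖x‖ = (‖x‖ : ℂ) • 1 := by
      rw [Algebra.algebraMap_eq_smul_one]
      refine CStarMatrix.ext fun i j => ?_
      simp [CStarMatrix.smul_apply]
    have h5 : amplify φ n 1 ξ = ξ := by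
      ext i
      refine (blockOp_apply _ _ _).trans ?_
      simp only [Matrix.of_apply, CStarMatrix.one_apply]
      rw [Finset.sum_eq_single i]
      · simp [h1]
      · intro j _ hj; simp [Ne.symm hj]
      · simp
    rw [h4, map_sub, map_smul, sub_apply, smul_apply, h5]
  have h4 : (inner ℂ ξ (amplify φ n (algebraMap ℝ _ ‖x‖ - x) ξ) : ℂ).re ≤ ‖x‖ * ‖ξ‖ ^ 2 := by
    refine (Complex.re_le_norm _).trans ((norm_inner_le_norm _ _).trans ?_)
    have := (amplify φ n (algebraMap ℝ _ ‖x‖ - x)).le_of_opNorm_le h2 ξ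
    exact (mul_le_mul_of_nonneg_left this (norm_nonneg ξ)).trans_eq (by ring)
  have h5 : (inner ℂ ξ ξ : ℂ).re = ‖ξ‖ ^ 2 := inner_self_eq_norm_sq (𝕜 := ℂ) ξ
  rw [h3, inner_sub_right, inner_smul_right, Complex.sub_re, Complex.re_ofReal_mul, h5] at h4
  linarith

/-- The positive 2 × 2 matrix with diagonal 1 and corners x, x* is paired with K. The two corners
contribute conjugate numbers, hence the factor 2. -/
theorem re_nonneg_of_mem_sosUnitBall [DecidableEq G] {ι : Type} [Fintype ι] [DecidableEq ι] (s₀ : S)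
    {A : S → S → Matrix ι ι ℂ} (hA : stretch S A ∈ sosUnitBall S) {K : G → ι ⊕ ι → ι ⊕ ι → ℂ}
    (hK : (toeplitzMatrix S K).PosSemidef) :
    0 ≤ (∑ i, K 1 (.inl i) (.inl i)).re + (∑ i, K 1 (.inr i) (.inr i)).re +
      2 * (symbPair A fun g i j => K g (.inl i) (.inr j)).re := by
  rw [mem_sosUnitBall_iff s₀] at hA
  have h2 := symbPair_nonneg_of_mem_sosCone hA hK
  rw [symbPair_blockCoeff, symbPair_unitCoeff, symbPair_unitCoeff] at h2
  have h3 : symbPair (fun s t => (A t s).conjTranspose) (fun g i j => K g (.inr i) (.inl j)) =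
      star (symbPair A fun g i j => K g (.inl i) (.inr j)) := by
    rw [star_symbPair]
    refine symbPair_congr _ ?_
    ext p q
    have := (hK.1.apply (p.1, .inr p.2) (q.1, .inl q.2)).symm
    simpa [toeplitzMatrix, kerStar] using this
  rw [h3] at h2
  have h6 := (Complex.le_def.1 h2).1
  simp only [Complex.zero_re, Complex.add_re, RCLike.star_def, Complex.conj_re] at h6
  linarith

theorem symbPair_inner {ι : Type} [Fintype ι] (A : S → S → Matrix ι ι ℂ) (T : G → H →L[ℂ] H)
    (η ξ : PiLp 2 (fun _ : ι => H)) :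
    symbPair A (fun g i j => (inner ℂ (η i) (T g (ξ j)) : ℂ)) = inner ℂ η (blockOp (Matrix.of
      fun i j : ι => ∑ s : S, ∑ t : S, A s t i j • T ((s : G) * (t : G)⁻¹)) ξ) := by
  rw [inner_blockOp]
  simp only [Matrix.of_apply, sum_apply, smul_apply, inner_sum, inner_smul_right,
    symbPair, smul_eq_mul]
  simp only [← Finset.sum_product', Finset.univ_product_univ]
  let e : S × S × ι × ι ≃ ι × ι × S × S :=
    ⟨fun p => (p.2.2.1, p.2.2.2, p.1, p.2.1), fun p => (p.2.2.1, p.2.2.2, p.1, p.2.1),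
      fun _ => rfl, fun _ => rfl⟩
  exact Fintype.sum_equiv e _ _ fun _ => rfl

theorem sum_inner_self {ι : Type*} [Fintype ι] (ζ : PiLp 2 (fun _ : ι => H)) :
    ∑ i, (inner ℂ (ζ i) (ζ i) : ℂ) = ((‖ζ‖ ^ 2 : ℝ) : ℂ) :=
  ((PiLp.inner_apply ζ ζ).symm.trans (inner_self_eq_norm_sq_to_K ζ)).trans (by simp)

/-- The map φ_T is then unital and completely positive on SOS(S), hence completely contractive.
Concretely, the unit ball condition is tested on the kernel of T at the vectors η and ξ jointly. -/
theorem toeplitzCbNorm_le_one_of_isPositive {T : G → H →L[ℂ] H} (hS : S.Nonempty)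
    (hT : (blockOp (Matrix.of fun s t : S => T ((s : G) * (t : G)⁻¹))).IsPositive) (h1 : T 1 = 1) :
    toeplitzCbNorm (Matrix.of fun s t : S => T ((s : G) * (t : G)⁻¹)) ≤ 1 := by
  classical
  obtain ⟨s₁, hs₁⟩ := hS
  refine iSup_le fun n => iSup_le fun A => iSup_le fun hA => ?_
  rw [← enorm_one (G := ℝ), enorm_le_iff_norm_le, norm_one]
  refine norm_le_of_re_inner_nonneg zero_le_one fun η ξ => ?_
  let h : Fin n ⊕ Fin n → H := Sum.elim η ξ
  have hK : (toeplitzMatrix S fun g i j => inner ℂ (h i) (T g (h j))).PosSemidef :=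
    posSemidef_of_blockOp_isPositive hT (fun p : S × (Fin n ⊕ Fin n) => p.1) (fun p => h p.2)
  have h2 := re_nonneg_of_mem_sosUnitBall ⟨s₁, hs₁⟩ hA hK
  simp only [h, Sum.elim_inl, Sum.elim_inr, h1] at h2
  rw [symbPair_inner] at h2
  have h7 := sum_inner_self η
  have h8 := sum_inner_self ξ
  simp only [one_apply_eq_self] at h2
  rw [h7, h8, Complex.ofReal_re, Complex.ofReal_re] at h2
  rw [one_pow, one_mul]
  exact h2

/-- Normalisation of a strictly positive element. -/
theorem IsStrictlyPositive.exists_normalise {A : Type*} [CStarAlgebra A] [PartialOrder A]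
    [StarOrderedRing A] {P : A} (hP : IsStrictlyPositive P) :
    ∃ C D : A, IsSelfAdjoint C ∧ IsSelfAdjoint D ∧ C * P * C = 1 ∧ C * D = 1 ∧ D * C = 1 :=
  ⟨P ^ (-(1 / 2) : ℝ), P ^ (1 / 2 : ℝ), .of_nonneg CFC.rpow_nonneg, .of_nonneg CFC.rpow_nonneg,
    CFC.conjugate_rpow_neg_one_half P hP, CFC.rpow_neg_mul_rpow _ hP, CFC.rpow_mul_rpow_neg _ hP⟩

theorem isPositive_diag_of_blockOp {κ : Type*} [Fintype κ] {T : Matrix κ κ (H →L[ℂ] H)}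
    (hT : (blockOp T).IsPositive) (k : κ) : (T k k).IsPositive :=
  isPositive_iff_inner_nonneg.2 fun ξ =>
    (posSemidef_of_blockOp_isPositive hT (fun _ : Unit => k) (fun _ => ξ)).diag_nonneg (i := ())

/-- Conjugation by C = T(1)^{-1/2} makes the kernel unital. Its Toeplitz matrix then has dual norm
at most 1, so the extension provided by (ii) is a unital complete contraction and therefore
positive. -/
theorem re_symbPair_nonneg_of_strictlyPositive [CompleteSpace H]
    (h : BoundedOperatorExtensionProperty.{u, v} S) (hS : S.Nonempty) {T : G → H →L[ℂ] H}
    (hT : (blockOp (Matrix.of fun s t : S => T ((s : G) * (t : G)⁻¹))).IsPositive)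
    (hT1 : IsStrictlyPositive (T 1)) {n : ℕ} {A : S → S → Matrix (Fin n) (Fin n) ℂ}
    (hA : 0 ≤ stretch S A) (ξ : Fin n → H) :
    0 ≤ (symbPair A fun g i j => (inner ℂ (ξ i) (T g (ξ j)) : ℂ)).re := by
  obtain ⟨C, D, hC, hD, hCP, hCD, hDC⟩ := hT1.exists_normalise
  have hC2 : ∀ x y : H, inner ℂ x (C y) = (inner ℂ (C x) y : ℂ) :=
    fun x y => (ContinuousLinearMap.isSelfAdjoint_iff_isSymmetric.1 hC x y).symm
  let T' : G → H →L[ℂ] H := fun g => C * T g * C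
  have hT' : (blockOp (Matrix.of fun s t : S => T' ((s : G) * (t : G)⁻¹))).IsPositive := by
    rw [blockOp_isPositive_iff] at hT ⊢
    intro η
    refine (hT fun s => C (η s)).trans_eq ?_
    simp only [T', Matrix.of_apply, mul_apply_eq_comp, hC2]
  obtain ⟨u, -, huT, φ, hφ, hcb⟩ := h H (Matrix.of fun s t : S => T' ((s : G) * (t : G)⁻¹))
    (fun s₁ t₁ s₂ t₂ h => by simp [h])
  have hcb1 : cbNorm φ ≤ 1 := hcb.trans_le (toeplitzCbNorm_le_one_of_isPositive hS hT' hCP)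
  obtain ⟨s₁, hs₁⟩ := hS
  have hφ1 : φ 1 = 1 := by
    rw [← GroupCStar.delta_one, hφ]
    have := huT ⟨s₁, hs₁⟩ ⟨s₁, hs₁⟩
    simp only [mul_inv_cancel] at this
    rw [← this]
    simp only [Matrix.of_apply, mul_inv_cancel]
    exact hCP
  -- The vectors Dξ_i with D = C⁻¹ undo the conjugation.
  have := re_inner_amplify_nonneg hcb1 hφ1 hA (WithLp.toLp 2 fun i => D (ξ i))
  refine this.trans_eq (congrArg Complex.re ?_)
  have hCD' : ∀ x, C (D x) = x := fun x => by rw [← mul_apply_eq_comp, hCD]; rfl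
  refine (inner_blockOp _ _ _).trans ?_
  simp only [Matrix.of_apply, stretch_apply, map_sum, map_smul, hφ, ← huT, sum_apply, smul_apply,
    inner_sum, inner_smul_right, T', mul_apply_eq_comp, hC2, hCD', symbPair, smul_eq_mul]
  simp only [← Finset.sum_product', Finset.univ_product_univ]
  let e : Fin n × Fin n × S × S ≃ S × S × Fin n × Fin n :=
    ⟨fun p => (p.2.2.1, p.2.2.2, p.1, p.2.1), fun p => (p.2.2.1, p.2.2.2, p.1, p.2.1),
      fun _ => rfl, fun _ => rfl⟩
  exact Fintype.sum_equiv e _ _ fun _ => rfl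

/-- The pairing is real because both factors are Hermitian. Its real part is treated by adding ε
times the identity kernel, which makes T(1) strictly positive, and letting ε tend to 0. -/
theorem completeFejerRiesz_of_bounded (h : BoundedOperatorExtensionProperty.{u, v} S) :
    CompleteFejerRieszProperty S := by
  classical
  rintro n _ hx ⟨A, rfl⟩
  refine mem_sosCone_of_forall_symbPair fun K hK => ?_
  rcases S.eq_empty_or_nonempty with hS | hS
  · subst hS
    simp [symbPair]
  have him := symbPair_im_eq_zero (.of_nonneg hx) hK.1
  obtain ⟨T, e, he, hs⟩ := exists_operator_kernel K
  have hT : (blockOp (Matrix.of fun s t : S => T ((s : G) * (t : G)⁻¹))).IsPositive :=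
    blockOp_isPositive_of_posSemidef e hs (by
      convert hK using 1
      ext p q
      simp [toeplitzMatrix, he])
  let J : G → EuclideanSpace ℂ (ULift.{v} (Fin n)) →L[ℂ] EuclideanSpace ℂ (ULift.{v} (Fin n)) :=
    fun g => if g = 1 then 1 else 0
  let r := (symbPair A K).re
  let c := (symbPair A fun g i j => (inner ℂ (e i) (J g (e j)) : ℂ)).re
  have hre : ∀ ε : ℝ, 0 < ε → 0 ≤ r + ε * c := fun ε hε => by
    have hTε : (blockOp (Matrix.of fun s t : S =>
        (T + (ε : ℂ) • J) ((s : G) * (t : G)⁻¹))).IsPositive := by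
      rw [blockOp_isPositive_iff] at hT ⊢
      intro ξ
      have h1 := hT ξ
      have h2 : (0 : ℂ) ≤ ε * ∑ s, inner ℂ (ξ s) (ξ s) :=
        mul_nonneg (Complex.zero_le_real.2 hε.le) (Finset.sum_nonneg fun s _ => by
          rw [inner_self_eq_norm_sq_to_K]; positivity)
      refine (add_nonneg h1 h2).trans_eq ?_
      rw [Finset.mul_sum, ← Finset.sum_add_distrib]
      refine Finset.sum_congr rfl fun s _ => ?_
      simp only [Matrix.of_apply, Pi.add_apply, Pi.smul_apply, add_apply, smul_apply,
        inner_add_right, Finset.sum_add_distrib, inner_smul_right]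
      congr 1
      rw [Finset.sum_eq_single s]
      · simp [J]
      · intro t _ ht
        have : (s : G) * (t : G)⁻¹ ≠ 1 := fun h => ht (Subtype.ext (mul_inv_eq_one.1 h).symm)
        simp [J, this]
      · simp
    have hT1 : IsStrictlyPositive ((T + (ε : ℂ) • J) 1) := by
      obtain ⟨s₁, hs₁⟩ := hS
      have h1 := isPositive_diag_of_blockOp hT ⟨s₁, hs₁⟩
      simp only [Matrix.of_apply, mul_inv_cancel] at h1
      rw [← ContinuousLinearMap.nonneg_iff_isPositive] at h1
      refine IsStrictlyPositive.nonneg_add h1 ?_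
      simp only [Pi.smul_apply, J, if_true]
      exact IsStrictlyPositive.smul (𝕜 := ℂ) (by exact_mod_cast hε) isStrictlyPositive_one
    have := re_symbPair_nonneg_of_strictlyPositive h hS hTε hT1 hx e
    refine this.trans_eq ?_
    have h2 : (fun g i j => (inner ℂ (e i) ((T + (ε : ℂ) • J) g (e j)) : ℂ)) =
        K + (ε : ℂ) • fun g i j => (inner ℂ (e i) (J g (e j)) : ℂ) := by
      funext g i j
      simp [he]
    rw [h2, symbPair_add, symbPair_smul, Complex.add_re, Complex.re_ofReal_mul]
  rw [Complex.le_def]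
  refine ⟨?_, him.symm⟩
  have hlim : Filter.Tendsto (fun ε : ℝ => r + ε * c) (nhdsWithin 0 (Set.Ioi 0)) (nhds r) := by
    have : Filter.Tendsto (fun ε : ℝ => r + ε * c) (nhds 0) (nhds (r + 0 * c)) :=
      Continuous.tendsto (by fun_prop) 0
    rw [zero_mul, add_zero] at this
    exact this.mono_left nhdsWithin_le_nhds
  exact ge_of_tendsto hlim (Filter.eventually_of_mem self_mem_nhdsWithin hre)

end Unital

/-! ### Extension of positive semi-definite kernels -/

section Krein

variable {G : Type u} [Group G] {J : Type*}

/-- The coefficients of `y y*`, where `y` is the column with coefficients `c`. -/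
def sqCoeff (c : G × J →₀ ℂ) : G × J × J →₀ ℂ :=
  c.sum fun p a => c.sum fun q b => Finsupp.single (p.1 * q.1⁻¹, p.2, q.2) (a * star b)

/-- The convex cone generated by the squares. -/
def sqCone (G : Type*) [Group G] (J : Type*) : PointedCone ℝ (G × J × J →₀ ℂ) :=
  Submodule.span _ (Set.range sqCoeff)

/-- The adjoint, on the level of coefficients. -/
def coeffStar (G : Type*) [Group G] (J : Type*) : (G × J × J →₀ ℂ) →ₗ[ℝ] (G × J × J →₀ ℂ) :=
  Finsupp.lsum ℝ fun p =>
    (Finsupp.lsingle (M := ℂ) (R := ℝ) (p.1⁻¹, p.2.2, p.2.1)) ∘ₗ Complex.conjAe.toLinearMap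

theorem coeffStar_single (p : G × J × J) (z : ℂ) :
    coeffStar G J (Finsupp.single p z) = Finsupp.single (p.1⁻¹, p.2.2, p.2.1) (star z) := by
  simp [coeffStar]

theorem coeffStar_sqCoeff (c : G × J →₀ ℂ) : coeffStar G J (sqCoeff c) = sqCoeff c := by
  simp only [sqCoeff, Finsupp.sum, map_sum, coeffStar_single]
  rw [Finset.sum_comm]
  refine Finset.sum_congr rfl fun p _ => Finset.sum_congr rfl fun q _ => ?_
  simp [mul_comm]

theorem coeffStar_of_mem_sqCone {w : G × J × J →₀ ℂ} (hw : w ∈ sqCone G J) :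
    coeffStar G J w = w := by
  induction hw using Submodule.span_induction with
  | mem x hx => obtain ⟨c, rfl⟩ := hx; exact coeffStar_sqCoeff c
  | zero => simp
  | add x y _ _ hx hy => rw [map_add, hx, hy]
  | smul a x _ hx =>
    have : a • x = (a : ℝ) • x := rfl
    rw [this, map_smul, hx]

theorem coeffStar_smul_I (w : G × J × J →₀ ℂ) :
    coeffStar G J (Complex.I • w) = -(Complex.I • coeffStar G J w) := by
  induction w using Finsupp.induction_linear with
  | zero => simp
  | add x y hx hy => rw [smul_add, map_add, hx, hy, map_add, smul_add, neg_add]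
  | single p z =>
    rw [Finsupp.smul_single, coeffStar_single, coeffStar_single, Finsupp.smul_single,
      ← Finsupp.single_neg]
    congr 1
    simp

/-- A monomial plus its adjoint becomes a square after adding diagonal terms at the unit. This gives
the majorisation needed in the extension theorem. -/
theorem sqCoeff_pair (g : G) (i j : J) (z : ℂ) :
    sqCoeff (Finsupp.single (g, i) z + Finsupp.single (1, j) 1) =
      Finsupp.single (1, i, i) (z * star z) + Finsupp.single (g, i, j) z +
        (Finsupp.single (g⁻¹, j, i) (star z) + Finsupp.single (1, j, j) 1) := by
  have h1 : ∀ (p : G × J) (a : ℂ) (x y : G × J) (b d : ℂ),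
      ((Finsupp.single x b + Finsupp.single y d).sum fun q b =>
        Finsupp.single (p.1 * q.1⁻¹, p.2, q.2) (a * star b)) =
      Finsupp.single (p.1 * x.1⁻¹, p.2, x.2) (a * star b) +
        Finsupp.single (p.1 * y.1⁻¹, p.2, y.2) (a * star d) := fun p a x y b d => by
    classical
    rw [Finsupp.sum_add_index' (by simp) (by simp [mul_add, Finsupp.single_add]),
      Finsupp.sum_single_index (by simp), Finsupp.sum_single_index (by simp)]
  classical
  rw [sqCoeff]
  simp only [h1]
  rw [Finsupp.sum_add_index' (by simp) (fun p a b => by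
      simp only [add_mul, Finsupp.single_add]; abel),
    Finsupp.sum_single_index (by simp), Finsupp.sum_single_index (by simp)]
  simp

theorem sqCoeff_sum {X : Type*} [Fintype X] (p : X → G × J) (c : X → ℂ) :
    sqCoeff (∑ x, Finsupp.single (p x) (c x)) =
      ∑ x, ∑ y, Finsupp.single ((p x).1 * (p y).1⁻¹, (p x).2, (p y).2) (c x * star (c y)) := by
  have h1 : ∀ (q : G × J) (a : ℂ), ((∑ x, Finsupp.single (p x) (c x)).sum fun r b =>
      Finsupp.single (q.1 * r.1⁻¹, q.2, r.2) (a * star b)) =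
      ∑ y, Finsupp.single (q.1 * (p y).1⁻¹, q.2, (p y).2) (a * star (c y)) := fun q a => by
    rw [← Finsupp.sum_finsetSum_index (by simp) (by simp [mul_add, Finsupp.single_add])]
    exact Finset.sum_congr rfl fun y _ => Finsupp.sum_single_index (by simp)
  rw [sqCoeff]
  simp only [h1]
  rw [← Finsupp.sum_finsetSum_index (by simp) (fun q a b => by
    simp only [add_mul, Finsupp.single_add, Finset.sum_add_distrib])]
  exact Finset.sum_congr rfl fun y _ => Finsupp.sum_single_index (by simp)

/-- M. Riesz's extension theorem, applied to the real part of the pairing with `k` on coefficients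
supported in `D`. The set `D` need only contain the diagonal at the unit, because `sqCoeff_pair`
dominates every coefficient by such terms. -/
theorem exists_posSemidef_extension (D : Set (G × J × J)) (h1 : ∀ j, (1, j, j) ∈ D)
    (hD : ∀ g i j, (g, i, j) ∈ D → (g⁻¹, j, i) ∈ D) (k : G → J → J → ℂ)
    (hk : ∀ g i j, (g, i, j) ∈ D → star (k g⁻¹ j i) = k g i j)
    (hpos : ∀ w ∈ sqCone G J, (w.support : Set (G × J × J)) ⊆ D →
      0 ≤ (Finsupp.linearCombination ℂ (fun p : G × J × J => k p.1 p.2.1 p.2.2) w).re) :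
    ∃ K : G → J → J → ℂ, (Matrix.of fun p q : G × J => K (p.1 * q.1⁻¹) p.2 q.2).PosSemidef ∧
      ∀ g i j, (g, i, j) ∈ D → K g i j = k g i j := by
  classical
  let L := Finsupp.linearCombination ℂ (fun p : G × J × J => k p.1 p.2.1 p.2.2)
  let W : Submodule ℝ (G × J × J →₀ ℂ) := (Finsupp.supported ℂ ℂ D).restrictScalars ℝ
  let f : (G × J × J →₀ ℂ) →ₗ.[ℝ] ℝ :=
    ⟨W, Complex.reLm ∘ₗ L.restrictScalars ℝ ∘ₗ W.subtype⟩
  -- Pulling the cone back along w ↦ w + w* puts all skew elements and their negatives into it. The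
  -- extended functional thus vanishes on skew elements, so the kernel obtained from it is
  -- automatically Hermitian.
  let s : PointedCone ℝ (G × J × J →₀ ℂ) := (sqCone G J).comap (LinearMap.id + coeffStar G J)
  have hs : ∀ w, w ∈ s ↔ w + coeffStar G J w ∈ sqCone G J := fun w => Iff.rfl
  have hstarD : ∀ w ∈ W, coeffStar G J w ∈ W ∧ (L (coeffStar G J w)).re = (L w).re := by
    intro w hw
    have hw' : w = ∑ p ∈ w.support, Finsupp.single p (w p) := w.sum_single.symm
    have hws : ∀ p ∈ w.support, p ∈ D := fun p hp => (Finsupp.mem_supported ℂ w).1 hw hp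
    constructor
    · rw [hw', map_sum]
      refine W.sum_mem fun p hp => ?_
      rw [coeffStar_single]
      exact Finsupp.single_mem_supported ℂ _ (hD _ _ _ (hws p hp))
    · rw [hw', map_sum, map_sum, map_sum, Complex.re_sum, Complex.re_sum]
      refine Finset.sum_congr rfl fun p hp => ?_
      rw [coeffStar_single]
      simp only [L, Finsupp.linearCombination_single, smul_eq_mul]
      rw [← Complex.conj_re (w p * _), ← hk _ _ _ (hws p hp)]
      simp
  have hnonneg : ∀ x : f.domain, (x : G × J × J →₀ ℂ) ∈ s → 0 ≤ f x := fun x hx => by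
    have h2 := hstarD x x.2
    have h3 := hpos _ ((hs _).1 hx) (W.add_mem x.2 h2.1)
    change 0 ≤ (L (x + coeffStar G J x)).re at h3
    rw [map_add, Complex.add_re, h2.2] at h3
    change 0 ≤ (L x).re
    linarith
  have hdense : ∀ y, ∃ x : f.domain, (x : G × J × J →₀ ℂ) + y ∈ s := fun y => by
    induction y using Finsupp.induction_linear with
    | zero => exact ⟨0, by simp⟩
    | add y z hy hz =>
      obtain ⟨x, hx⟩ := hy
      obtain ⟨x', hx'⟩ := hz
      refine ⟨x + x', ?_⟩
      have := s.add_mem hx hx'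
      rwa [add_add_add_comm] at this
    | single p z =>
      obtain ⟨g, i, j⟩ := p
      -- The diagonal terms are halved because adding the adjoint doubles them.
      refine ⟨⟨Finsupp.single (1, i, i) (z * star z / 2) + Finsupp.single (1, j, j) (1 / 2),
        W.add_mem (Finsupp.single_mem_supported ℂ _ (h1 i))
          (Finsupp.single_mem_supported ℂ _ (h1 j))⟩, ?_⟩
      rw [hs]
      have : sqCoeff (Finsupp.single (g, i) z + Finsupp.single (1, j) 1) ∈ sqCone G J :=
        Submodule.subset_span ⟨_, rfl⟩
      convert this using 1
      rw [sqCoeff_pair]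
      simp only [map_add, coeffStar_single, inv_one]
      have h2 : star (z * star z / 2) = z * star z / 2 := by
        simp [mul_comm]
      have h3 : star (1 / 2 : ℂ) = 1 / 2 := by simp
      rw [h2, h3]
      have h4 : ∀ (p : G × J × J) (a : ℂ), Finsupp.single p a = Finsupp.single p (a / 2) +
          Finsupp.single p (a / 2) := fun p a => by rw [← Finsupp.single_add, add_halves]
      rw [h4 (1, i, i) (z * star z), h4 (1, j, j) 1]
      abel
  obtain ⟨φ, hφ1, hφ2⟩ := riesz_extension s f hnonneg hdense
  have hφsq : ∀ w ∈ sqCone G J, 0 ≤ φ w ∧ φ (Complex.I • w) = 0 := fun w hw => by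
    have h := coeffStar_of_mem_sqCone hw
    refine ⟨hφ2 w ((hs w).2 (by rw [h]; exact (sqCone G J).add_mem hw hw)), ?_⟩
    have h3 : ∀ v, v + coeffStar G J v = 0 → 0 ≤ φ v := fun v hv =>
      hφ2 v ((hs v).2 (by rw [hv]; exact (sqCone G J).zero_mem))
    have h4 := h3 (Complex.I • w) (by rw [coeffStar_smul_I, h]; simp)
    have h5 := h3 (-(Complex.I • w)) (by rw [map_neg, coeffStar_smul_I, h]; simp)
    rw [map_neg] at h5
    linarith
  -- The values of the complex linear functional w ↦ φ(w) − iφ(iw), whose real part is φ.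
  let K : G → J → J → ℂ := fun g i j =>
    φ (Finsupp.single (g, i, j) 1) - Complex.I * φ (Finsupp.single (g, i, j) Complex.I)
  have hK : ∀ w, Finsupp.linearCombination ℂ (fun p : G × J × J => K p.1 p.2.1 p.2.2) w =
      φ w - Complex.I * φ (Complex.I • w) := fun w => by
    induction w using Finsupp.induction_linear with
    | zero => simp
    | add x y hx hy =>
      rw [map_add, hx, hy, smul_add, map_add, map_add]
      push_cast
      ring
    | single p z =>
      rw [Finsupp.linearCombination_single, Finsupp.smul_single]
      have hz : ∀ a : ℂ, φ (Finsupp.single p a) = a.re * φ (Finsupp.single p 1) +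
          a.im * φ (Finsupp.single p Complex.I) := fun a => by
        have : Finsupp.single p a = a.re • Finsupp.single p (1 : ℂ) +
            a.im • Finsupp.single p Complex.I := by
          rw [Finsupp.smul_single, Finsupp.smul_single, ← Finsupp.single_add]
          congr 1
          simp [Complex.re_add_im]
        rw [this, map_add, map_smul, map_smul]; rfl
      rw [hz z, hz (Complex.I • z)]
      simp only [K, Prod.mk.eta, smul_eq_mul, Complex.mul_re, Complex.mul_im, Complex.I_re,
        Complex.I_im, zero_mul, one_mul, zero_sub, zero_add]
      push_cast
      nth_rewrite 1 [← Complex.re_add_im z]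
      linear_combination (-(z.im : ℂ) * φ (Finsupp.single p Complex.I)) * Complex.I_mul_I
  refine ⟨K, posSemidef_of_finset fun F => Matrix.posSemidef_of_forall_nonneg fun c => ?_, ?_⟩
  -- Conjugated coefficients, so that the square of `d` carries `star (c p) * c q`.
  · let d : G × J →₀ ℂ := ∑ p : F, Finsupp.single (p : G × J) (star (c p))
    have h5 := hφsq _ (Submodule.subset_span ⟨d, rfl⟩)
    have h6 : (0 : ℂ) ≤ φ (sqCoeff d) - Complex.I * φ (Complex.I • sqCoeff d) := by
      rw [h5.2]; simpa using h5.1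
    refine h6.trans_eq ?_
    rw [← hK, sqCoeff_sum]
    simp only [map_sum, Finsupp.linearCombination_single]
    simp
  · intro g i j hg
    have h7 : ∀ z : ℂ, φ (Finsupp.single (g, i, j) z) = (z * k g i j).re := fun z => by
      have := hφ1 ⟨Finsupp.single (g, i, j) z, Finsupp.single_mem_supported ℂ _ hg⟩
      refine this.trans ?_
      change (L (Finsupp.single (g, i, j) z)).re = _
      simp [L]
    simp only [K, h7]
    apply Complex.ext <;> simp

end Krein

/-! ### From the cone of squares to positive matrices over C*(G). -/

section Compression

variable {G : Type u} [Group G] {S : Finset G}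

/-- The set `S S⁻¹`. -/
def diffs (S : Finset G) : Set G := {g | ∃ s t : S, g = (s : G) * (t : G)⁻¹}

theorem inv_mem_diffs {g : G} (h : g ∈ diffs S) : g⁻¹ ∈ diffs S := by
  obtain ⟨s, t, rfl⟩ := h
  exact ⟨t, s, by simp⟩

theorem symb_add {ι : Type*} [Fintype ι] (A B : S → S → Matrix ι ι ℂ) :
    symb (A + B) = symb A + symb B := by
  simp [symb, Finset.sum_add_distrib]

/-- Each element of SS⁻¹ is written as one quotient st⁻¹, and its coefficient is placed in that
entry. -/
theorem exists_symb_eq {ι : Type*} [Fintype ι] (z : G × ι × ι →₀ ℂ)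
    (hz : ∀ p ∈ z.support, p.1 ∈ diffs S) : ∃ A : S → S → Matrix ι ι ℂ, symb A = z := by
  classical
  have key : ∀ F : Finset (G × ι × ι), (∀ p ∈ F, p.1 ∈ diffs S) →
      ∃ A : S → S → Matrix ι ι ℂ, symb A = ∑ p ∈ F, Finsupp.single p (z p) := fun F => by
    induction F using Finset.induction_on with
    | empty => exact fun _ => ⟨0, by simp [symb]⟩
    | insert p F hp ih =>
      intro hF
      obtain ⟨A, hA⟩ := ih fun q hq => hF q (Finset.mem_insert_of_mem hq)
      obtain ⟨s, t, hst⟩ := hF p (Finset.mem_insert_self _ _)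
      refine ⟨(fun s' t' => if s' = s ∧ t' = t then Matrix.single p.2.1 p.2.2 (z p) else 0) + A, ?_⟩
      rw [symb_add, hA, Finset.sum_insert hp]
      congr 1
      rw [symb, Finset.sum_eq_single s, Finset.sum_eq_single t, Finset.sum_eq_single p.2.1,
        Finset.sum_eq_single p.2.2]
      · simp [← hst]
      · intro j _ hj; simp [Ne.symm hj]
      · simp
      · intro i _ hi; simp [Ne.symm hi]
      · simp
      · intro t' _ ht; simp [ht]
      · simp
      · intro s' _ hs; simp [hs]
      · simp
  obtain ⟨A, hA⟩ := key z.support hz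
  exact ⟨A, hA.trans z.sum_single⟩

open Classical in
/-- The matrix over the group algebra with prescribed coefficients, compressed along `e`. -/
def compress {J : Type*} {ι : Type} (e : ι → J) :
    (G × J × J →₀ ℂ) →ₗ[ℂ] CStarMatrix ι ι (GroupCStar G) :=
  CStarMatrix.ofMatrixₗ.toLinearMap ∘ₗ
  LinearMap.pi fun i => LinearMap.pi fun j => Finsupp.linearCombination ℂ fun p : G × J × J =>
    if p.2 = (e i, e j) then GroupCStar.delta p.1 else 0

open Classical in
theorem compress_apply {J : Type*} {ι : Type} (e : ι → J) (w : G × J × J →₀ ℂ) (i j : ι) :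
    compress e w i j = Finsupp.linearCombination ℂ (fun p : G × J × J =>
      if p.2 = (e i, e j) then GroupCStar.delta p.1 else 0) w := rfl

theorem CStarMatrix.mul_star_nonneg {ι : Type} [Fintype ι] {A : Type*} [CStarAlgebra A]
    [PartialOrder A] [StarOrderedRing A] (y : ι → A) :
    0 ≤ (CStarMatrix.ofMatrix (Matrix.of fun i j => y i * star (y j)) : CStarMatrix ι ι A) := by
  classical
  rcases isEmpty_or_nonempty ι with h | ⟨⟨i₀⟩⟩
  · exact le_of_eq (CStarMatrix.ext fun i => (h.false i).elim)
  · let Y : CStarMatrix ι ι A := CStarMatrix.ofMatrix (Matrix.of fun i j =>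
        if j = i₀ then y i else 0)
    have : CStarMatrix.ofMatrix (Matrix.of fun i j => y i * star (y j)) = Y * star Y := by
      refine CStarMatrix.ext fun i j => ?_
      rw [CStarMatrix.mul_apply, Finset.sum_eq_single i₀]
      · simp [Y, CStarMatrix.star_apply]
      · intro k _ hk; simp [Y, hk]
      · simp
    rw [this]
    exact mul_star_self_nonneg Y

/-- A generator of the cone compresses to the matrix (y_i y_j*), where y_i collects the terms with
second index `e i`. Individual squares may have arbitrary support; only the sum is restricted where
this is applied. -/
theorem compress_nonneg {J : Type*} {ι : Type} [Fintype ι] (e : ι → J) {w : G × J × J →₀ ℂ}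
    (hw : w ∈ sqCone G J) : 0 ≤ compress e w := by
  classical
  induction hw using Submodule.span_induction with
  | mem x hx =>
    obtain ⟨c, rfl⟩ := hx
    convert CStarMatrix.mul_star_nonneg fun i : ι => c.sum fun p a =>
      if p.2 = e i then a • GroupCStar.delta p.1 else 0 using 1
    refine CStarMatrix.ext fun i j => ?_
    rw [compress_apply]
    simp only [sqCoeff, Finsupp.sum, map_sum, Finsupp.linearCombination_single,
      CStarMatrix.ofMatrix_apply, Matrix.of_apply, star_sum, Finset.sum_mul, Finset.mul_sum]
    rw [Finset.sum_comm]
    refine Finset.sum_congr rfl fun p _ => Finset.sum_congr rfl fun q _ => ?_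
    by_cases hp : q.2 = e i <;> by_cases hq : p.2 = e j <;>
      simp [hp, hq, GroupCStar.delta_mul, GroupCStar.star_delta, smul_smul, mul_comm]
  | zero => simp
  | add x y _ _ hx hy => rw [map_add]; exact add_nonneg hx hy
  | smul a x _ hx =>
    obtain ⟨y, hy⟩ := CStarAlgebra.exists_star_mul_self_of_nonneg hx
    have h1 : compress e (a • x) = star (((Real.sqrt a : ℝ) : ℂ) • y) *
        (((Real.sqrt a : ℝ) : ℂ) • y) := by
      have h2 : a • x = ((a : ℝ) : ℂ) • x := by
        ext p; simp
      rw [h2, map_smul, hy, star_smul, smul_mul_smul_comm]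
      congr 1
      rw [RCLike.star_def, Complex.conj_ofReal, ← Complex.ofReal_mul, Real.mul_self_sqrt a.2]
    rw [h1]
    exact star_mul_self_nonneg _

theorem stretch_eq_compress {ι : Type} [Fintype ι] (A : S → S → Matrix ι ι ℂ) :
    stretch S A = compress id (symb A) := by
  classical
  refine CStarMatrix.ext fun i j => ?_
  rw [stretch_apply_eq_symbPair, symbPair_eq, compress_apply]
  refine congrArg (fun F => Finsupp.linearCombination ℂ F (symb A)) (funext fun p => ?_)
  by_cases h1 : p.2.1 = i <;> by_cases h2 : p.2.2 = j <;> simp [h1, h2, Prod.ext_iff]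

/-- The pairing of an element of the cone of squares with a kernel only depends on the matrix
over `C*(G)` of that element. -/
theorem exists_symbPair_of_mem_sqCone {J : Type*} {ι : Type} [Fintype ι] {e : ι → J}
    (he : Function.Injective e) {w : G × J × J →₀ ℂ} (hw : w ∈ sqCone G J)
    (hwS : ∀ p ∈ w.support, p.1 ∈ diffs S)
    (hwe : ∀ p ∈ w.support, p.2.1 ∈ Set.range e ∧ p.2.2 ∈ Set.range e) :
    ∃ A : S → S → Matrix ι ι ℂ, 0 ≤ stretch S A ∧
      (∀ p ∈ (symb A).support, (p.1, e p.2.1, e p.2.2) ∈ w.support) ∧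
      ∀ k : G → J → J → ℂ, Finsupp.linearCombination ℂ (fun p : G × J × J => k p.1 p.2.1 p.2.2) w =
        symbPair A fun g i j => k g (e i) (e j) := by
  classical
  let f : G × ι × ι → G × J × J := fun p => (p.1, e p.2.1, e p.2.2)
  have hf : Function.Injective f := by
    rintro ⟨a, b, c⟩ ⟨a', b', c'⟩ h
    simp only [f, Prod.mk.injEq] at h
    rw [h.1, he h.2.1, he h.2.2]
  let z := Finsupp.comapDomain f w hf.injOn
  have hzw : Finsupp.mapDomain f z = w := by
    refine Finsupp.mapDomain_comapDomain f hf w ?_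
    rintro ⟨g, i, j⟩ hp
    obtain ⟨⟨i', hi⟩, ⟨j', hj⟩⟩ := hwe _ hp
    exact ⟨(g, i', j'), by simpa [f] using ⟨hi, hj⟩⟩
  have hzD : ∀ p ∈ z.support, f p ∈ w.support := fun p hp => by simpa [z] using hp
  obtain ⟨A, hA⟩ := exists_symb_eq z fun p hp => hwS _ (hzD p hp)
  have h1 : stretch S A = compress e w := by
    rw [stretch_eq_compress, hA, ← hzw]
    refine CStarMatrix.ext fun i j => ?_
    rw [compress_apply, compress_apply, Finsupp.linearCombination_mapDomain]
    refine congrArg (fun F => Finsupp.linearCombination ℂ F z) (funext fun p => ?_)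
    simp [f, Prod.ext_iff, he.eq_iff]
  refine ⟨A, h1 ▸ compress_nonneg e hw, by rw [hA]; exact hzD, fun k => ?_⟩
  rw [symbPair_eq, hA, ← hzw, Finsupp.linearCombination_mapDomain]
  rfl

/-- The positivity condition for extending kernels, in terms of the matrix order of `C*(G)`. -/
theorem re_pairing_nonneg {J : Type*} {D : Set (G × J × J)} (hDS : ∀ p ∈ D, p.1 ∈ diffs S)
    {k : G → J → J → ℂ}
    (hk : ∀ (n : ℕ) (e : Fin n → J) (A : S → S → Matrix (Fin n) (Fin n) ℂ), 0 ≤ stretch S A →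
      0 ≤ (symbPair A fun g i j => k g (e i) (e j)).re)
    {w : G × J × J →₀ ℂ} (hw : w ∈ sqCone G J) (hwD : (w.support : Set (G × J × J)) ⊆ D) :
    0 ≤ (Finsupp.linearCombination ℂ (fun p : G × J × J => k p.1 p.2.1 p.2.2) w).re := by
  classical
  let F : Finset J := w.support.image (fun p => p.2.1) ∪ w.support.image (fun p => p.2.2)
  let e : Fin F.card → J := fun i => (F.equivFin.symm i : J)
  have he : Function.Injective e := Subtype.val_injective.comp F.equivFin.symm.injective
  have heF : ∀ j ∈ F, ∃ i, e i = j := fun j hj => ⟨F.equivFin ⟨j, hj⟩, by simp [e]⟩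
  obtain ⟨A, hA, -, h⟩ := exists_symbPair_of_mem_sqCone (S := S) he hw
    (fun p hp => hDS p (hwD hp)) fun p hp =>
      ⟨heF _ (Finset.mem_union_left _ (Finset.mem_image_of_mem _ hp)),
        heF _ (Finset.mem_union_right _ (Finset.mem_image_of_mem _ hp))⟩
  rw [h]
  exact hk _ e A hA

end Compression

/-! ### Fejér–Riesz implies positive extension. -/

section PositiveExtension

universe w w'

variable {G : Type u} [Group G] {S : Finset G} {H : Type v} [NormedAddCommGroup H]
  [InnerProductSpace ℂ H]

theorem exists_toeplitz_function {B : Type*} [Zero B] {T : Matrix S S B} (hT : IsToeplitz T) :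
    ∃ k : G → B, (∀ s t : S, T s t = k ((s : G) * (t : G)⁻¹)) ∧ ∀ g, g ∉ diffs S → k g = 0 := by
  classical
  refine ⟨fun g => if h : g ∈ diffs S then T h.choose h.choose_spec.choose else 0,
    fun s t => ?_, fun g hg => by simp [hg]⟩
  have h : (s : G) * (t : G)⁻¹ ∈ diffs S := ⟨s, t, rfl⟩
  simp only [h, dif_pos]
  exact hT _ _ _ _ h.choose_spec.choose_spec

theorem isPosSemidefFun_of_factorization [CompleteSpace H] {E : Type*} [NormedAddCommGroup E]
    [InnerProductSpace ℂ E] [CompleteSpace E] {u : G → H →L[ℂ] H} (W : G → H →L[ℂ] E)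
    (hW : ∀ s t, (W s).adjoint ∘L W t = u (s * t⁻¹)) : IsPosSemidefFun u := fun F => by
  rw [blockOp_isPositive_iff]
  intro ξ
  have h : (0 : ℂ) ≤ inner ℂ (∑ s : F, W s (ξ s)) (∑ s : F, W s (ξ s)) := by
    rw [inner_self_eq_norm_sq_to_K]; positivity
  refine h.trans_eq ?_
  simp only [Matrix.of_apply, ← hW, sum_inner, inner_sum, ContinuousLinearMap.comp_apply,
    ContinuousLinearMap.adjoint_inner_right]
  exact Finset.sum_comm

/-- A positive semi-definite kernel on `G × (κ × I)`, with `I` indexing a basis of `H`, comes from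
operator valued functions if its diagonal value at `1` is bounded. -/
theorem exists_operators_of_kernel [CompleteSpace H] {I : Type w} {κ : Type w'}
    (b : Module.Basis I ℂ H)
    {K : G → κ × I → κ × I → ℂ}
    (hK : (Matrix.of fun p q : G × (κ × I) => K (p.1 * q.1⁻¹) p.2 q.2).PosSemidef)
    {T : H →L[ℂ] H} (hT : ∀ c i j, K 1 (c, i) (c, j) = inner ℂ (b i) (T (b j))) :
    ∃ (E : Type (max (max w w') u)) (_ : NormedAddCommGroup E) (_ : InnerProductSpace ℂ E)
        (_ : CompleteSpace E)
      (V : κ → G → H →L[ℂ] E) (U : κ → κ → G → H →L[ℂ] H),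
      (∀ c d s t, (V c s).adjoint ∘L V d t = U c d (s * t⁻¹)) ∧
        ∀ c d g i j, inner ℂ (b i) (U c d g (b j)) = K g (c, i) (d, j) := by
  obtain ⟨E, _, _, _, e, he, -⟩ := exists_hilbert_of_posSemidef _ hK
  simp only [Matrix.of_apply] at he
  -- The GNS vectors define linear maps on the Hamel basis. Their Gram form is ⟪x, Ty⟫ for every `c`
  -- and `g`, by the hypothesis at the unit, and this alone makes them bounded.
  let V₀ : κ → G → H →ₗ[ℂ] E := fun c g => b.constr ℂ fun i => e (g, c, i)
  have hV₀ : ∀ c g i, V₀ c g (b i) = e (g, c, i) := fun c g i => b.constr_basis ℂ _ i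
  have hin : ∀ c g x y, inner ℂ (V₀ c g x) (V₀ c g y) = (inner ℂ x (T y) : ℂ) := by
    intro c g x y
    rw [← b.linearCombination_repr x, ← b.linearCombination_repr y]
    simp only [Finsupp.linearCombination_apply, Finsupp.sum, map_sum, map_smul, sum_inner,
      inner_sum, inner_smul_left, inner_smul_right, hV₀, he, mul_inv_cancel, hT]
  have hbound : ∀ c g x, ‖V₀ c g x‖ ≤ Real.sqrt ‖T‖ * ‖x‖ := fun c g x => by
    have h1 : ‖V₀ c g x‖ ^ 2 ≤ ‖T‖ * ‖x‖ ^ 2 := by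
      rw [← inner_self_eq_norm_sq (𝕜 := ℂ), hin]
      refine (RCLike.re_le_norm _).trans ((norm_inner_le_norm _ _).trans ?_)
      have := T.le_opNorm x
      nlinarith [norm_nonneg x]
    refine (sq_le_sq₀ (norm_nonneg _) (by positivity)).1 (h1.trans_eq ?_)
    rw [mul_pow, Real.sq_sqrt (norm_nonneg _)]
  let V : κ → G → H →L[ℂ] E := fun c g => (V₀ c g).mkContinuous _ (hbound c g)
  have hV : ∀ c g i, V c g (b i) = e (g, c, i) := hV₀
  have hVin : ∀ c d s t i j, inner ℂ (b i) (((V c s).adjoint ∘L V d t) (b j)) =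
      K (s * t⁻¹) (c, i) (d, j) := fun c d s t i j => by
    rw [ContinuousLinearMap.comp_apply, ContinuousLinearMap.adjoint_inner_right, hV, hV, he]
  refine ⟨E, inferInstance, inferInstance, inferInstance, V,
    fun c d g => (V c 1).adjoint ∘L V d g⁻¹, fun c d s t => ?_, fun c d g i j => ?_⟩
  · refine ContinuousLinearMap.coe_injective (b.ext fun j =>
        InnerProductSpace.ext_inner_left_basis b fun i => ?_)
    refine (hVin c d s t i j).trans (Eq.trans ?_ (hVin c d 1 _ i j).symm)
    simp
  · simpa using hVin c d 1 g⁻¹ i j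

/-- Coefficients in the cone of squares with support over SS⁻¹ give a positive matrix over C*(G).
Fejér–Riesz rewrites it by squares over `S`, on which the positive Toeplitz matrix T is nonnegative.
The extension theorem then applies. -/
theorem CompleteFejerRieszProperty.posExtension (h : CompleteFejerRieszProperty S) :
    PositiveOperatorExtensionProperty.{u, v} S := by
  intro H _ _ _ T hT hpos
  obtain ⟨k, hk, hk0⟩ := exists_toeplitz_function hT
  let b := Module.Basis.ofVectorSpace ℂ H
  by_cases hS : S.Nonempty
  swap
  · rw [Finset.not_nonempty_iff_eq_empty] at hS
    subst hS
    refine ⟨0, fun F => blockOp_isPositive_iff.2 fun ξ => by simp, fun s => absurd s.2 (Finset.notMem_empty _)⟩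
  obtain ⟨s₁, hs₁⟩ := hS
  let s₀ : S := ⟨s₁, hs₁⟩
  have h1 : (1 : G) ∈ diffs S := ⟨s₀, s₀, by simp⟩
  let k' : G → Unit × _ → Unit × _ → ℂ := fun g i j => inner ℂ (b i.2) (k g (b j.2))
  have hT1 : T = Matrix.of fun s t : S => k ((s : G) * (t : G)⁻¹) := by
    ext1 s t; exact hk s t
  rw [hT1] at hpos
  obtain ⟨K, hK, hKk⟩ := exists_posSemidef_extension {p | p.1 ∈ diffs S} (fun _ => h1)
    (fun g i j hg => inv_mem_diffs hg) k' (by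
      rintro g i j ⟨s, t, hst⟩
      have := (posSemidef_of_blockOp_isPositive hpos (fun p : S × _ => p.1)
        (fun p => b p.2.2)).1.apply (s, i) (t, j)
      have hg : g = (s : G) * (t : G)⁻¹ := hst
      simp only [k', hg, mul_inv_rev, inv_inv]
      exact this) (fun w hw hwD => re_pairing_nonneg (S := S) (fun p hp => hp) (by
      intro n e A hA
      have := symbPair_nonneg_of_mem_sosCone (K := fun g i j => k' g (e i) (e j))
        (h n _ hA ⟨A, rfl⟩) (posSemidef_of_blockOp_isPositive hpos (fun p : S × _ => p.1)
          (fun p => b (e p.2).2))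
      exact (Complex.le_def.1 this).1) hw hwD)
  obtain ⟨E, _, _, _, V, U, hVU, hU⟩ := exists_operators_of_kernel b hK (T := k 1)
    fun c i j => hKk 1 (c, i) (c, j) h1
  refine ⟨U () (), isPosSemidefFun_of_factorization (V ()) fun s t => hVU () () s t,
    fun s t => ?_⟩
  rw [hk]
  refine ContinuousLinearMap.coe_injective (b.ext fun j =>
      InnerProductSpace.ext_inner_left_basis b fun i => ?_)
  exact ((hU () () _ i j).trans (hKk _ ((), i) ((), j) ⟨s, t, rfl⟩)).symm

end PositiveExtension

/-! ### Congruences of coefficients and kernels. -/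

section Normalisation

theorem nonneg_of_forall_pos_add_mul {r c : ℝ} (h : ∀ ε : ℝ, 0 < ε → 0 ≤ r + ε * c) : 0 ≤ r := by
  have hlim : Filter.Tendsto (fun ε : ℝ => r + ε * c) (nhdsWithin 0 (Set.Ioi 0)) (nhds r) := by
    have : Filter.Tendsto (fun ε : ℝ => r + ε * c) (nhds 0) (nhds (r + 0 * c)) :=
      Continuous.tendsto (by fun_prop) 0
    rw [zero_mul, add_zero] at this
    exact this.mono_left nhdsWithin_le_nhds
  exact ge_of_tendsto hlim (Filter.eventually_of_mem self_mem_nhdsWithin h)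

open scoped MatrixOrder Matrix.Norms.L2Operator in
-- P = (a + ε)^{-1/2} and D = P⁻¹; the summand ε provides invertibility.
theorem Matrix.PosSemidef.exists_normalise {ι : Type*} [Fintype ι] [DecidableEq ι]
    {a : Matrix ι ι ℂ} (ha : a.PosSemidef) {ε : ℝ} (hε : 0 < ε) :
    ∃ P D : Matrix ι ι ℂ, P.IsHermitian ∧ P * (a + (ε : ℂ) • 1) * P = 1 ∧ P * D = 1 := by
  have h : IsStrictlyPositive (a + (ε : ℂ) • 1) :=
    .nonneg_add ha.nonneg
      (IsStrictlyPositive.smul (𝕜 := ℂ) (by exact_mod_cast hε) isStrictlyPositive_one)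
  obtain ⟨C, D, hC, -, h1, h2, -⟩ := h.exists_normalise
  exact ⟨C, D, hC, h1, h2⟩

variable {G : Type u} [Group G] {ι : Type} [Fintype ι] {S : Finset G}

/-- The kernel obtained by congruence with scalar matrices. -/
def conjKer {M : Type*} [AddCommMonoid M] [Module ℂ M] (P R : Matrix ι ι ℂ) (K : G → ι → ι → M) :
    G → ι → ι → M :=
  fun g i j => ∑ p, ∑ q, (P p i * R j q) • K g p q

theorem sum_conj {M : Type*} [AddCommMonoid M] [Module ℂ M] (P a R : Matrix ι ι ℂ)
    (k : ι → ι → M) : ∑ i, ∑ j, (P * a * R) i j • k i j =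
      ∑ i, ∑ j, a i j • ∑ p, ∑ q, (P p i * R j q) • k p q := by
  simp only [Matrix.mul_apply, Finset.sum_smul, Finset.smul_sum, Finset.sum_mul, smul_smul]
  simp only [← Finset.sum_product', Finset.univ_product_univ]
  let e : ι × ι × ι × ι ≃ ι × ι × ι × ι :=
    ⟨fun p => (p.2.2.2, p.2.2.1, p.1, p.2.1), fun p => (p.2.2.1, p.2.2.2, p.2.1, p.1),
      fun _ => rfl, fun _ => rfl⟩
  exact Fintype.sum_equiv e _ _ fun _ => by congr 1; simp only [e, Equiv.coe_fn_mk]; ring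

theorem sum_diag_eq_of_conj_eq_one [DecidableEq ι] {Q a : Matrix ι ι ℂ} {ε : ℂ}
    (h : Q * (a + ε • 1) * Q = 1) (k : G → ι → ι → ℂ) (g : G) :
    ∑ i, k g i i = ∑ i, ∑ j, a i j • conjKer Q Q k g i j + ε * ∑ i, conjKer Q Q k g i i := by
  have h1 := sum_conj Q (a + ε • 1) Q (k g)
  rw [h] at h1
  have h2 : ∑ i, ∑ j, (1 : Matrix ι ι ℂ) i j • k g i j = ∑ i, k g i i :=
    Finset.sum_congr rfl fun i _ => by simp [Matrix.one_apply]
  rw [← h2, h1, Finset.mul_sum, ← Finset.sum_add_distrib]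
  refine Finset.sum_congr rfl fun i _ => ?_
  simp only [Matrix.add_apply, Matrix.smul_apply, Matrix.one_apply, add_smul,
    Finset.sum_add_distrib, conjKer]
  congr 1
  rw [Finset.sum_eq_single i]
  · simp
  · intro j _ hj; simp [Ne.symm hj]
  · simp

theorem symbPair_conj {M : Type*} [AddCommMonoid M] [Module ℂ M] (P R : Matrix ι ι ℂ)
    (A : S → S → Matrix ι ι ℂ) (K : G → ι → ι → M) :
    symbPair (fun s t => P * A s t * R) K = symbPair A (conjKer P R K) :=
  Finset.sum_congr rfl fun _ _ => Finset.sum_congr rfl fun _ _ => sum_conj _ _ _ _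

/-- On the full matrix the operation is congruence by 1 ⊗ Wᵀ. -/
theorem posSemidef_toeplitzMatrix_conjKer {W : Matrix ι ι ℂ} (hW : W.IsHermitian)
    {K : G → ι → ι → ℂ} (hK : (toeplitzMatrix S K).PosSemidef) :
    (toeplitzMatrix S (conjKer W W K)).PosSemidef := by
  classical
  have := hK.conjTranspose_mul_mul_same (Matrix.kronecker (1 : Matrix S S ℂ) W.transpose)
  convert this using 1
  ext ⟨s, i⟩ ⟨t, j⟩
  have hW' : ∀ i j, star (W i j) = W j i := fun i j => hW.apply j i
  simp only [Matrix.mul_apply, Matrix.kronecker, Matrix.kroneckerMap_apply, Fintype.sum_prod_type,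
    Matrix.one_apply, Matrix.conjTranspose_apply, Matrix.transpose_apply, star_mul', hW']
  rw [Finset.sum_eq_single t]
  · refine Finset.sum_comm.trans (Finset.sum_congr rfl fun q _ => ?_)
    rw [Finset.sum_eq_single s, Finset.sum_mul]
    · refine Finset.sum_congr rfl fun p _ => ?_
      simp only [toeplitzMatrix, Matrix.of_apply, if_true, star_one, one_mul, smul_eq_mul]
      ring
    · intro r _ hr; simp [hr]
    · simp
  · intro r _ hr; simp [hr]
  · simp

theorem symbPair_eq_of_symb_support {α : S → S → Matrix ι ι ℂ}
    (hα : ∀ g i j, g ≠ 1 → symb α (g, i, j) = 0) {M : Type*} [AddCommMonoid M] [Module ℂ M]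
    (K : G → ι → ι → M) : symbPair α K = ∑ i, ∑ j, symb α (1, i, j) • K 1 i j := by
  classical
  rw [symbPair_eq, Finsupp.linearCombination_apply,
    Finsupp.sum_of_support_subset (s := Finset.univ.image fun p : ι × ι => ((1 : G), p))]
  · rw [Finset.sum_image (fun _ _ _ _ h => (Prod.ext_iff.1 h).2), Fintype.sum_prod_type]
  · rintro ⟨g, i, j⟩ hp
    have : g = 1 := by
      by_contra hg
      exact Finsupp.mem_support_iff.1 hp (hα g i j hg)
    simp [this]
  · simp

/-- Transport to arbitrary finite index types, needed for the 2 × 2 blocks. -/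
theorem CompleteFejerRieszProperty.mem_sosCone (h : CompleteFejerRieszProperty S)
    {A : S → S → Matrix ι ι ℂ} (hA : 0 ≤ stretch S A) : stretch S A ∈ sosCone S := by
  classical
  let e := Fintype.equivFin ι
  let A' : S → S → Matrix (Fin (Fintype.card ι)) (Fin (Fintype.card ι)) ℂ :=
    fun s t => (A s t).submatrix e.symm e.symm
  have hA' : 0 ≤ stretch S A' := by
    obtain ⟨y, hy⟩ := CStarAlgebra.exists_star_mul_self_of_nonneg hA
    let z : CStarMatrix (Fin (Fintype.card ι)) (Fin (Fintype.card ι)) (GroupCStar G) :=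
      CStarMatrix.ofMatrix (Matrix.of fun i j => y (e.symm i) (e.symm j))
    have : stretch S A' = star z * z := by
      refine CStarMatrix.ext fun i j => ?_
      have h1 := congrArg (fun x : CStarMatrix ι ι (GroupCStar G) => x (e.symm i) (e.symm j)) hy
      simp only [stretch_apply, CStarMatrix.mul_apply, CStarMatrix.star_apply] at h1
      simp only [stretch_apply, CStarMatrix.mul_apply, CStarMatrix.star_apply, A', z,
        Matrix.submatrix_apply, CStarMatrix.ofMatrix_apply, Matrix.of_apply]
      rw [h1]
      exact (Equiv.sum_comp e.symm fun k => star (y k (e.symm i)) * y k (e.symm j)).symm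
    rw [this]
    exact star_mul_self_nonneg z
  refine mem_sosCone_of_forall_symbPair fun K hK => ?_
  have h2 := symbPair_nonneg_of_mem_sosCone (h _ _ hA' ⟨A', rfl⟩)
    (K := fun g i j => K g (e.symm i) (e.symm j))
    (hK.submatrix fun p : S × Fin (Fintype.card ι) => (p.1, e.symm p.2))
  refine h2.trans_eq ?_
  simp only [symbPair, A', Matrix.submatrix_apply]
  refine Finset.sum_congr rfl fun s _ => Finset.sum_congr rfl fun t _ => ?_
  rw [← Equiv.sum_comp e.symm]
  refine Finset.sum_congr rfl fun i _ => ?_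
  rw [← Equiv.sum_comp e.symm]

end Normalisation

/-! ### The 2 × 2 estimate with scalar diagonal blocks. -/

section Estimate

variable {G : Type u} [Group G] {S : Finset G} {H : Type v} [NormedAddCommGroup H]
  [InnerProductSpace ℂ H]

/-- Adding ε to the block matrix and conjugating by diag(P, R) normalises both diagonal blocks to
the identity, leaving P Y R in the corner. This works because α and β are scalar matrices, with
coefficients only at the unit. -/
theorem conj_mem_sosUnitBall [DecidableEq G] {ι : Type} [Fintype ι] [DecidableEq ι] (s₀ : S)
    {α Y β : S → S → Matrix ι ι ℂ}
    (hsos : stretch S (blockCoeff α Y (fun s t => (Y t s).conjTranspose) β) ∈ sosCone S)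
    (hα : ∀ g i j, g ≠ 1 → symb α (g, i, j) = 0) (hβ : ∀ g i j, g ≠ 1 → symb β (g, i, j) = 0)
    {ε : ℝ} (hε : 0 < ε) {P R : Matrix ι ι ℂ} (hP : P.IsHermitian) (hR : R.IsHermitian)
    (hPα : P * (Matrix.of (fun i j => symb α (1, i, j)) + (ε : ℂ) • 1) * P = 1)
    (hRβ : R * (Matrix.of (fun i j => symb β (1, i, j)) + (ε : ℂ) • 1) * R = 1) :
    stretch S (fun s t => P * Y s t * R) ∈ sosUnitBall S := by
  rw [mem_sosUnitBall_iff s₀]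
  refine mem_sosCone_of_forall_symbPair fun K hK => ?_
  let W : Matrix (ι ⊕ ι) (ι ⊕ ι) ℂ := Matrix.fromBlocks P 0 0 R
  have hW : W.IsHermitian := by
    rw [Matrix.IsHermitian, Matrix.fromBlocks_conjTranspose, hP, hR]
    simp [W]
  have hK' := posSemidef_toeplitzMatrix_conjKer hW hK
  have h1 := symbPair_nonneg_of_mem_sosCone hsos hK'
  have h2 : 0 ≤ symbPair (unitCoeff s₀ : S → S → Matrix (ι ⊕ ι) (ι ⊕ ι) ℂ) (conjKer W W K) := by
    rw [symbPair_unitCoeff]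
    refine Finset.sum_nonneg fun i _ => ?_
    have := hK'.diag_nonneg (i := (s₀, i))
    simpa [toeplitzMatrix] using this
  have h3 := add_nonneg h1 (mul_nonneg (Complex.zero_le_real.2 hε.le) h2)
  refine h3.trans_eq ?_
  rw [symbPair_unitCoeff, Fintype.sum_sum_type, symbPair_blockCoeff, symbPair_blockCoeff,
    symbPair_unitCoeff, symbPair_unitCoeff, symbPair_conj]
  have e11 : ∀ g i j, conjKer W W K g (.inl i) (.inl j) =
      conjKer P P (fun g i j => K g (.inl i) (.inl j)) g i j := fun g i j => by
    simp [conjKer, W, Fintype.sum_sum_type]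
  have e12 : ∀ g i j, conjKer W W K g (.inl i) (.inr j) =
      conjKer P R (fun g i j => K g (.inl i) (.inr j)) g i j := fun g i j => by
    simp [conjKer, W, Fintype.sum_sum_type]
  have e21 : ∀ g i j, conjKer W W K g (.inr i) (.inl j) =
      conjKer R P (fun g i j => K g (.inr i) (.inl j)) g i j := fun g i j => by
    simp [conjKer, W, Fintype.sum_sum_type]
  have e22 : ∀ g i j, conjKer W W K g (.inr i) (.inr j) =
      conjKer R R (fun g i j => K g (.inr i) (.inr j)) g i j := fun g i j => by
    simp [conjKer, W, Fintype.sum_sum_type]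
  have hY : (fun s t : S => (P * Y t s * R).conjTranspose) =
      fun s t => R * (Y t s).conjTranspose * P := by
    funext s t
    rw [Matrix.conjTranspose_mul, Matrix.conjTranspose_mul, hP, hR, Matrix.mul_assoc]
  rw [hY, symbPair_conj]
  simp only [e11, e12, e21, e22]
  rw [symbPair_eq_of_symb_support hα, symbPair_eq_of_symb_support hβ]
  rw [sum_diag_eq_of_conj_eq_one hPα (fun g i j => K g (.inl i) (.inl j)) 1,
    sum_diag_eq_of_conj_eq_one hRβ (fun g i j => K g (.inr i) (.inr j)) 1]
  simp only [Matrix.of_apply]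
  ring

/-- Compression to the coefficient at the unit is given by the trace, hence preserves positivity. -/
theorem posSemidef_symb_one {ι : Type} [Fintype ι] {A : S → S → Matrix ι ι ℂ}
    (hA : 0 ≤ stretch S A) : (Matrix.of fun i j => symb A (1, i, j)).PosSemidef := by
  convert (GroupCStar.posSemidef_coef hA).submatrix (fun i : ι => ((1 : G), i)) using 1
  ext i j
  simp [coef_stretch]

/-- The estimate for operator valued pairings in terms of the norm in the dual of `SOS(S)`. -/
theorem re_nonneg_of_norm_le (s₀ : S) {T : G → H →L[ℂ] H} {C : ℝ}
    (hC : ∀ (n : ℕ) (A : S → S → Matrix (Fin n) (Fin n) ℂ), stretch S A ∈ sosUnitBall S →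
      ‖blockOp (Matrix.of fun i j : Fin n => ∑ s : S, ∑ t : S,
        A s t i j • T ((s : G) * (t : G)⁻¹))‖ ≤ C)
    {n : ℕ} {α Y β : S → S → Matrix (Fin n) (Fin n) ℂ}
    (hsos : stretch S (blockCoeff α Y (fun s t => (Y t s).conjTranspose) β) ∈ sosCone S)
    (hα : ∀ g i j, g ≠ 1 → symb α (g, i, j) = 0) (hβ : ∀ g i j, g ≠ 1 → symb β (g, i, j) = 0)
    (v w : Fin n → H) :
    0 ≤ C * (symbPair α fun _ i j => (inner ℂ (v i) (v j) : ℂ)).re +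
      C * (symbPair β fun _ i j => (inner ℂ (w i) (w j) : ℂ)).re +
      2 * (symbPair Y fun g i j => (inner ℂ (v i) (T g (w j)) : ℂ)).re := by
  classical
  have hpos := nonneg_of_mem_sosCone hsos
  have hblock : ∀ i j, symb (blockCoeff α Y (fun s t => (Y t s).conjTranspose) β) (1, .inl i, .inl j)
      = symb α (1, i, j) ∧
      symb (blockCoeff α Y (fun s t => (Y t s).conjTranspose) β) (1, .inr i, .inr j)
      = symb β (1, i, j) := fun i j => by
    simp only [← coef_stretch, stretch_blockCoeff]
    exact ⟨rfl, rfl⟩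
  have ha : (Matrix.of fun i j => symb α (1, i, j)).PosSemidef := by
    convert (posSemidef_symb_one hpos).submatrix Sum.inl using 1
    ext i j
    exact (hblock i j).1.symm
  have hb : (Matrix.of fun i j => symb β (1, i, j)).PosSemidef := by
    convert (posSemidef_symb_one hpos).submatrix Sum.inr using 1
    ext i j
    exact (hblock i j).2.symm
  refine nonneg_of_forall_pos_add_mul (c := C * ((∑ i, (inner ℂ (v i) (v i) : ℂ)).re +
    (∑ i, (inner ℂ (w i) (w i) : ℂ)).re)) fun ε hε => ?_
  obtain ⟨P, D, hP, hPa, hPD⟩ := ha.exists_normalise hε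
  obtain ⟨R, D', hR, hRb, hRD⟩ := hb.exists_normalise hε
  have hX := hC n _ (conj_mem_sosUnitBall s₀ hsos hα hβ hε hP hR hPa hRb)
  -- η = P⁻¹v, and ζ = R⁻¹w below. Then the pairing of Y with v, w is that of PYR with η, ζ, while
  -- ‖η‖² is the form of α + ε at v, and likewise for ζ.
  let η : PiLp 2 (fun _ : Fin n => H) := WithLp.toLp 2 fun p => ∑ i, D p i • v i
  let ζ : PiLp 2 (fun _ : Fin n => H) := WithLp.toLp 2 fun p => ∑ i, D' p i • w i
  have hrec : ∀ {P D : Matrix (Fin n) (Fin n) ℂ} (_ : P * D = 1) (v : Fin n → H) (i : Fin n),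
      v i = ∑ p, P i p • ∑ j, D p j • v j := fun {P D} h v i => by
    simp only [Finset.smul_sum, smul_smul]
    rw [Finset.sum_comm]
    simp only [← Finset.sum_smul, ← Matrix.mul_apply, h, Matrix.one_apply, ite_smul, one_smul,
      zero_smul, Finset.sum_ite_eq, Finset.mem_univ, if_true]
  have hv : ∀ i, v i = ∑ p, P i p • η p := hrec hPD v
  have hw : ∀ i, w i = ∑ p, R i p • ζ p := hrec hRD w
  have hin : ∀ {P R : Matrix (Fin n) (Fin n) ℂ} (_ : P.IsHermitian) (x y : Fin n → H)
      (B : H →L[ℂ] H) (i j : Fin n), (inner ℂ (∑ p, P i p • x p) (B (∑ q, R j q • y q)) : ℂ) =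
        ∑ p, ∑ q, (P p i * R j q) • inner ℂ (x p) (B (y q)) := fun {P R} hP x y B i j => by
    simp only [map_sum, map_smul, sum_inner, inner_sum, inner_smul_left, inner_smul_right,
      Finset.mul_sum]
    rw [Finset.sum_comm]
    refine Finset.sum_congr rfl fun p _ => Finset.sum_congr rfl fun q _ => ?_
    rw [← hP.apply p i, smul_eq_mul, RCLike.star_def]
    ring
  have hnorm : ∀ {P a : Matrix (Fin n) (Fin n) ℂ} (_ : P.IsHermitian)
      (_ : P * (a + (ε : ℂ) • 1) * P = 1) (x : PiLp 2 (fun _ : Fin n => H)) (v : Fin n → H)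
      (_ : ∀ i, v i = ∑ p, P i p • x p),
      ((‖x‖ ^ 2 : ℝ) : ℂ) = ∑ i, ∑ j, a i j • (inner ℂ (v i) (v j) : ℂ) +
        ε * ∑ i, (inner ℂ (v i) (v i) : ℂ) := fun {P a} hP h x v hv => by
    have h2 : ∀ i j, (inner ℂ (v i) (v j) : ℂ) =
        ∑ p, ∑ q, (P p i * P j q) • inner ℂ (x p) (x q) := fun i j => by
      rw [hv, hv]
      exact hin hP x x (.id ℂ H) i j
    rw [← sum_inner_self, sum_diag_eq_of_conj_eq_one h (fun _ i j => (inner ℂ (x i) (x j) : ℂ))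
        (1 : G)]
    simp only [h2]
    rfl
  have h1 := hnorm hP hPa η v hv
  have h2 := hnorm hR hRb ζ w hw
  have h3 : symbPair Y (fun g i j => (inner ℂ (v i) (T g (w j)) : ℂ)) = inner ℂ η
      (blockOp (Matrix.of fun i j : Fin n => ∑ s : S, ∑ t : S,
        (P * Y s t * R) i j • T ((s : G) * (t : G)⁻¹)) ζ) := by
    rw [← symbPair_inner, symbPair_conj]
    congr 1
    funext g i j
    rw [hv, hw]
    exact hin hP η ζ (T g) i j
  rw [symbPair_eq_of_symb_support hα, symbPair_eq_of_symb_support hβ, h3]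
  have h4 := (neg_abs_le _).trans' (neg_le_neg ((Complex.abs_re_le_norm _).trans
    ((norm_inner_le_norm (𝕜 := ℂ) η _).trans (mul_le_mul_of_nonneg_left
      (ContinuousLinearMap.le_of_opNorm_le _ hX ζ) (norm_nonneg η)))))
  have h5 := congrArg Complex.re h1
  have h6 := congrArg Complex.re h2
  rw [Complex.ofReal_re, Complex.add_re, Complex.re_ofReal_mul] at h5 h6
  simp only [Matrix.of_apply] at h5 h6
  have hC0 : 0 ≤ C := (ContinuousLinearMap.opNorm_nonneg _).trans hX
  -- Replaces 2C‖η‖‖ζ‖, the bound on the corner term, by C(‖η‖² + ‖ζ‖²).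
  have h7 : 0 ≤ C * (‖η‖ - ‖ζ‖) ^ 2 := by positivity
  generalize (inner ℂ η _ : ℂ).re = z at h4 ⊢
  linear_combination h7 + 2 * h4 + C * h5 + C * h6

end Estimate

/-! ### Finiteness of the dual norm and comparison with the C*-norm. -/

section DualNorm

variable {G : Type u} [Group G] {S : Finset G} {H : Type v} [NormedAddCommGroup H]
  [InnerProductSpace ℂ H]

/-- The norm in the operator space dual of `SOS(S)` is finite. -/
theorem exists_norm_le_of_mem_sosUnitBall (s₀ : S) (k : G → H →L[ℂ] H) :
    ∃ M : ℝ, ∀ (n : ℕ) (A : S → S → Matrix (Fin n) (Fin n) ℂ), stretch S A ∈ sosUnitBall S →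
      ‖blockOp (Matrix.of fun i j : Fin n => ∑ s : S, ∑ t : S,
        A s t i j • k ((s : G) * (t : G)⁻¹))‖ ≤ M := by
  classical
  let B : Finset G := Finset.univ.image fun p : S × S => (p.1 : G) * (p.2 : G)⁻¹
  have hB : ∀ s t : S, (s : G) * (t : G)⁻¹ ∈ B := fun s t =>
    Finset.mem_image.2 ⟨(s, t), Finset.mem_univ _, rfl⟩
  let M := ∑ g ∈ B, ‖k g‖ ^ 2
  have hM : 0 ≤ M := Finset.sum_nonneg fun g _ => by positivity
  refine ⟨Real.sqrt M, fun n A hA => norm_le_of_re_inner_nonneg (Real.sqrt_nonneg M) fun η ξ => ?_⟩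
  -- Vectors in ℓ²(G, H) built from translates, so their Gram matrix is Toeplitz. Its off-diagonal
  -- corner over SS⁻¹ is ⟪η_i, k(g) ξ_j⟫, and the second diagonal corner at the unit is at most
  -- M‖ξ_j‖².
  let x : G → Fin n ⊕ Fin n → lp (fun _ : G => H) 2 := fun s =>
    Sum.elim (fun i => lp.single 2 s (η i)) (fun j => ∑ g ∈ B, lp.single 2 (g * s) (k g (ξ j)))
  let K : G → Fin n ⊕ Fin n → Fin n ⊕ Fin n → ℂ := fun g p q => inner ℂ (x g p) (x 1 q)
  have hinner : ∀ (s t : G) (v w : H),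
      (inner ℂ (lp.single (E := fun _ : G => H) 2 s v) (lp.single 2 t w) : ℂ) =
        if s = t then inner ℂ v w else 0 := fun s t v w => by
    rw [lp.inner_single_left, lp.single_apply, Pi.single_apply]
    split_ifs <;> simp
  have hshift : ∀ s t p q, (inner ℂ (x s p) (x t q) : ℂ) = K (s * t⁻¹) p q := by
    intro s t p q
    rcases p with p | p <;> rcases q with q | q <;>
      simp only [K, x, Sum.elim_inl, Sum.elim_inr, inner_sum, sum_inner, hinner, ← mul_assoc,
        mul_inv_eq_iff_eq_mul, mul_one, one_mul]
  have hK : (toeplitzMatrix S K).PosSemidef := by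
    convert posSemidef_gram_family fun p : S × (Fin n ⊕ Fin n) => x p.1 p.2 using 1
    ext p q
    simp only [toeplitzMatrix, Matrix.of_apply, hshift]
  have h2 := re_nonneg_of_mem_sosUnitBall s₀ hA hK
  have h3 : ∀ g ∈ B, ∀ i j, K g (.inl i) (.inr j) = inner ℂ (η i) (k g (ξ j)) := fun g hg i j => by
    simp only [K, x, Sum.elim_inl, Sum.elim_inr, inner_sum, hinner, mul_one]
    simp [hg]
  have h4 : symbPair A (fun g i j => K g (.inl i) (.inr j)) =
      symbPair A fun g i j => (inner ℂ (η i) (k g (ξ j)) : ℂ) := symbPair_congr _ <| by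
    ext p q
    exact h3 _ (hB p.1 q.1) _ _
  have h5 : ∀ i, K 1 (.inl i) (.inl i) = inner ℂ (η i) (η i) := fun i => by
    simp only [K, x, Sum.elim_inl, hinner, if_true]
  have h6 : ∀ j, (K 1 (.inr j) (.inr j)).re ≤ M * ‖ξ j‖ ^ 2 := fun j => by
    simp only [K, x, Sum.elim_inr, inner_sum, sum_inner, hinner, mul_one, M, Complex.re_sum,
      Finset.sum_mul]
    refine Finset.sum_le_sum fun g hg => ?_
    rw [Finset.sum_eq_single g]
    · rw [if_pos rfl, ← mul_pow]
      have h7 : (inner ℂ (k g (ξ j)) (k g (ξ j)) : ℂ).re = ‖k g (ξ j)‖ ^ 2 :=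
        inner_self_eq_norm_sq (𝕜 := ℂ) _
      rw [h7]
      exact pow_le_pow_left₀ (norm_nonneg _) ((k g).le_opNorm _) 2
    · intro h _ hh; simp [hh]
    · simp [hg]
  have h7 : (∑ j, K 1 (.inr j) (.inr j)).re ≤ M * ‖ξ‖ ^ 2 := by
    rw [Complex.re_sum, PiLp.norm_sq_eq_of_L2, Finset.mul_sum]
    exact Finset.sum_le_sum fun j _ => h6 j
  have h8 := congrArg Complex.re (sum_inner_self η)
  rw [Complex.ofReal_re] at h8
  simp only [h5] at h2
  rw [h8, h4, symbPair_inner] at h2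
  rw [Real.sq_sqrt hM]
  linarith

/-- If the 2 × 2 matrix is Y*Y with first columns A, A′ and second columns B, B′, then 1 − x*x is
the sum of the squares of B − Ax and B′ − A′x. -/
theorem norm_le_one_of_mem_sosUnitBall {ι : Type} [Fintype ι] [DecidableEq ι]
    {x : CStarMatrix ι ι (GroupCStar G)} (hx : x ∈ sosUnitBall S) : ‖x‖ ≤ 1 := by
  obtain ⟨Y, hY⟩ := CStarAlgebra.exists_star_mul_self_of_nonneg (nonneg_of_mem_sosCone hx)
  have hY' : ∀ i j, Matrix.fromBlocks (1 : Matrix ι ι (GroupCStar G)) (CStarMatrix.ofMatrix.symm x)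
      (CStarMatrix.ofMatrix.symm (star x)) 1 i j = (star Y * Y) i j := fun i j =>
    congrArg (fun z : CStarMatrix (ι ⊕ ι) (ι ⊕ ι) (GroupCStar G) => z i j) hY
  simp only [CStarMatrix.mul_apply, CStarMatrix.star_apply, Fintype.sum_sum_type] at hY'
  let A : CStarMatrix ι ι (GroupCStar G) := CStarMatrix.ofMatrix (.of fun i j =>
      Y (.inl i) (.inl j))
  let A' : CStarMatrix ι ι (GroupCStar G) := CStarMatrix.ofMatrix (.of fun i j =>
      Y (.inr i) (.inl j))
  let B : CStarMatrix ι ι (GroupCStar G) := CStarMatrix.ofMatrix (.of fun i j =>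
      Y (.inl i) (.inr j))
  let B' : CStarMatrix ι ι (GroupCStar G) := CStarMatrix.ofMatrix (.of fun i j =>
      Y (.inr i) (.inr j))
  have h1 : star A * A + star A' * A' = 1 := CStarMatrix.ext fun i j => by
    simp only [CStarMatrix.add_apply, CStarMatrix.mul_apply, CStarMatrix.star_apply]
    exact (hY' (.inl i) (.inl j)).symm
  have h2 : star A * B + star A' * B' = x := CStarMatrix.ext fun i j => by
    simp only [CStarMatrix.add_apply, CStarMatrix.mul_apply, CStarMatrix.star_apply]
    exact (hY' (.inl i) (.inr j)).symm
  have h3 : star B * A + star B' * A' = star x := CStarMatrix.ext fun i j => by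
    simp only [CStarMatrix.add_apply, CStarMatrix.mul_apply, CStarMatrix.star_apply]
    exact (hY' (.inr i) (.inl j)).symm
  have h4 : star B * B + star B' * B' = 1 := CStarMatrix.ext fun i j => by
    simp only [CStarMatrix.add_apply, CStarMatrix.mul_apply, CStarMatrix.star_apply]
    exact (hY' (.inr i) (.inr j)).symm
  have h5 : star (B - A * x) * (B - A * x) + star (B' - A' * x) * (B' - A' * x) =
      1 - star x * x := by
    have h6 : star (B - A * x) * (B - A * x) + star (B' - A' * x) * (B' - A' * x) =
        (star B * B + star B' * B') - (star B * A + star B' * A') * x -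
          star x * (star A * B + star A' * B') + star x * (star A * A + star A' * A') * x := by
      rw [star_sub, star_sub, star_mul, star_mul]
      noncomm_ring
    rw [h6, h1, h2, h3, h4]
    noncomm_ring
  have h6 : star x * x ≤ 1 :=
    sub_nonneg.1 (h5 ▸ add_nonneg (star_mul_self_nonneg _) (star_mul_self_nonneg _))
  have h7 := (CStarAlgebra.norm_le_one_iff_of_nonneg _ (star_mul_self_nonneg x)).2 h6
  rw [CStarRing.norm_star_mul_self] at h7
  nlinarith [norm_nonneg x]

end DualNorm

/-! ### Off-diagonal corners of a translation-invariant factorisation. -/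

section Dilation

theorem CStarAlgebra.exists_nonneg_add_star_mul_self {A : Type*} [CStarAlgebra A] [PartialOrder A]
    [StarOrderedRing A] (x : A) :
    ∃ d : A, 0 ≤ d ∧ d + star x * x = ((‖x‖ ^ 2 : ℝ) : ℂ) • (1 : A) := by
  refine ⟨_, sub_nonneg.2 (CStarAlgebra.star_mul_le_algebraMap_norm_sq (a := x)), ?_⟩
  rw [sub_add_cancel, Algebra.algebraMap_eq_smul_one]
  exact (Complex.coe_smul _ _).symm

theorem GroupCStar.norm_rep_le {G : Type u} [Group G] (π : UnitaryRep G) (x : GroupCStar G) :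
    ‖rep π x‖ ≤ ‖x‖ :=
  lp.norm_apply_le_norm ENNReal.top_ne_zero (x.1 : UniversalProduct G) π

variable {G : Type u} [Group G]

/-- Amplified representations are contractive: ‖x‖² − x*x is positive, and evaluating it at ξ bounds
the norm of the image of ξ. -/
theorem norm_sum_inner_rep_le {n : ℕ} (x : CStarMatrix (Fin n) (Fin n) (GroupCStar G))
    (π : UnitaryRep G) (η ξ : PiLp 2 (fun _ : Fin n => π.space)) :
    ‖∑ i, ∑ j, (inner ℂ (η i) (GroupCStar.rep π (x i j) (ξ j)) : ℂ)‖ ≤ ‖x‖ * (‖η‖ * ‖ξ‖) := by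
  let X := blockOp (Matrix.of fun i j => GroupCStar.rep π (x i j))
  have h1 : ‖X ξ‖ ≤ ‖x‖ * ‖ξ‖ := by
    obtain ⟨d, hd, hdx⟩ : ∃ d : CStarMatrix (Fin n) (Fin n) (GroupCStar G), 0 ≤ d ∧ ∀ i j, d i j =
        (if i = j then ((‖x‖ ^ 2 : ℝ) : ℂ) • 1 else 0) - (star x * x) i j := by
      obtain ⟨d, hd, hdx⟩ := CStarAlgebra.exists_nonneg_add_star_mul_self x
      refine ⟨d, hd, fun i j => ?_⟩
      have h4 := congrArg (fun z : CStarMatrix (Fin n) (Fin n) (GroupCStar G) => z i j) hdx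
      simp only [CStarMatrix.add_apply, CStarMatrix.smul_apply, CStarMatrix.one_apply] at h4
      rw [eq_sub_iff_add_eq, h4]
      split_ifs <;> simp
    have h3 := (GroupCStar.posSemidef_vecFun hd π (fun i : Fin n => i) (fun i => ξ i)).sum_nonneg
    have h4 : ∑ i, ∑ j, GroupCStar.vecFun π (ξ i) (ξ j) (d i j) =
        ((‖x‖ ^ 2 * ‖ξ‖ ^ 2 - ‖X ξ‖ ^ 2 : ℝ) : ℂ) := by
      have h5 : ∑ i, ∑ j, GroupCStar.vecFun π (ξ i) (ξ j)
          (if i = j then ((‖x‖ ^ 2 : ℝ) : ℂ) • 1 else 0) = ((‖x‖ ^ 2 * ‖ξ‖ ^ 2 : ℝ) : ℂ) := by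
        rw [Complex.ofReal_mul, ← sum_inner_self, Finset.mul_sum]
        refine Finset.sum_congr rfl fun i _ => ?_
        rw [Finset.sum_eq_single i]
        · rw [if_pos rfl, map_smul, GroupCStar.vecFun_apply, map_one]
          rfl
        · intro j _ hj; rw [if_neg (Ne.symm hj), map_zero]
        · simp
      have h6 : ∑ i, ∑ j, GroupCStar.vecFun π (ξ i) (ξ j) ((star x * x) i j) =
          ((‖X ξ‖ ^ 2 : ℝ) : ℂ) := by
        rw [← sum_inner_self]
        simp only [X, blockOp_apply, Matrix.of_apply, sum_inner, inner_sum,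
          CStarMatrix.mul_apply, CStarMatrix.star_apply, map_sum, GroupCStar.vecFun_apply, map_mul,
          map_star, mul_apply_eq_comp, ContinuousLinearMap.star_eq_adjoint,
          ContinuousLinearMap.adjoint_inner_right]
        simp only [← Finset.sum_product', Finset.univ_product_univ]
        let e : Fin n × Fin n × Fin n ≃ Fin n × Fin n × Fin n :=
          ⟨fun p => (p.2.2, p.2.1, p.1), fun p => (p.2.2, p.2.1, p.1), fun _ => rfl, fun _ => rfl⟩
        exact Fintype.sum_equiv e _ _ fun _ => rfl
      rw [Complex.ofReal_sub, ← h5, ← h6, ← Finset.sum_sub_distrib]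
      refine Finset.sum_congr rfl fun i _ => ?_
      rw [← Finset.sum_sub_distrib]
      exact Finset.sum_congr rfl fun j _ => by rw [hdx, map_sub]
    simp only [Matrix.of_apply] at h3
    rw [h4] at h3
    have h5 := Complex.zero_le_real.1 h3
    refine (sq_le_sq₀ (norm_nonneg _) (by positivity)).1 ?_
    rw [mul_pow]
    linarith
  have h2 : ∑ i, ∑ j, (inner ℂ (η i) (GroupCStar.rep π (x i j) (ξ j)) : ℂ) = inner ℂ η (X ξ) := by
    rw [inner_blockOp]
    rfl
  rw [h2]
  refine (norm_inner_le_norm _ _).trans ?_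
  exact (mul_le_mul_of_nonneg_left h1 (norm_nonneg η)).trans_eq (by ring)

theorem norm_le_of_norm_inner_le {H : Type*} [NormedAddCommGroup H] [InnerProductSpace ℂ H]
    {X : H →L[ℂ] H} {C : ℝ} (hC : 0 ≤ C)
    (h : ∀ η ξ, ‖(inner ℂ η (X ξ) : ℂ)‖ ≤ C * (‖η‖ * ‖ξ‖)) : ‖X‖ ≤ C := by
  refine X.opNorm_le_bound hC fun ξ => ?_
  have h1 := h (X ξ) ξ
  rw [inner_self_eq_norm_sq_to_K, norm_pow, RCLike.norm_ofReal, abs_norm] at h1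
  rcases (norm_nonneg (X ξ)).eq_or_lt with h0 | h0
  · rw [← h0]; positivity
  · nlinarith

variable {H : Type v} [NormedAddCommGroup H] [InnerProductSpace ℂ H] [CompleteSpace H]
  {E : Type*} [NormedAddCommGroup E] [InnerProductSpace ℂ E] [CompleteSpace E]
  {κ : Type*} {V : κ → G → H →L[ℂ] E} {U : κ → κ → G → H →L[ℂ] H}

/-- GNS applied to the translation-invariant Gram matrix of the vectors V_c(g) h_j. -/
theorem exists_unitaryRep_of_factorization
    (hVU : ∀ c d s t, (V c s).adjoint ∘L V d t = U c d (s * t⁻¹)) {J : Type} (c : J → κ)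
    (h : J → H) : ∃ (π : UnitaryRep G) (ξ : J → π.space),
      ∀ g i j, inner ℂ (ξ i) (π.op g (ξ j)) = (inner ℂ (h i) (U (c i) (c j) g (h j)) : ℂ) := by
  refine exists_unitaryRep (fun g i j => inner ℂ (h i) (U (c i) (c j) g (h j))) ?_
  convert posSemidef_gram_family fun p : G × J => V (c p.2) p.1 (h p.2) using 1
  ext p q
  simp only [Matrix.of_apply, ← hVU, ContinuousLinearMap.comp_apply,
    ContinuousLinearMap.adjoint_inner_right]

/-- Polarisation: V_false + ωV_true factorises a positive semi-definite function for every ω, and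
averaging over the fourth roots of unity with weight ω̄ isolates the corner. -/
theorem mem_fourierStieltjes_of_factorization {V : Bool → G → H →L[ℂ] E}
    {U : Bool → Bool → G → H →L[ℂ] H}
    (hVU : ∀ c d s t, (V c s).adjoint ∘L V d t = U c d (s * t⁻¹)) :
    U false true ∈ fourierStieltjes G H := by
  let v : ℂ → G → H →L[ℂ] H := fun ω => U false false + ω • U false true +
    star ω • U true false + (ω * star ω) • U true true
  have hv : ∀ ω, IsPosSemidefFun (v ω) := fun ω =>
    isPosSemidefFun_of_factorization (fun g => V false g + ω • V true g) fun s t => by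
      simp only [v, Pi.add_apply, Pi.smul_apply, ← hVU]
      ext ξ
      simp [map_smulₛₗ, mul_smul]
      abel
  have h : U false true = (1 / 4 : ℂ) • (v 1 + (-Complex.I) • v Complex.I - v (-1) +
      Complex.I • v (-Complex.I)) := by
    funext g
    ext ξ
    simp only [v, Pi.add_apply, Pi.smul_apply, Pi.sub_apply, add_apply, smul_apply, sub_apply]
    have hI : star Complex.I = -Complex.I := Complex.conj_I
    match_scalars <;> (try simp only [star_neg, star_one, hI]) <;> ring_nf <;> simp only [Complex.I_sq] <;>
      ring
  rw [h]
  have hm : ∀ ω, v ω ∈ fourierStieltjes G H := fun ω => Submodule.subset_span (hv ω)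
  exact Submodule.smul_mem _ _ (Submodule.add_mem _ (Submodule.sub_mem _ (Submodule.add_mem _ (hm _)
    (Submodule.smul_mem _ _ (hm _))) (hm _)) (Submodule.smul_mem _ _ (hm _)))

/-- The corner is a matrix coefficient of a unitary representation between vectors whose squared
norms are C times those of the given ones. Contractivity of representations bounds the map on the
span of the δ_g, and then all amplifications of its extension. -/
theorem exists_clm_of_factorization {V : Bool → G → H →L[ℂ] E}
    {U : Bool → Bool → G → H →L[ℂ] H}
    (hVU : ∀ c d s t, (V c s).adjoint ∘L V d t = U c d (s * t⁻¹)) {C : ℝ} (hC : 0 ≤ C)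
    (hU : ∀ c, U c c 1 = (C : ℂ) • 1) :
    ∃ φ : GroupCStar G →L[ℂ] (H →L[ℂ] H), (∀ g, φ (GroupCStar.delta g) = U false true g) ∧
      cbNorm φ ≤ ENNReal.ofReal C := by
  have hnorm : ∀ {π : UnitaryRep G} {ζ : π.space} {c : Bool} {x : H},
      (inner ℂ ζ (π.op 1 ζ) : ℂ) = inner ℂ x (U c c 1 x) → ‖ζ‖ ^ 2 = C * ‖x‖ ^ 2 := by
    intro π ζ c x h
    rw [UnitaryRep.op_one, hU, smul_apply, inner_smul_right] at h
    have h1 := congrArg Complex.re h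
    rw [Complex.re_ofReal_mul] at h1
    exact (inner_self_eq_norm_sq (𝕜 := ℂ) ζ).symm.trans
      (h1.trans (congrArg (C * ·) (inner_self_eq_norm_sq (𝕜 := ℂ) x)))
  let e : (G →₀ ℂ) →ₗ[ℂ] GroupCStar G := Finsupp.linearCombination ℂ GroupCStar.delta
  let f : (G →₀ ℂ) →ₗ[ℂ] (H →L[ℂ] H) := Finsupp.linearCombination ℂ (U false true)
  have he : DenseRange e := by
    have := GroupCStar.dense_span_delta (G := G)
    rwa [← Finsupp.range_linearCombination] at this
  have hfe : ∀ z, ‖f z‖ ≤ C * ‖e z‖ := fun z => by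
    refine norm_le_of_norm_inner_le (by positivity) fun η ξ => ?_
    obtain ⟨π, ζ, hζ⟩ := exists_unitaryRep_of_factorization hVU (fun b : Bool => b)
      (fun b => if b then ξ else η)
    have h1 : (inner ℂ η (f z ξ) : ℂ) = GroupCStar.vecFun π (ζ false) (ζ true) (e z) := by
      simp only [f, e, Finsupp.linearCombination_apply, Finsupp.sum, map_sum, map_smul, sum_apply,
        smul_apply, inner_sum, inner_smul_right, GroupCStar.vecFun_apply, GroupCStar.rep_delta, hζ]
      simp
    have h2 := hnorm (hζ 1 false false)
    have h3 := hnorm (hζ 1 true true)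
    simp only [if_true, Bool.false_eq_true, if_false] at h2 h3
    rw [h1, GroupCStar.vecFun_apply]
    refine (norm_inner_le_norm _ _).trans ?_
    have h4 : ‖GroupCStar.rep π (e z) (ζ true)‖ ≤ ‖e z‖ * ‖ζ true‖ :=
      ContinuousLinearMap.le_of_opNorm_le _ (GroupCStar.norm_rep_le π (e z)) _
    have h5 : ‖ζ false‖ * ‖ζ true‖ = C * (‖η‖ * ‖ξ‖) := by
      refine (sq_eq_sq₀ (by positivity) (by positivity)).1 ?_
      rw [mul_pow, h2, h3]; ring
    calc _ ≤ ‖ζ false‖ * (‖e z‖ * ‖ζ true‖) := mul_le_mul_of_nonneg_left h4 (norm_nonneg _)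
      _ = ‖e z‖ * (‖ζ false‖ * ‖ζ true‖) := by ring
      _ = _ := by rw [h5]; ring
  let φ := f.extendOfNorm e
  have hφ : ∀ g, φ (GroupCStar.delta g) = U false true g := fun g => by
    have := LinearMap.extendOfNorm_eq he ⟨C, hfe⟩ (Finsupp.single g 1)
    simpa [e, f] using this
  refine ⟨φ, hφ, iSup_le fun n => iSup_le fun x => iSup_le fun hx => ?_⟩
  rw [← ofReal_norm]
  refine ENNReal.ofReal_le_ofReal (norm_le_of_norm_inner_le hC fun η ξ => ?_)
  obtain ⟨π, ζ, hζ⟩ := exists_unitaryRep_of_factorization hVU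
    (Sum.elim (fun _ : Fin n => false) (fun _ : Fin n => true)) (Sum.elim η ξ)
  have h1 : ∀ i j a, (inner ℂ (η i) (φ a (ξ j)) : ℂ) =
      GroupCStar.vecFun π (ζ (.inl i)) (ζ (.inr j)) a := fun i j a => by
    have : (innerSL ℂ (η i)) ∘L (ContinuousLinearMap.apply ℂ H (ξ j)) ∘L φ =
        GroupCStar.vecFun π (ζ (.inl i)) (ζ (.inr j)) := GroupCStar.ext_clm fun g => by
      simp [GroupCStar.vecFun_apply, GroupCStar.rep_delta, hζ, hφ]
    exact DFunLike.congr_fun this a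
  have h2 : ‖(WithLp.toLp 2 fun i => ζ (.inl i) : PiLp 2 fun _ : Fin n => π.space)‖ ^ 2 =
      C * ‖η‖ ^ 2 := by
    rw [PiLp.norm_sq_eq_of_L2, PiLp.norm_sq_eq_of_L2, Finset.mul_sum]
    exact Finset.sum_congr rfl fun i _ => hnorm (hζ 1 (.inl i) (.inl i))
  have h3 : ‖(WithLp.toLp 2 fun i => ζ (.inr i) : PiLp 2 fun _ : Fin n => π.space)‖ ^ 2 =
      C * ‖ξ‖ ^ 2 := by
    rw [PiLp.norm_sq_eq_of_L2, PiLp.norm_sq_eq_of_L2, Finset.mul_sum]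
    exact Finset.sum_congr rfl fun i _ => hnorm (hζ 1 (.inr i) (.inr i))
  have h4 := norm_sum_inner_rep_le x π (WithLp.toLp 2 fun i => ζ (.inl i))
    (WithLp.toLp 2 fun i => ζ (.inr i))
  have h5 : ‖(WithLp.toLp 2 fun i => ζ (.inl i) : PiLp 2 fun _ : Fin n => π.space)‖ *
      ‖(WithLp.toLp 2 fun i => ζ (.inr i) : PiLp 2 fun _ : Fin n => π.space)‖ =
      C * (‖η‖ * ‖ξ‖) := by
    refine (sq_eq_sq₀ (by positivity) (by positivity)).1 ?_
    rw [mul_pow, h2, h3]; ring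
  rw [h5] at h4
  rw [inner_blockOp]
  simp only [Matrix.of_apply, h1]
  refine h4.trans ?_
  exact mul_le_of_le_one_left (by positivity) hx

end Dilation

/-! ### Fejér–Riesz implies bounded extension. -/

section BoundedExtension

variable {G : Type u} [Group G] {S : Finset G} {H : Type v} [NormedAddCommGroup H]
  [InnerProductSpace ℂ H]

/-- The kernel on `Bool × I` with diagonal corner `C` at the unit and off-diagonal corners
`k` and `k*`. -/
def offDiagKernel {I : Type*} (b : I → H) (k : G → H →L[ℂ] H) (C : ℝ) :
    G → Bool × I → Bool × I → ℂ :=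
  fun g p q => if p.1 = q.1 then C * inner ℂ (b p.2) (b q.2)
    else if p.1 = false then inner ℂ (b p.2) (k g (b q.2)) else inner ℂ (k g⁻¹ (b p.2)) (b q.2)

theorem star_offDiagKernel {I : Type*} (b : I → H) (k : G → H →L[ℂ] H) (C : ℝ) (g : G)
    (p q : Bool × I) : star (offDiagKernel b k C g⁻¹ q p) = offDiagKernel b k C g p q := by
  obtain ⟨c, i⟩ := p
  obtain ⟨d, j⟩ := q
  cases c <;> cases d <;> simp [offDiagKernel]

theorem blocks_eq_blockCoeff {ι : Type} [Fintype ι] {Q : Matrix (S × (ι ⊕ ι)) (S × (ι ⊕ ι)) ℂ}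
    (hQ : Q.IsHermitian) : blocks Q = blockCoeff (fun s t => (blocks Q s t).toBlocks₁₁)
      (fun s t => (blocks Q s t).toBlocks₁₂)
      (fun s t => ((fun s t => (blocks Q s t).toBlocks₁₂) t s).conjTranspose)
      (fun s t => (blocks Q s t).toBlocks₂₂) := by
  funext s t
  ext i j
  rcases i with i | i <;> rcases j with j | j <;>
    simp [blockCoeff, blocks, Matrix.toBlocks₁₁, Matrix.toBlocks₁₂, Matrix.toBlocks₂₂]
  exact (hQ.apply _ _).symm

/-- Fejér–Riesz turns the positive element into a sum of squares whose diagonal blocks have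
coefficients only at the unit. There the 2 × 2 estimate applies with the dual norm bound C. -/
theorem re_offDiagKernel_nonneg (h : CompleteFejerRieszProperty S) (s₀ : S) {I : Type*} (b : I → H)
    {k : G → H →L[ℂ] H} {C : ℝ}
    (hC : ∀ (n : ℕ) (A : S → S → Matrix (Fin n) (Fin n) ℂ), stretch S A ∈ sosUnitBall S →
      ‖blockOp (Matrix.of fun i j : Fin n => ∑ s : S, ∑ t : S,
        A s t i j • k ((s : G) * (t : G)⁻¹))‖ ≤ C)
    {w : G × (Bool × I) × (Bool × I) →₀ ℂ} (hw : w ∈ sqCone G (Bool × I))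
    (hwD : ∀ p ∈ w.support, p.1 ∈ diffs S ∧ (p.2.1.1 = p.2.2.1 → p.1 = 1)) :
    0 ≤ (Finsupp.linearCombination ℂ
      (fun p : G × (Bool × I) × (Bool × I) => offDiagKernel b k C p.1 p.2.1 p.2.2) w).re := by
  classical
  let F : Finset I := w.support.image (fun p => p.2.1.2) ∪ w.support.image (fun p => p.2.2.2)
  let f : Fin F.card → I := fun i => (F.equivFin.symm i : I)
  have hf : Function.Injective f := Subtype.val_injective.comp F.equivFin.symm.injective
  have hfF : ∀ j ∈ F, ∃ i, f i = j := fun j hj => ⟨F.equivFin ⟨j, hj⟩, by simp [f]⟩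
  let e : Fin F.card ⊕ Fin F.card → Bool × I := Sum.elim (fun i => (false, f i)) (fun i => (true, f i))
  have he : Function.Injective e := by
    rintro (i | i) (j | j) hij <;> simp [e, hf.eq_iff] at hij ⊢ <;> exact hij
  have heF : ∀ p : Bool × I, p.2 ∈ F → p ∈ Set.range e := by
    rintro ⟨c, j⟩ hj
    obtain ⟨i, rfl⟩ := hfF j hj
    cases c
    · exact ⟨.inl i, rfl⟩
    · exact ⟨.inr i, rfl⟩
  obtain ⟨A, hA, hAw, hpair⟩ := exists_symbPair_of_mem_sqCone (S := S) he hw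
    (fun p hp => (hwD p hp).1) fun p hp =>
      ⟨heF _ (Finset.mem_union_left _ (Finset.mem_image_of_mem _ hp)),
        heF _ (Finset.mem_union_right _ (Finset.mem_image_of_mem _ hp))⟩
  obtain ⟨Q, hQ, hAQ⟩ := mem_sosCone_iff.1 (h.mem_sosCone hA)
  have hsos : stretch S (blocks Q) ∈ sosCone S := mem_sosCone_iff.2 ⟨Q, hQ, rfl⟩
  rw [stretch_eq_iff] at hAQ
  have hsupp : ∀ g p q, symb (blocks Q) (g, p, q) ≠ 0 → (e p).1 = (e q).1 → g = 1 :=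
    fun g p q hne heq => (hwD _ (hAw (g, p, q) (by rwa [hAQ, Finsupp.mem_support_iff]))).2 heq
  rw [hpair, symbPair_eq_of_symb_eq hAQ]
  have hblock := blocks_eq_blockCoeff hQ.1
  set α : S → S → Matrix (Fin F.card) (Fin F.card) ℂ := fun s t => (blocks Q s t).toBlocks₁₁
  set Y : S → S → Matrix (Fin F.card) (Fin F.card) ℂ := fun s t => (blocks Q s t).toBlocks₁₂
  set β : S → S → Matrix (Fin F.card) (Fin F.card) ℂ := fun s t => (blocks Q s t).toBlocks₂₂
  rw [hblock] at hsos hsupp ⊢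
  have hα : ∀ g i j, g ≠ 1 → symb α (g, i, j) = 0 := fun g i j hg => by
    by_contra hne
    refine hg (hsupp g (.inl i) (.inl j) ?_ rfl)
    rw [← coef_stretch, stretch_blockCoeff]
    rwa [← coef_stretch] at hne
  have hβ : ∀ g i j, g ≠ 1 → symb β (g, i, j) = 0 := fun g i j hg => by
    by_contra hne
    refine hg (hsupp g (.inr i) (.inr j) ?_ rfl)
    rw [← coef_stretch, stretch_blockCoeff]
    rwa [← coef_stretch] at hne
  have h1 := re_nonneg_of_norm_le s₀ hC hsos hα hβ (fun i => b (f i)) (fun i => b (f i))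
  have h2 : symbPair (fun s t => (Y t s).conjTranspose)
      (fun g i j => (inner ℂ (k g⁻¹ (b (f i))) (b (f j)) : ℂ)) =
      star (symbPair Y fun g i j => (inner ℂ (b (f i)) (k g (b (f j))) : ℂ)) := by
    rw [star_symbPair]
    congr 1
    funext g i j
    simp [kerStar]
  rw [symbPair_blockCoeff]
  simp only [offDiagKernel, e, Sum.elim_inl, Sum.elim_inr, if_true, Bool.false_eq_true, if_false,
    reduceCtorEq]
  rw [h2]
  have h3 : ∀ B : S → S → Matrix (Fin F.card) (Fin F.card) ℂ,
      symbPair B (fun _ i j => (C : ℂ) * inner ℂ (b (f i)) (b (f j))) =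
        C * symbPair B fun _ i j => (inner ℂ (b (f i)) (b (f j)) : ℂ) := fun B =>
    symbPair_smul B C fun _ i j => (inner ℂ (b (f i)) (b (f j)) : ℂ)
  rw [h3, h3]
  simp only [Complex.add_re, Complex.re_ofReal_mul, RCLike.star_def, Complex.conj_re]
  linarith

/-- With C the dual norm of T, Paulsen's off-diagonal kernel extends to a positive kernel on G. Its
corner extends T with norm at most C. -/
theorem CompleteFejerRieszProperty.boundedExtension (h : CompleteFejerRieszProperty S) :
    BoundedOperatorExtensionProperty.{u, v} S := by
  classical
  intro H _ _ _ T hT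
  rcases S.eq_empty_or_nonempty with hS | ⟨s₁, hs₁⟩
  · subst hS
    refine ⟨0, Submodule.zero_mem _, fun s => absurd s.2 (Finset.notMem_empty _), 0, fun _ => rfl, ?_⟩
    have h0 : ∀ n, blockOp (0 : Matrix (Fin n) (Fin n) (H →L[ℂ] H)) = 0 := fun n => by
      ext ξ i
      rw [blockOp_apply]
      simp
    have h1 : cbNorm (0 : GroupCStar G →L[ℂ] (H →L[ℂ] H)) = 0 := by
      simp only [cbNorm, ENNReal.iSup_eq_zero]
      intro n x _
      refine Eq.trans (congrArg _ (h0 n)) ?_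
      exact enorm_zero (E := PiLp 2 (fun _ : Fin n => H) →L[ℂ] PiLp 2 (fun _ : Fin n => H))
    have h2 : toeplitzCbNorm T = 0 := by
      simp only [toeplitzCbNorm, ENNReal.iSup_eq_zero]
      intro n A _
      have : (Matrix.of fun i j : Fin n => ∑ s, ∑ t, A s t i j • T s t) = 0 := by
        ext i j : 2
        simp
      rw [this, h0]
      exact enorm_zero (E := PiLp 2 (fun _ : Fin n => H) →L[ℂ] PiLp 2 (fun _ : Fin n => H))
    rw [h1, h2]
  let s₀ : S := ⟨s₁, hs₁⟩
  have h1 : (1 : G) ∈ diffs S := ⟨s₀, s₀, by simp⟩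
  obtain ⟨k, hk, -⟩ := exists_toeplitz_function hT
  have hcb : toeplitzCbNorm T = ⨆ (n : ℕ) (A : S → S → Matrix (Fin n) (Fin n) ℂ)
      (_ : stretch S A ∈ sosUnitBall S), ‖blockOp (Matrix.of fun i j : Fin n =>
        ∑ s : S, ∑ t : S, A s t i j • k ((s : G) * (t : G)⁻¹))‖ₑ := by
    simp only [toeplitzCbNorm, hk]
  have hfin : toeplitzCbNorm T ≠ ⊤ := by
    obtain ⟨M, hM⟩ := exists_norm_le_of_mem_sosUnitBall s₀ k
    refine ne_top_of_le_ne_top (ENNReal.ofReal_ne_top (r := M)) ?_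
    rw [hcb]
    refine iSup_le fun n => iSup_le fun A => iSup_le fun hA => ?_
    rw [← ofReal_norm]
    exact ENNReal.ofReal_le_ofReal (hM n A hA)
  let C := (toeplitzCbNorm T).toReal
  have hC0 : 0 ≤ C := ENNReal.toReal_nonneg
  have hC : ∀ (n : ℕ) (A : S → S → Matrix (Fin n) (Fin n) ℂ), stretch S A ∈ sosUnitBall S →
      ‖blockOp (Matrix.of fun i j : Fin n => ∑ s : S, ∑ t : S,
        A s t i j • k ((s : G) * (t : G)⁻¹))‖ ≤ C := fun n A hA => by
    rw [← ENNReal.ofReal_le_ofReal_iff hC0, ENNReal.ofReal_toReal hfin, ofReal_norm, hcb]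
    exact le_iSup_of_le n (le_iSup_of_le A (le_iSup_of_le hA le_rfl))
  let b := Module.Basis.ofVectorSpace ℂ H
  -- The off-diagonal blocks are prescribed on SS⁻¹ and the diagonal blocks only at the unit;
  -- elsewhere the extension is free.
  obtain ⟨K, hK, hKk⟩ := exists_posSemidef_extension
    (G := G) {p : G × (Bool × _) × (Bool × _) | p.1 ∈ diffs S ∧ (p.2.1.1 = p.2.2.1 → p.1 = 1)}
    (fun _ => ⟨h1, fun _ => rfl⟩)
    (fun g i j hg => ⟨inv_mem_diffs hg.1, fun hij => inv_eq_one.2 (hg.2 hij.symm)⟩)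
    (offDiagKernel b k C) (fun g i j _ => star_offDiagKernel b k C g i j)
    (fun w hw hwD => re_offDiagKernel_nonneg h s₀ b hC hw fun p hp => hwD hp)
  obtain ⟨E, _, _, _, V, U, hVU, hU⟩ := exists_operators_of_kernel b hK (T := (C : ℂ) • 1)
    fun c i j => by
      rw [hKk 1 (c, i) (c, j) ⟨h1, fun _ => rfl⟩]
      simp [offDiagKernel]
  have hext : ∀ {X Y : H →L[ℂ] H}, (∀ i j, (inner ℂ (b i) (X (b j)) : ℂ) = inner ℂ (b i) (Y (b j))) →
      X = Y := fun hXY => ContinuousLinearMap.coe_injective (b.ext fun j =>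
    InnerProductSpace.ext_inner_left_basis b fun i => hXY i j)
  have hU1 : ∀ c, U c c 1 = (C : ℂ) • 1 := fun c => hext fun i j => by
    rw [hU, hKk 1 (c, i) (c, j) ⟨h1, fun _ => rfl⟩]
    simp [offDiagKernel]
  have hUT : ∀ s t : S, T s t = U false true ((s : G) * (t : G)⁻¹) := fun s t => by
    rw [hk]
    refine hext fun i j => ?_
    rw [hU, hKk _ (false, i) (true, j) ⟨⟨s, t, rfl⟩, fun h => absurd h (by simp)⟩]
    simp [offDiagKernel]
  obtain ⟨φ, hφ, hφC⟩ := exists_clm_of_factorization hVU hC0 hU1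
  refine ⟨U false true, mem_fourierStieltjes_of_factorization hVU, hUT, φ, hφ,
    le_antisymm (hφC.trans_eq (ENNReal.ofReal_toReal hfin)) ?_⟩
  -- The reverse inequality: the unit ball of SOS(S) lies in that of C*(G), and φ agrees with φ_T
  -- there.
  refine iSup_le fun n => iSup_le fun A => iSup_le fun hA => ?_
  refine le_iSup_of_le n (le_iSup_of_le (stretch S A)
    (le_iSup_of_le (norm_le_one_of_mem_sosUnitBall hA) (le_of_eq ?_)))
  congr 2
  ext i j : 2
  simp only [Matrix.of_apply, stretch_apply, map_sum, map_smul, hφ, hUT]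

end BoundedExtension

/-! ### Fejér–Riesz implies the duality of Toeplitz and Fourier systems. -/

section Duality

variable {G : Type u} [Group G] {S : Finset G}

/-- The generators of the Fourier system. -/
def fourierDelta (s t : S) : fourierSystem S :=
  ⟨GroupCStar.delta ((s : G) * (t : G)⁻¹), Submodule.subset_span ⟨s, s.2, t, t.2, rfl⟩⟩

theorem exists_eq_sum_fourierDelta (x : fourierSystem S) :
    ∃ a : S → S → ℂ, x = ∑ s, ∑ t, a s t • fourierDelta s t := by
  obtain ⟨x, hx⟩ := x
  induction hx using Submodule.span_induction with
  | mem x hx =>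
    classical
    obtain ⟨s, hs, t, ht, rfl⟩ := hx
    refine ⟨fun s' t' => if s' = ⟨s, hs⟩ ∧ t' = ⟨t, ht⟩ then 1 else 0, ?_⟩
    rw [Finset.sum_eq_single ⟨s, hs⟩, Finset.sum_eq_single ⟨t, ht⟩]
    · simp [fourierDelta]
    · intro t' _ ht; simp [ht]
    · simp
    · intro s' _ hs; simp [hs]
    · simp
  | zero => exact ⟨0, by simp; rfl⟩
  | add x y hx hy ihx ihy =>
    obtain ⟨a, ha⟩ := ihx
    obtain ⟨b, hb⟩ := ihy
    refine ⟨a + b, ?_⟩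
    simp only [Pi.add_apply, add_smul, Finset.sum_add_distrib, ← ha, ← hb]
    rfl
  | smul c x hx ih =>
    obtain ⟨a, ha⟩ := ih
    refine ⟨c • a, ?_⟩
    simp only [Pi.smul_apply, smul_assoc, ← Finset.smul_sum, ← ha]
    rfl

theorem exists_stretch_eq {n : ℕ} (x : Matrix (Fin n) (Fin n) (fourierSystem S)) :
    ∃ A : S → S → Matrix (Fin n) (Fin n) ℂ,
      (∀ i j, x i j = ∑ s, ∑ t, A s t i j • fourierDelta s t) ∧
      (CStarMatrix.ofMatrix (x.map (fun a => (a : GroupCStar G))) :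
        CStarMatrix (Fin n) (Fin n) (GroupCStar G)) = stretch S A := by
  choose a ha using fun i j => exists_eq_sum_fourierDelta (x i j)
  refine ⟨fun s t => .of fun i j => a i j s t, ha, CStarMatrix.ext fun i j => ?_⟩
  rw [stretch_apply]
  have := congrArg (Submodule.subtype _) (ha i j)
  simpa [fourierDelta, map_sum] using this

/-- The Toeplitz matrix of values of a functional on the Fourier system. -/
def dualToToeplitz (S : Finset G) : Module.Dual ℂ (fourierSystem S) →ₗ[ℂ] toeplitzSystem S where
  toFun F := ⟨.of fun s t => F (fourierDelta s t), fun s₁ t₁ s₂ t₂ h => by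
    simp only [Matrix.of_apply, fourierDelta, h]⟩
  map_add' _ _ := rfl
  map_smul' _ _ := rfl

theorem dualToToeplitz_apply (F : Module.Dual ℂ (fourierSystem S)) (s t : S) :
    (dualToToeplitz S F : Matrix S S ℂ) s t = F (fourierDelta s t) := rfl

/-- Injective because the generators span; surjective because the coefficient functionals separate
the distinct values of st⁻¹. -/
theorem dualToToeplitz_bijective : Function.Bijective (dualToToeplitz S) := by
  classical
  constructor
  · refine (injective_iff_map_eq_zero _).2 fun F hF => LinearMap.ext fun x => ?_
    obtain ⟨a, rfl⟩ := exists_eq_sum_fourierDelta x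
    have : ∀ s t, F (fourierDelta s t) = 0 := fun s t => by
      rw [← dualToToeplitz_apply, hF]
      rfl
    simp [map_sum, this]
  · intro T
    obtain ⟨k, hk, -⟩ := exists_toeplitz_function T.2
    let B : Finset G := Finset.univ.image fun p : S × S => (p.1 : G) * (p.2 : G)⁻¹
    refine ⟨∑ g ∈ B, k g • ((GroupCStar.coef g).toLinearMap ∘ₗ (fourierSystem S).subtype),
      Subtype.ext ?_⟩
    ext s t
    have hB : (s : G) * (t : G)⁻¹ ∈ B := Finset.mem_image.2 ⟨(s, t), Finset.mem_univ _, rfl⟩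
    rw [dualToToeplitz_apply, hk]
    simp [fourierDelta, GroupCStar.coef_delta, hB]

theorem fourierDelta_mem_fourierCones {n : ℕ} (a : Fin n → S) :
    (Matrix.of fun i j => fourierDelta (a i) (a j)) ∈ fourierCones S n := by
  have h := CStarMatrix.mul_star_nonneg fun i : Fin n => GroupCStar.delta (a i : G)
  refine h.trans_eq (CStarMatrix.ext fun i j => ?_)
  exact ((GroupCStar.delta_mul _ _).trans (congrArg _ (GroupCStar.star_delta _).symm)).symm

/-- The matrix (δ_{st⁻¹}) over `S` has the form yy*, hence is positive; a positive matrix of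
functionals is evaluated there. -/
theorem posSemidef_of_mem_dualCones {n : ℕ}
    {F : Matrix (Fin n) (Fin n) (Module.Dual ℂ (fourierSystem S))}
    (hF : F ∈ dualCones (fourierCones S) n) :
    (Matrix.of fun p q : Fin n × S => F p.1 q.1 (fourierDelta p.2 q.2)).PosSemidef := by
  let e := Fintype.equivFin S
  have := hF _ _ (fourierDelta_mem_fourierCones fun i => e.symm i)
  convert this.submatrix (fun p : Fin n × S => (e p.2, p.1)) using 1
  ext p q
  simp

theorem posSemidef_contraction {X Y ι : Type*} [Fintype X] [Fintype Y] [Fintype ι]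
    {M : Matrix (X × Y) (X × Y) ℂ} (hM : M.PosSemidef) (c : ι → X → ℂ) :
    (Matrix.of fun p q : Y × ι =>
      ∑ a, ∑ b, star (c p.2 a) * c q.2 b * M (a, p.1) (b, q.1)).PosSemidef := by
  classical
  refine Matrix.posSemidef_of_forall_nonneg fun d => ?_
  refine (hM.sum_mul_nonneg fun r : X × Y => ∑ i, c i r.1 * d (r.2, i)).trans_eq ?_
  simp only [Fintype.sum_prod_type, Matrix.of_apply, star_sum, star_mul', Finset.sum_mul,
    Finset.mul_sum]
  simp only [← Finset.sum_product', Finset.univ_product_univ]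
  let e : X × Y × X × Y × ι × ι ≃ Y × ι × Y × ι × X × X :=
    ⟨fun p => (p.2.1, p.2.2.2.2.2, p.2.2.2.1, p.2.2.2.2.1, p.1, p.2.2.1),
      fun p => (p.2.2.2.2.1, p.1, p.2.2.2.2.2, p.2.2.1, p.2.2.2.1, p.2.1), fun _ => rfl, fun _ => rfl⟩
  exact Fintype.sum_equiv e _ _ fun _ => by simp only [e, Equiv.coe_fn_mk]; ring

/-- The map is the inverse of evaluation at the generators. Evaluation is always completely
positive; its inverse is so because positive elements are sums of squares, which pair nonnegatively
with contractions of positive Toeplitz block matrices. -/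
theorem CompleteFejerRieszProperty.completelyOrderIsomorphic (h : CompleteFejerRieszProperty S) :
    CompletelyOrderIsomorphic (toeplitzCones S) (dualCones (fourierCones S)) := by
  let f := (LinearEquiv.ofBijective _ (dualToToeplitz_bijective (S := S))).symm
  have hf : ∀ T s t, f T (fourierDelta s t) = (T : Matrix S S ℂ) s t := fun T s t => by
    rw [← dualToToeplitz_apply]
    exact congrArg (fun T : toeplitzSystem S => (T : Matrix S S ℂ) s t)
      ((LinearEquiv.ofBijective _ (dualToToeplitz_bijective (S := S))).apply_symm_apply T)
  refine ⟨f, fun n X hX k x hx => ?_, fun n F hF => ?_⟩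
  · obtain ⟨A, hxA, hA⟩ := exists_stretch_eq x
    have hsos := h _ _ hx ⟨A, hA⟩
    rw [hA] at hsos
    choose κ hκ _ using fun a b => exists_toeplitz_function (X a b).2
    refine Matrix.posSemidef_of_forall_nonneg fun c => ?_
    have hK : (toeplitzMatrix S fun g i j =>
        ∑ a, ∑ b, star (c (i, a)) * c (j, b) * κ a b g).PosSemidef := by
      convert posSemidef_contraction hX fun i a => c (i, a) using 1
      ext p q
      simp only [toeplitzMatrix, Matrix.of_apply, hκ]
    refine (symbPair_nonneg_of_mem_sosCone hsos hK).trans_eq ?_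
    simp only [symbPair, Matrix.of_apply, Matrix.map_apply, hxA, map_sum, map_smul, hf, hκ,
      Finset.mul_sum, smul_eq_mul, Fintype.sum_prod_type]
    simp only [← Finset.sum_product', Finset.univ_product_univ]
    let e : S × S × Fin k × Fin k × Fin n × Fin n ≃ Fin k × Fin n × Fin k × Fin n × S × S :=
      ⟨fun p => (p.2.2.1, p.2.2.2.2.1, p.2.2.2.1, p.2.2.2.2.2, p.1, p.2.1),
        fun p => (p.2.2.2.2.1, p.2.2.2.2.2, p.1, p.2.2.1, p.2.1, p.2.2.2.1), fun _ => rfl, fun _ => rfl⟩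
    exact Fintype.sum_equiv e _ _ fun _ => by simp only [e, Equiv.coe_fn_mk]; ring
  · exact posSemidef_of_mem_dualCones hF

end Duality

/-! ### The algebra generated by the Toeplitz matrices. -/

section ToeplitzAlgebra

variable {G : Type u} [Group G]

/-- Two elements of `S` are equivalent if they admit the same left translations within `S`. -/
def transSetoid (S : Finset G) : Setoid S where
  r s t := ∀ g : G, g * s ∈ S ↔ g * t ∈ S
  iseqv := ⟨fun _ _ => Iff.rfl, fun h g => (h g).symm, fun h h' g => (h g).trans (h' g)⟩

variable {S : Finset G}

theorem transSetoid_of_mul_inv_eq {s t s' t' : S} (h : transSetoid S t t')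
    (hst : (s : G) * (t : G)⁻¹ = (s' : G) * (t' : G)⁻¹) : transSetoid S s s' := fun g => by
  have h1 : (s : G) = (s : G) * (t : G)⁻¹ * t := by simp
  have h2 : (s' : G) = (s : G) * (t : G)⁻¹ * t' := by rw [hst]; simp
  have h3 := h (g * ((s : G) * (t : G)⁻¹))
  rwa [mul_assoc, ← h1, mul_assoc, ← h2] at h3

theorem mem_of_transSetoid {t t' : S} (h : transSetoid S t t') (r : S) :
    (r : G) * (t : G)⁻¹ * t' ∈ S :=
  (h ((r : G) * (t : G)⁻¹)).1 (by simp)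

/-- The right translation by `t⁻¹ t'`, for equivalent `t` and `t'`. -/
def transEquiv {t t' : S} (h : transSetoid S t t') : S ≃ S where
  toFun r := ⟨(r : G) * (t : G)⁻¹ * t', mem_of_transSetoid h r⟩
  invFun r := ⟨(r : G) * (t' : G)⁻¹ * t, mem_of_transSetoid (Setoid.symm' _ h) r⟩
  left_inv r := by ext; simp
  right_inv r := by ext; simp

theorem transEquiv_apply {t t' : S} (h : transSetoid S t t') (r : S) :
    (transEquiv h r : G) = (r : G) * (t : G)⁻¹ * t' := rfl

theorem transEquiv_mul_inv {t t' : S} (h : transSetoid S t t') (r : S) :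
    (transEquiv h r : G) * (t' : G)⁻¹ = (r : G) * (t : G)⁻¹ := by
  rw [transEquiv_apply]; simp

theorem transEquiv_equiv {t t' : S} (h : transSetoid S t t') (r : S) :
    transSetoid S r (transEquiv h r) :=
  transSetoid_of_mul_inv_eq h (transEquiv_mul_inv h r).symm

variable [DecidableEq G]

/-- The algebra of matrices which are invariant under the right translations preserving `S`. -/
def toepAlg (S : Finset G) : Subalgebra ℂ (Matrix S S ℂ) where
  carrier := {c | ∀ s t s' t' : S, transSetoid S t t' →
    (s : G) * (t : G)⁻¹ = (s' : G) * (t' : G)⁻¹ → c s t = c s' t'}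
  mul_mem' {c d} hc hd s t s' t' h hst := by
    rw [Matrix.mul_apply, Matrix.mul_apply,
      ← Equiv.sum_comp (transEquiv h) fun r => c s' r * d r t']
    refine Finset.sum_congr rfl fun r _ => congrArg₂ _ (hc _ _ _ _ (transEquiv_equiv h r) ?_)
      (hd _ _ _ _ h (transEquiv_mul_inv h r).symm)
    have h1 : (s : G) * (r : G)⁻¹ = (s : G) * (t : G)⁻¹ * ((r : G) * (t : G)⁻¹)⁻¹ := by group
    rw [h1, hst, ← transEquiv_mul_inv h r]
    group
  add_mem' {c d} hc hd s t s' t' h hst := by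
    rw [Matrix.add_apply, Matrix.add_apply, hc s t s' t' h hst, hd s t s' t' h hst]
  algebraMap_mem' r s t s' t' h hst := by
    have : s = t ↔ s' = t' := by
      rw [Subtype.ext_iff, Subtype.ext_iff, ← mul_inv_eq_one, hst, mul_inv_eq_one]
    simp [Matrix.algebraMap_matrix_apply, this]

theorem mem_toepAlg_of_isToeplitz {T : Matrix S S ℂ} (hT : IsToeplitz T) : T ∈ toepAlg S :=
  fun s t s' t' _ h => hT s t s' t' h

/-- The compression of the left translation by `g`. -/
def shift (S : Finset G) (g : G) : Matrix S S ℂ :=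
  .of fun s t => if (s : G) * (t : G)⁻¹ = g then 1 else 0

theorem isToeplitz_shift (g : G) : IsToeplitz (shift S g) := fun s t s' t' h => by
  simp only [shift, Matrix.of_apply, h]

theorem shift_inv_mul_shift (g : G) :
    shift S g⁻¹ * shift S g = Matrix.diagonal fun t : S => if g * t ∈ S then 1 else 0 := by
  ext s t
  rw [Matrix.mul_apply]
  have hr : ∀ r : S, shift S g r t = if (r : G) = g * t then 1 else 0 := fun r => by
    simp only [shift, Matrix.of_apply, mul_inv_eq_iff_eq_mul]
  simp only [hr, mul_ite, mul_one, mul_zero]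
  by_cases h : g * t ∈ S
  · rw [Finset.sum_eq_single ⟨g * t, h⟩]
    · rcases eq_or_ne s t with rfl | hst
      · simp [shift, h]
      · have : ¬ (s : G) * (g * t)⁻¹ = g⁻¹ := fun h => hst (Subtype.ext (by
          rw [mul_inv_eq_iff_eq_mul] at h
          simpa using h))
        rw [Matrix.diagonal_apply_ne _ hst, if_pos rfl]
        exact if_neg this
    · intro r _ hr
      rw [if_neg fun h' => hr (Subtype.ext h')]
    · simp
  · rw [Finset.sum_eq_zero fun (r : S) _ => if_neg fun h' : (r : G) = g * t => h (h' ▸ r.2)]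
    rcases eq_or_ne s t with rfl | hst
    · simp [h]
    · simp [hst]

/-- The indicator functions of the equivalence classes are generated by the shifts. -/
theorem diagonal_mem_of_shift_mem {𝒜 : Subalgebra ℂ (Matrix S S ℂ)} (h : ∀ g, shift S g ∈ 𝒜)
    (t : S) [DecidablePred fun t' : S => transSetoid S t t'] :
    Matrix.diagonal (fun t' : S => if transSetoid S t t' then (1 : ℂ) else 0) ∈ 𝒜 := by
  classical
  let B : Finset G := Finset.univ.image fun p : S × S => (p.1 : G) * (p.2 : G)⁻¹
  have hB : ∀ (g : G) (s : S), g * s ∈ S → g ∈ B := fun g s hg =>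
    Finset.mem_image.2 ⟨(⟨g * s, hg⟩, s), Finset.mem_univ _, by simp⟩
  let χ : G → S → ℂ := fun g t' => if g * t' ∈ S then 1 else 0
  let 𝒟 : Subalgebra ℂ (S → ℂ) := 𝒜.comap (Matrix.diagonalAlgHom ℂ)
  have hχ : ∀ g, χ g ∈ 𝒟 := fun g => by
    change Matrix.diagonal (χ g) ∈ 𝒜
    rw [← shift_inv_mul_shift]
    exact mul_mem (h _) (h _)
  -- Each factor keeps the t′ on which `g` acts as it does on t. Elements outside `B` never map S
  -- into S, so `B` separates the classes.
  have hprod : (∏ g ∈ B, if g * t ∈ S then χ g else 1 - χ g) ∈ 𝒟 := by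
    refine prod_mem fun g _ => ?_
    split_ifs
    · exact hχ g
    · exact sub_mem (one_mem _) (hχ g)
  have heq : (∏ g ∈ B, if g * t ∈ S then χ g else 1 - χ g) =
      fun t' : S => if transSetoid S t t' then (1 : ℂ) else 0 := by
    funext t'
    rw [Finset.prod_apply]
    split_ifs with h1
    · refine Finset.prod_eq_one fun g _ => ?_
      have : g * (t : G) ∈ S ↔ g * (t' : G) ∈ S := h1 g
      by_cases h2 : g * (t : G) ∈ S
      · simp [χ, h2, this.1 h2]
      · have h3 : g * (t' : G) ∉ S := mt this.2 h2
        simp [χ, h2, h3]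
    · have : ∃ g : G, ¬ (g * (t : G) ∈ S ↔ g * (t' : G) ∈ S) := by
        by_contra! hcon
        exact h1 hcon
      obtain ⟨g, hg⟩ := this
      have hgB : g ∈ B := by
        by_cases h2 : g * t ∈ S
        · exact hB g t h2
        · by_cases h3 : g * t' ∈ S
          · exact hB g t' h3
          · exact absurd (by simp [h2, h3]) hg
      refine Finset.prod_eq_zero hgB ?_
      by_cases h2 : g * t ∈ S <;> by_cases h3 : g * t' ∈ S <;> simp [χ, h2, h3] at hg ⊢
  rw [heq] at hprod
  exact hprod

/-- The shifts cut down to one class span: a matrix in the algebra is determined by its columns at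
class representatives. -/
theorem toepAlg_le_of_shift_mem {𝒜 : Subalgebra ℂ (Matrix S S ℂ)} (h : ∀ g, shift S g ∈ 𝒜) :
    toepAlg S ≤ 𝒜 := by
  classical
  intro c hc
  let r : Quotient (transSetoid S) → S := Quotient.out
  have hr : ∀ o t, transSetoid S (r o) t ↔ o = ⟦t⟧ := fun o t => by
    rw [← Quotient.eq (r := transSetoid S), Quotient.out_eq]
  have heq : c = ∑ o, ∑ s, c s (r o) • (shift S ((s : G) * (r o : G)⁻¹) *
      Matrix.diagonal (fun t' : S => if transSetoid S (r o) t' then (1 : ℂ) else 0)) := by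
    ext s' t'
    simp only [Matrix.sum_apply, Matrix.smul_apply, Matrix.mul_diagonal]
    rw [Finset.sum_eq_single ⟦t'⟧]
    · have h1 : transSetoid S t' (r ⟦t'⟧) := Setoid.symm' _ ((hr _ _).2 rfl)
      rw [Finset.sum_eq_single (transEquiv h1 s')]
      · simp only [shift, Matrix.of_apply, transEquiv_mul_inv, if_true,
          (hr _ _).2 rfl, smul_eq_mul, mul_one]
        exact hc _ _ _ _ h1 (transEquiv_mul_inv h1 s').symm
      · intro s _ hs
        have : (s' : G) * (t' : G)⁻¹ ≠ (s : G) * (r ⟦t'⟧ : G)⁻¹ := fun h2 =>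
          hs (Subtype.ext (by rw [transEquiv_apply, h2]; simp))
        simp [shift, this]
      · simp
    · intro o _ ho
      simp [hr, ho]
    · simp
  rw [heq]
  exact sum_mem fun o _ => sum_mem fun s _ => 𝒜.smul_mem (mul_mem (h _)
    (diagonal_mem_of_shift_mem h _)) _

end ToeplitzAlgebra

/-! ### Dimension count for the Toeplitz algebra. -/

section ToeplitzAlgebraDimension

variable {G : Type u} [Group G] {S : Finset G}

/-- The set of equivalence classes of elements of `S` with the same left translations. -/
abbrev TransClass (S : Finset G) := Quotient (transSetoid S)

instance : Finite (TransClass S) := Quotient.finite _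

instance : Fintype (TransClass S) := Fintype.ofFinite _

instance : DecidableEq (TransClass S) := Classical.decEq _

/-- The class of an element. -/
def TransClass.mk (t : S) : TransClass S := Quotient.mk (transSetoid S) t

/-- A representative of a class. -/
def TransClass.rep (o : TransClass S) : S := Quotient.out o

theorem TransClass.mk_rep (o : TransClass S) : (TransClass.mk o.rep) = o := Quotient.out_eq o

theorem transSetoid_rep (t : S) : transSetoid S t (TransClass.mk t).rep :=
  Quotient.exact (TransClass.mk_rep (TransClass.mk t)).symm

theorem transClass_eq {s t : S} (h : transSetoid S s t) : TransClass.mk s = TransClass.mk t :=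
  Quotient.sound h

theorem transEquiv_class {t t' : S} (h : transSetoid S t t') (r : S) :
    TransClass.mk (transEquiv h r) = TransClass.mk r := (transClass_eq (transEquiv_equiv h r)).symm

/-- The offset of an element from the representative of its class. -/
def transOffset (t : S) : G := ((TransClass.mk t).rep : G)⁻¹ * t

theorem transOffset_transEquiv {t t' : S} (h : transSetoid S t t') (r : S) :
    transOffset (transEquiv h r) = transOffset r * ((t : G)⁻¹ * t') := by
  simp only [transOffset, transEquiv_class, transEquiv_apply, mul_assoc]

/-- Classes are the cosets tN inside S of its right stabiliser N = {h : Sh = S}. The offset is the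
coordinate in N, so S is identified with classes × N. In these terms `toepAlg` is the m × m matrix
algebra over ℂ[N], with m classes. -/
theorem exists_transOffset_eq (o : TransClass S) (s : S) :
    ∃ t : S, ∀ r : S, (TransClass.mk r = o ∧ transOffset s = transOffset r) ↔ r = t := by
  have h := Setoid.symm' _ (transSetoid_rep s)
  have ho : transOffset o.rep = 1 := by
    simp [transOffset, TransClass.mk_rep]
  refine ⟨transEquiv h o.rep, fun r => ⟨fun ⟨h1, h2⟩ => Subtype.ext ?_, ?_⟩⟩
  · rw [transEquiv_apply, mul_assoc]
    change _ = _ * transOffset s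
    rw [h2, transOffset, h1]
    simp
  · rintro rfl
    refine ⟨(transEquiv_class h _).trans (TransClass.mk_rep o), ?_⟩
    rw [transOffset_transEquiv, ho, one_mul]
    rfl

variable [DecidableEq G]

/-- Matrices in the algebra are determined by their columns indexed by representatives. -/
def toepAlgEquiv (S : Finset G) : toepAlg S ≃ₗ[ℂ] (TransClass S × S → ℂ) where
  toFun c p := (c : Matrix S S ℂ) p.2 p.1.rep
  map_add' _ _ := rfl
  map_smul' _ _ := rfl
  invFun F := ⟨.of fun s t => F (TransClass.mk t, transEquiv (transSetoid_rep t) s),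
      fun s t s' t' h hst => by
    simp only [Matrix.of_apply]
    congr 1
    refine Prod.ext (transClass_eq h) (Subtype.ext ?_)
    simp only [transEquiv_apply, hst, transClass_eq h]⟩
  left_inv c := by
    ext s t
    exact (c.2 _ _ _ _ (transSetoid_rep t) (transEquiv_mul_inv (transSetoid_rep t) s).symm).symm
  right_inv F := by
    funext ⟨o, s⟩
    simp only [Matrix.of_apply]
    congr 1
    refine Prod.ext (TransClass.mk_rep o) (Subtype.ext ?_)
    simp [transEquiv_apply, TransClass.mk_rep]

theorem finrank_toepAlg (S : Finset G) :
    Module.finrank ℂ (toepAlg S) = Fintype.card (TransClass S) * S.card := by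
  rw [(toepAlgEquiv S).finrank_eq, Module.finrank_fintype_fun_eq_card, Fintype.card_prod,
    Fintype.card_coe]

/-- Matrices over the classes act on functions on `S`. -/
def inflate (S : Finset G) : Matrix (TransClass S) (TransClass S) ℂ →+* toepAlg S where
  toFun m := ⟨.of fun s t => if transOffset s = transOffset t then m (TransClass.mk s)
      (TransClass.mk t) else 0,
    fun s t s' t' h hst => by
      have h1 : s' = transEquiv h s := Subtype.ext (by rw [transEquiv_apply, hst]; simp)
      have h2 : t' = transEquiv h t := Subtype.ext (by simp [transEquiv_apply])
      simp only [Matrix.of_apply]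
      rw [h1]
      simp only [show transOffset t' = _ from (congrArg _ h2).trans (transOffset_transEquiv h t),
        show TransClass.mk t' = _ from (congrArg _ h2).trans (transEquiv_class h t),
        transOffset_transEquiv, mul_left_inj, transEquiv_class]⟩
  map_one' := by
    ext s t
    change (if transOffset s = transOffset t then
      (1 : Matrix (TransClass S) (TransClass S) ℂ) (TransClass.mk s) (TransClass.mk t) else 0) =
          (1 : Matrix S S ℂ) s t
    rcases eq_or_ne s t with rfl | hst
    · simp
    · rw [Matrix.one_apply_ne hst]
      split_ifs with h
      · refine Matrix.one_apply_ne fun h' => hst (Subtype.ext ?_)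
        rw [transOffset, transOffset, h'] at h
        exact mul_left_cancel h
      · rfl
  map_zero' := by
    ext s t
    change (if transOffset s = transOffset t then (0 : ℂ) else 0) = 0
    simp
  map_add' m m' := by
    ext s t
    change (if transOffset s = transOffset t then (m + m') (TransClass.mk s)
        (TransClass.mk t) else 0) =
      (if transOffset s = transOffset t then m (TransClass.mk s) (TransClass.mk t) else 0) +
        if transOffset s = transOffset t then m' (TransClass.mk s) (TransClass.mk t) else 0
    split_ifs <;> simp
  map_mul' m m' := by
    ext s t
    change (if transOffset s = transOffset t then (m * m') (TransClass.mk s)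
        (TransClass.mk t) else 0) =
      ∑ r : S, (if transOffset s = transOffset r then m (TransClass.mk s)
          (TransClass.mk r) else 0) *
        if transOffset r = transOffset t then m' (TransClass.mk r) (TransClass.mk t) else 0
    rw [← Finset.sum_fiberwise Finset.univ fun r : S => (TransClass.mk r)]
    split_ifs with hst
    · rw [Matrix.mul_apply]
      refine Finset.sum_congr rfl fun o _ => ?_
      obtain ⟨r₀, hr₀⟩ := exists_transOffset_eq o s
      have h0 := (hr₀ r₀).2 rfl
      rw [Finset.sum_eq_single r₀]
      · rw [if_pos h0.2, if_pos (h0.2.symm.trans hst), h0.1]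
      · intro r hr hne
        rw [if_neg fun h => hne ((hr₀ r).1 ⟨(Finset.mem_filter.1 hr).2, h⟩), zero_mul]
      · intro h
        simp [h0.1] at h
    · refine (Finset.sum_eq_zero fun o _ => Finset.sum_eq_zero fun r _ => ?_).symm
      by_cases h1 : transOffset s = transOffset r
      · rw [if_neg fun h => hst (h1.trans h), mul_zero]
      · rw [if_neg h1, zero_mul]

/-- Row sums over a class depend only on the class of the row, which makes `deflate` multiplicative;
it corresponds to the trivial character of the stabiliser. -/
theorem sum_fiber_eq {c : Matrix S S ℂ} (hc : c ∈ toepAlg S) {s s' : S} (h : transSetoid S s s')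
    (o : TransClass S) : ∑ t with TransClass.mk t = o, c s t = ∑ t with TransClass.mk t = o,
        c s' t := by
  refine Finset.sum_equiv (transEquiv h) (fun t => ?_) fun t _ => ?_
  · simp only [Finset.mem_filter, Finset.mem_univ, true_and, transEquiv_class]
  · refine hc _ _ _ _ (transEquiv_equiv h t) ?_
    rw [transEquiv_apply]
    group

/-- The action on the functions which are constant on the classes. -/
def deflate (S : Finset G) : toepAlg S →+* Matrix (TransClass S) (TransClass S) ℂ where
  toFun c := .of fun o o' => ∑ t with TransClass.mk t = o', (c : Matrix S S ℂ) o.rep t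
  map_one' := by
    ext o o'
    change ∑ t with TransClass.mk t = o', (1 : Matrix S S ℂ) o.rep t = _
    simp only [Matrix.one_apply, Finset.sum_ite_eq, Finset.mem_filter, Finset.mem_univ, true_and,
      TransClass.mk_rep]
  map_zero' := by
    ext o o'
    exact Finset.sum_const_zero
  map_add' c d := by
    ext o o'
    exact Finset.sum_add_distrib
  map_mul' c d := by
    ext o o'
    change ∑ t with TransClass.mk t = o', ((c : Matrix S S ℂ) * (d : Matrix S S ℂ)) o.rep t = ∑ o'',
        _
    simp only [Matrix.mul_apply, Matrix.of_apply]
    rw [Finset.sum_comm, ← Finset.sum_fiberwise Finset.univ fun r : S => (TransClass.mk r)]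
    refine Finset.sum_congr rfl fun o'' _ => ?_
    rw [Finset.sum_mul]
    refine Finset.sum_congr rfl fun r hr => ?_
    rw [← Finset.mul_sum, sum_fiber_eq d.2 (transSetoid_rep r) o', (Finset.mem_filter.1 hr).2]

theorem inflate_smul (a : ℂ) (m : Matrix (TransClass S) (TransClass S) ℂ) :
    inflate S (a • m) = a • inflate S m := by
  ext s t
  change (if transOffset s = transOffset t then (a • m) _ _ else 0) =
    a • (if transOffset s = transOffset t then m _ _ else 0)
  split_ifs <;> simp

theorem deflate_smul (a : ℂ) (c : toepAlg S) : deflate S (a • c) = a • deflate S c := by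
  ext o o'
  change ∑ t with TransClass.mk t = o', a • (c : Matrix S S ℂ) o.rep t =
    a • ∑ t with TransClass.mk t = o', (c : Matrix S S ℂ) o.rep t
  rw [Finset.smul_sum]

/-- If the algebra of `S` maps onto that of a larger set `R`, then `R = S`. -/
theorem eq_of_surjective_algHom {R : Finset G} (hS : S.Nonempty) (hSR : S ⊆ R)
    (Θ : toepAlg S →ₐ[ℂ] toepAlg R) (hΘ : Function.Surjective Θ) : S = R := by
  have hne : Nonempty (TransClass R) := ⟨TransClass.mk ⟨_, hSR hS.choose_spec⟩⟩
  have h1 : Fintype.card (TransClass S) ≤ Fintype.card (TransClass R) := by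
    rcases isEmpty_or_nonempty (TransClass S) with h | h
    · simp
    -- A ring homomorphism between full matrix algebras; the source is simple, so it is injective
    -- and S has at most as many classes as R.
    let f : Matrix (TransClass S) (TransClass S) ℂ →+* Matrix (TransClass R) (TransClass R) ℂ :=
      (deflate R).comp (Θ.toRingHom.comp (inflate S))
    have hf : Function.Injective f := RingHom.injective f
    let F : Matrix (TransClass S) (TransClass S) ℂ →ₗ[ℂ] Matrix (TransClass R) (TransClass R) ℂ :=
      { f with
        map_smul' := fun a m => by
          change deflate R (Θ (inflate S (a • m))) = a • deflate R (Θ (inflate S m))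
          rw [inflate_smul, map_smul, deflate_smul] }
    have := LinearMap.finrank_le_finrank_of_injective (f := F) hf
    rw [Module.finrank_matrix, Module.finrank_matrix, Module.finrank_self, mul_one, mul_one] at this
    exact Nat.mul_self_le_mul_self_iff.1 this
  have h2 : Module.finrank ℂ (toepAlg R) ≤ Module.finrank ℂ (toepAlg S) :=
    LinearMap.finrank_le_finrank_of_surjective (f := Θ.toLinearMap) hΘ
  rw [finrank_toepAlg, finrank_toepAlg] at h2
  -- With m_S, m_R the numbers of classes, m_R |R| ≤ m_S |S| ≤ m_R |S|, so |R| ≤ |S|.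
  exact Finset.eq_of_subset_of_card_le hSR
    (Nat.le_of_mul_le_mul_left (h2.trans (Nat.mul_le_mul_right _ h1)) Fintype.card_pos)

end ToeplitzAlgebraDimension

/-! ### Homomorphisms from intertwining relations. -/

section ToeplitzAlgebraHom

open scoped Matrix

/-- Left multiplication by a is injective on the subalgebra, hence surjective by finite dimension.
-/
theorem Subalgebra.inv_mem_of_finiteDimensional {A : Type*} [Ring A] [Algebra ℂ A]
    [FiniteDimensional ℂ A] (𝒜 : Subalgebra ℂ A) {a b : A} (ha : a ∈ 𝒜) (hba : b * a = 1) :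
    b ∈ 𝒜 := by
  have hinj : Function.Injective (LinearMap.mulLeft ℂ (⟨a, ha⟩ : 𝒜)) := fun x y h => by
    refine Subtype.ext ?_
    have h1 : a * (x : A) = a * y := congrArg Subtype.val h
    rw [← one_mul (x : A), ← one_mul (y : A), ← hba, mul_assoc, h1, mul_assoc]
  obtain ⟨x, hx⟩ := LinearMap.injective_iff_surjective.1 hinj 1
  have hx' : a * (x : A) = 1 := congrArg Subtype.val hx
  have : b = x := by rw [← mul_one b, ← hx', ← mul_assoc, hba, one_mul]
  exact this ▸ x.2

variable {G : Type u} [Group G] [DecidableEq G] {S R : Finset G} {κ : Type*}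

/-- The matrices which are intertwined by all `U k` with a matrix in the algebra of `R`. -/
def intertwined (U : κ → Matrix S R ℂ) : Subalgebra ℂ (Matrix S S ℂ) where
  carrier := {c | ∃ d ∈ toepAlg R, ∀ k, c * U k = U k * d}
  mul_mem' := by
    rintro c c' ⟨d, hd, h⟩ ⟨d', hd', h'⟩
    exact ⟨d * d', mul_mem hd hd', fun k => by
      rw [Matrix.mul_assoc, h', ← Matrix.mul_assoc, h, Matrix.mul_assoc]⟩
  add_mem' := by
    rintro c c' ⟨d, hd, h⟩ ⟨d', hd', h'⟩
    exact ⟨d + d', add_mem hd hd', fun k => by rw [Matrix.add_mul, h, h', Matrix.mul_add]⟩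
  algebraMap_mem' a := ⟨algebraMap ℂ _ a, Subalgebra.algebraMap_mem _ a, fun k => by
    rw [Algebra.algebraMap_eq_smul_one, Algebra.algebraMap_eq_smul_one, Matrix.smul_mul,
      Matrix.mul_smul, Matrix.one_mul, Matrix.mul_one]⟩

/-- The intertwined matrices form an algebra containing every LΨ(g), hence LT for all Toeplitz T. In
particular it contains L, then its inverse Ψ(1), then every T = Ψ(1)(LT), and so all of `toepAlg S`.
-/
theorem exists_algHom_toepAlg [Fintype κ] {Ψ : G → Matrix S S ℂ} (hΨ : ∀ g, IsToeplitz (Ψ g))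
    (hspan : ∀ T : Matrix S S ℂ, IsToeplitz T → T ∈ Submodule.span ℂ (Set.range Ψ))
    {L : Matrix S S ℂ} (hL : L * Ψ 1 = 1) {U : κ → Matrix S R ℂ}
    (hU : ∑ k, (U k)ᴴ * Ψ 1 * U k = 1) (hcomm : ∀ g k, Ψ g * U k = Ψ 1 * U k * shift R g) :
    ∃ Θ : toepAlg S →ₐ[ℂ] toepAlg R, Function.Surjective Θ ∧
      ∀ (g : G) (h : L * Ψ g ∈ toepAlg S), (Θ ⟨L * Ψ g, h⟩ : Matrix R R ℂ) = shift R g := by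
  have hshift : ∀ g k, L * Ψ g * U k = U k * shift R g := fun g k => by
    rw [Matrix.mul_assoc, hcomm, ← Matrix.mul_assoc, ← Matrix.mul_assoc, hL, Matrix.one_mul]
  have hmem : ∀ T : Matrix S S ℂ, IsToeplitz T → L * T ∈ intertwined U := fun T hT => by
    refine Submodule.span_induction (p := fun T _ => L * T ∈ intertwined U) ?_ ?_ ?_ ?_
      (hspan T hT)
    · rintro _ ⟨g, rfl⟩
      exact ⟨_, mem_toepAlg_of_isToeplitz (isToeplitz_shift g), hshift g⟩
    · rw [Matrix.mul_zero]
      exact zero_mem _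
    · intro x y _ _ hx hy
      rw [Matrix.mul_add]
      exact add_mem hx hy
    · intro a x _ hx
      rw [Matrix.mul_smul]
      exact Subalgebra.smul_mem _ hx a
  have hLmem : L ∈ intertwined U := by
    have := hmem 1 fun s t s' t' h => by
      have : s = t ↔ s' = t' := by
        rw [Subtype.ext_iff, Subtype.ext_iff, ← mul_inv_eq_one, h, mul_inv_eq_one]
      simp [Matrix.one_apply, this]
    rwa [Matrix.mul_one] at this
  have hPmem : Ψ 1 ∈ intertwined U :=
    Subalgebra.inv_mem_of_finiteDimensional _ hLmem (mul_eq_one_comm.1 hL)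
  have hle : toepAlg S ≤ intertwined U := toepAlg_le_of_shift_mem fun g => by
    have := mul_mem hPmem (hmem _ (isToeplitz_shift g))
    rwa [← mul_assoc, mul_eq_one_comm.1 hL, one_mul] at this
  have hLS : L ∈ toepAlg S :=
    Subalgebra.inv_mem_of_finiteDimensional _ (mem_toepAlg_of_isToeplitz (hΨ 1)) hL
  -- The normalisation `hU` recovers the intertwined matrix d from c, so d is unique and c ↦ d is
  -- multiplicative.
  let θ : Matrix S S ℂ → Matrix R R ℂ := fun c => ∑ k, (U k)ᴴ * Ψ 1 * (c * U k)
  have hθ : ∀ c d, (∀ k, c * U k = U k * d) → θ c = d := fun c d h => by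
    simp only [θ, h]
    simp only [← Matrix.mul_assoc]
    rw [← Matrix.sum_mul, hU, Matrix.one_mul]
  have hθ' : ∀ c ∈ toepAlg S, θ c ∈ toepAlg R ∧ ∀ k, c * U k = U k * θ c := fun c hc => by
    obtain ⟨d, hd, h⟩ := hle hc
    rw [hθ c d h]
    exact ⟨hd, h⟩
  let Θ : toepAlg S →ₐ[ℂ] toepAlg R :=
    { toFun := fun c => ⟨θ c, (hθ' c c.2).1⟩
      map_one' := Subtype.ext (hθ _ _ fun k => by
        exact (Matrix.one_mul _).trans (Matrix.mul_one _).symm)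
      map_mul' := fun c c' => Subtype.ext (hθ _ _ fun k => by
        rw [MulMemClass.coe_mul, Matrix.mul_assoc, (hθ' _ c'.2).2, ← Matrix.mul_assoc,
          (hθ' _ c.2).2, Matrix.mul_assoc]; rfl)
      map_zero' := Subtype.ext (hθ _ _ fun k => by
        exact (Matrix.zero_mul _).trans (Matrix.mul_zero _).symm)
      map_add' := fun c c' => Subtype.ext (hθ _ _ fun k => by
        rw [AddMemClass.coe_add, Matrix.add_mul, (hθ' _ c'.2).2, (hθ' _ c.2).2, ← Matrix.mul_add]
        rfl)
      commutes' := fun a => Subtype.ext (hθ _ _ fun k => by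
        rw [Subalgebra.coe_algebraMap, Subalgebra.coe_algebraMap, Algebra.algebraMap_eq_smul_one,
          Algebra.algebraMap_eq_smul_one, Matrix.smul_mul, Matrix.mul_smul, Matrix.one_mul,
          Matrix.mul_one]) }
  have hΘ : ∀ (g : G) (h : L * Ψ g ∈ toepAlg S), (Θ ⟨L * Ψ g, h⟩ : Matrix R R ℂ) = shift R g :=
    fun g h => hθ _ _ (hshift g)
  refine ⟨Θ, fun d => ?_, hΘ⟩
  have : toepAlg R ≤ Θ.range.map (toepAlg R).val := toepAlg_le_of_shift_mem fun g => by
    have h := mul_mem hLS (mem_toepAlg_of_isToeplitz (hΨ g))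
    exact ⟨_, ⟨⟨_, h⟩, rfl⟩, hΘ g h⟩
  obtain ⟨_, ⟨c, rfl⟩, hc⟩ := this d.2
  exact ⟨c, Subtype.ext hc⟩

/-- If `R = S`, the homomorphism can be inverted. -/
theorem exists_algHom_shift [Fintype κ] {Ψ : G → Matrix S S ℂ} (hΨ : ∀ g, IsToeplitz (Ψ g))
    (hspan : ∀ T : Matrix S S ℂ, IsToeplitz T → T ∈ Submodule.span ℂ (Set.range Ψ))
    {L : Matrix S S ℂ} (hL : L * Ψ 1 = 1) (hS : S.Nonempty) (hSR : S ⊆ R) {U : κ → Matrix S R ℂ}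
    (hU : ∑ k, (U k)ᴴ * Ψ 1 * U k = 1) (hcomm : ∀ g k, Ψ g * U k = Ψ 1 * U k * shift R g) :
    ∃ η : toepAlg S →ₐ[ℂ] toepAlg S, ∀ (g : G) (h : shift S g ∈ toepAlg S),
      (η ⟨shift S g, h⟩ : Matrix S S ℂ) = L * Ψ g := by
  obtain ⟨Θ, hΘ, hΘ'⟩ := exists_algHom_toepAlg hΨ hspan hL hU hcomm
  obtain rfl := eq_of_surjective_algHom hS hSR Θ hΘ
  have hinj : Function.Injective Θ :=
    (LinearMap.injective_iff_surjective (f := Θ.toLinearMap)).2 hΘ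
  have hLS : L ∈ toepAlg S :=
    Subalgebra.inv_mem_of_finiteDimensional _ (mem_toepAlg_of_isToeplitz (hΨ 1)) hL
  refine ⟨(AlgEquiv.ofBijective Θ ⟨hinj, hΘ⟩).symm, fun g h => ?_⟩
  have hg := mul_mem hLS (mem_toepAlg_of_isToeplitz (hΨ g))
  have : (AlgEquiv.ofBijective Θ ⟨hinj, hΘ⟩).symm ⟨shift S g, h⟩ = ⟨L * Ψ g, hg⟩ := by
    rw [AlgEquiv.symm_apply_eq]
    exact Subtype.ext (hΘ' g hg).symm
  rw [show ((AlgEquiv.ofBijective Θ ⟨hinj, hΘ⟩).symm : toepAlg S →ₐ[ℂ] toepAlg S)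
    ⟨shift S g, h⟩ = ⟨L * Ψ g, hg⟩ from this]

end ToeplitzAlgebraHom

/-! ### Kernels and Kraus operators from an abstract isomorphism. -/

section DualIsomorphism

open scoped Matrix

variable {G : Type u} [Group G] {S R : Finset G}

theorem mul_inv_mem_diffs (s t : S) : (s : G) * (t : G)⁻¹ ∈ diffs S := ⟨s, t, rfl⟩

open Classical in
/-- The generator `δ_g` of the Fourier system, for `g = st⁻¹`, and zero for all other `g`. -/
def fourierGen (S : Finset G) (g : G) : fourierSystem S :=
  if h : g ∈ diffs S then fourierDelta h.choose h.choose_spec.choose else 0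

theorem coe_fourierGen {g : G} (h : g ∈ diffs S) :
    (fourierGen S g : GroupCStar G) = GroupCStar.delta g := by
  rw [fourierGen, dif_pos h]
  exact congrArg GroupCStar.delta h.choose_spec.choose_spec.symm

theorem fourierGen_mul_inv (s t : S) : fourierGen S ((s : G) * (t : G)⁻¹) = fourierDelta s t :=
  Subtype.ext (coe_fourierGen (mul_inv_mem_diffs s t))

/-- The coefficient functionals on the Fourier system. -/
def coefDual (S : Finset G) (h : G) : Module.Dual ℂ (fourierSystem S) :=
  (GroupCStar.coef h).toLinearMap ∘ₗ (fourierSystem S).subtype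

theorem dual_ext {F F' : Module.Dual ℂ (fourierSystem S)}
    (h : ∀ g ∈ diffs S, F (fourierGen S g) = F' (fourierGen S g)) : F = F' :=
  LinearMap.ext fun x => by
    obtain ⟨a, rfl⟩ := exists_eq_sum_fourierDelta x
    simp only [map_sum, map_smul]
    refine Finset.sum_congr rfl fun s _ => Finset.sum_congr rfl fun t _ => ?_
    rw [← fourierGen_mul_inv, h _ (mul_inv_mem_diffs s t)]

/-- The Toeplitz matrix of a function. -/
def toeplitzOf (S : Finset G) (k : G → ℂ) : toeplitzSystem S :=
  ⟨.of fun s t => k ((s : G) * (t : G)⁻¹), fun s t s' t' h => by simp only [Matrix.of_apply, h]⟩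

theorem toeplitzOf_apply (k : G → ℂ) (s t : S) :
    (toeplitzOf S k : Matrix S S ℂ) s t = k ((s : G) * (t : G)⁻¹) := rfl

theorem exists_toeplitzOf_eq (T : toeplitzSystem S) : ∃ k, T = toeplitzOf S k := by
  obtain ⟨k, hk, -⟩ := exists_toeplitz_function T.2
  exact ⟨k, Subtype.ext (Matrix.ext hk)⟩

theorem fourierGen_mem_fourierCones {n : ℕ} (a : Fin n → G)
    (ha : ∀ i j, a i * (a j)⁻¹ ∈ diffs S) :
    (Matrix.of fun i j => fourierGen S (a i * (a j)⁻¹)) ∈ fourierCones S n := by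
  have h := CStarMatrix.mul_star_nonneg fun i : Fin n => GroupCStar.delta (a i)
  refine h.trans_eq (CStarMatrix.ext fun i j => ?_)
  refine Eq.trans ?_ (coe_fourierGen (ha i j)).symm
  exact ((GroupCStar.delta_mul _ _).trans (congrArg _ (GroupCStar.star_delta _).symm)).symm

/-- The matrix (δ_{ab⁻¹}) over R is positive, and since RR⁻¹ ⊆ SS⁻¹ its entries lie in the Fourier
system of S. -/
theorem posSemidef_of_map_toeplitzCones {f : toeplitzSystem S ≃ₗ[ℂ] Module.Dual ℂ (fourierSystem S)}
    (hf : ∀ n, ∀ X ∈ toeplitzCones S n, X.map f ∈ dualCones (fourierCones S) n)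
    (hR : ∀ a b : R, (a : G) * (b : G)⁻¹ ∈ diffs S) {ι : Type*} [Fintype ι]
    {X : Matrix ι ι (toeplitzSystem S)}
    (hX : (Matrix.of fun p q : ι × S => (X p.1 q.1 : Matrix S S ℂ) p.2 q.2).PosSemidef) :
    (Matrix.of fun p q : ι × R =>
      f (X p.1 q.1) (fourierGen S ((p.2 : G) * (q.2 : G)⁻¹))).PosSemidef := by
  let e := Fintype.equivFin ι
  let e' := Fintype.equivFin R
  have h1 : X.submatrix e.symm e.symm ∈ toeplitzCones S (Fintype.card ι) :=
    hX.submatrix fun p : Fin (Fintype.card ι) × S => (e.symm p.1, p.2)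
  have h2 := hf _ _ h1 _ _ (fourierGen_mem_fourierCones (fun i => (e'.symm i : G))
    fun i j => hR (e'.symm i) (e'.symm j))
  convert h2.submatrix (fun p : ι × R => (e' p.2, e p.1)) using 1
  ext p q
  simp

/-- The coefficient functionals form a positive kernel with values in the dual; the inverse
isomorphism preserves this. -/
theorem posSemidef_symm_coefDual {f : toeplitzSystem S ≃ₗ[ℂ] Module.Dual ℂ (fourierSystem S)}
    (hf : ∀ n, ∀ F ∈ dualCones (fourierCones S) n, F.map f.symm ∈ toeplitzCones S n) :
    (Matrix.of fun p q : G × S =>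
      (f.symm (coefDual S (p.1 * q.1⁻¹)) : Matrix S S ℂ) p.2 q.2).PosSemidef :=
  posSemidef_of_finset fun E => by
    let e := Fintype.equivFin E
    have h1 : (Matrix.of fun i j => coefDual S ((e.symm i).1.1 * ((e.symm j).1.1)⁻¹)) ∈
        dualCones (fourierCones S) (Fintype.card E) := fun k x hx =>
      (GroupCStar.posSemidef_coef hx).submatrix
        fun p : Fin k × Fin (Fintype.card E) => ((e.symm p.2).1.1, p.1)
    have h2 := (hf _ _ h1).submatrix fun p : E => (e p, p.1.2)
    convert h2 using 1
    ext p q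
    simp

variable [DecidableEq G]

/-- The finite set of the elements `st⁻¹`. -/
def diffsFinset (S : Finset G) : Finset G :=
  Finset.univ.image fun p : S × S => (p.1 : G) * (p.2 : G)⁻¹

theorem mem_diffsFinset {g : G} : g ∈ diffsFinset S ↔ g ∈ diffs S := by
  simp only [diffsFinset, Finset.mem_image, Finset.mem_univ, true_and, Prod.exists, diffs]
  exact exists_congr fun s => exists_congr fun t => eq_comm

theorem coefDual_fourierGen (h : G) {g : G} (hg : g ∈ diffs S) :
    coefDual S h (fourierGen S g) = if g = h then 1 else 0 := by
  change GroupCStar.coef h (fourierGen S g : GroupCStar G) = _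
  rw [coe_fourierGen hg, GroupCStar.coef_delta]
  congr

theorem coefDual_eq_zero {h : G} (hh : h ∉ diffs S) : coefDual S h = 0 :=
  dual_ext fun g hg => by
    rw [coefDual_fourierGen h hg, if_neg fun e : g = h => hh (e ▸ hg)]
    rfl

theorem eq_sum_coefDual (F : Module.Dual ℂ (fourierSystem S)) :
    F = ∑ h ∈ diffsFinset S, F (fourierGen S h) • coefDual S h :=
  dual_ext fun g hg => by
    simp [LinearMap.sum_apply, coefDual_fourierGen _ hg, mem_diffsFinset.2 hg]

/-- The matrix `shift S g` as an element of the Toeplitz system. -/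
def shiftSystem (S : Finset G) (g : G) : toeplitzSystem S := ⟨shift S g, isToeplitz_shift g⟩

theorem toeplitzOf_eq_sum (k : G → ℂ) :
    toeplitzOf S k = ∑ g ∈ diffsFinset S, k g • shiftSystem S g := by
  refine Subtype.ext (Matrix.ext fun s t => ?_)
  have : ((∑ g ∈ diffsFinset S, k g • shiftSystem S g : toeplitzSystem S) : Matrix S S ℂ) =
      ∑ g ∈ diffsFinset S, k g • shift S g := by
    rw [AddSubmonoidClass.coe_finsetSum]
    rfl
  rw [this, toeplitzOf_apply, Matrix.sum_apply]
  simp [shift, mem_diffsFinset.2 (mul_inv_mem_diffs s t)]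

/-- A Choi–Kraus decomposition for a map defined only on the Toeplitz system. Complete positivity
makes the Choi coefficients `z` nonnegative on positive Toeplitz kernels. The bipolar theorem lifts
them to a positive matrix, whose factor supplies the U_k. -/
theorem exists_factorization {f : toeplitzSystem S ≃ₗ[ℂ] Module.Dual ℂ (fourierSystem S)}
    (hf : ∀ n, ∀ X ∈ toeplitzCones S n, X.map f ∈ dualCones (fourierCones S) n)
    (hR : ∀ a b : R, (a : G) * (b : G)⁻¹ ∈ diffs S) :
    ∃ U : S × R → Matrix S R ℂ, ∀ (T : toeplitzSystem S) (a b : R),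
      f T (fourierGen S ((a : G) * (b : G)⁻¹)) =
        ∑ k, ∑ s, ∑ t, star (U k s a) * (T : Matrix S S ℂ) s t * U k t b := by
  let z : G × R × R →₀ ℂ := ∑ g ∈ diffsFinset S, ∑ a, ∑ b,
    Finsupp.single (g, a, b) (f (shiftSystem S g) (fourierGen S ((a : G) * (b : G)⁻¹)))
  obtain ⟨A, hA⟩ := exists_symb_eq (S := S) z fun p hp => by
    by_contra hp'
    refine Finsupp.mem_support_iff.1 hp ?_
    simp only [z, Finsupp.finsetSum_apply]
    refine Finset.sum_eq_zero fun g hg => Finset.sum_eq_zero fun a _ =>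
        Finset.sum_eq_zero fun b _ =>
      Finsupp.single_eq_of_ne ?_
    rintro rfl
    exact hp' (mem_diffsFinset.1 hg)
  have hpair : ∀ K : G → R → R → ℂ, symbPair A K =
      ∑ a, ∑ b, f (toeplitzOf S fun g => K g a b) (fourierGen S ((a : G) * (b : G)⁻¹)) := fun K => by
    rw [symbPair_eq, hA]
    simp only [z, map_sum, Finsupp.linearCombination_single, toeplitzOf_eq_sum, map_smul,
      LinearMap.sum_apply, LinearMap.smul_apply, smul_eq_mul]
    rw [Finset.sum_comm]
    refine Finset.sum_congr rfl fun a _ => ?_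
    rw [Finset.sum_comm]
    exact Finset.sum_congr rfl fun b _ => Finset.sum_congr rfl fun g _ => mul_comm _ _
  obtain ⟨Q, hQ, hQA⟩ := exists_posSemidef_symb (A := A) fun K hK => by
    have h1 : (Matrix.of fun p q : R × S =>
        (toeplitzOf S (fun g => K g p.1 q.1) : Matrix S S ℂ) p.2 q.2).PosSemidef :=
      hK.submatrix Prod.swap
    have h2 := (posSemidef_of_map_toeplitzCones hf hR
      (X := .of fun a b => toeplitzOf S fun g => K g a b) h1).submatrix fun a : R => (a, a)
    rw [hpair]
    exact h2.sum_nonneg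
  obtain ⟨B, hB⟩ := hQ.exists_eq_sum
  refine ⟨fun k => .of fun s a => star (B (s, a) k), fun T a b => ?_⟩
  obtain ⟨k, rfl⟩ := exists_toeplitzOf_eq T
  -- A kernel concentrated in the single matrix entry (a, b) isolates that entry of f T.
  have h1 := hpair fun g a' b' => if b' = b then if a' = a then k g else 0 else 0
  rw [← symbPair_eq_of_symb_eq hQA] at h1
  have h2 : ∀ a' b', f (toeplitzOf S fun g => if b' = b then if a' = a then k g else 0 else 0)
      (fourierGen S ((a' : G) * (b' : G)⁻¹)) = if b' = b then if a' = a then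
        f (toeplitzOf S k) (fourierGen S ((a : G) * (b : G)⁻¹)) else 0 else 0 := fun a' b' => by
    have h0 : toeplitzOf S (fun _ => (0 : ℂ)) = 0 := rfl
    split_ifs with hb ha
    · rw [ha, hb]
    · rw [h0, map_zero, LinearMap.zero_apply]
    · rw [h0, map_zero, LinearMap.zero_apply]
  simp only [h2, Finset.sum_ite_eq', Finset.mem_univ, if_true] at h1
  rw [← h1]
  simp only [symbPair, blocks, Matrix.of_apply, smul_eq_mul, mul_ite, mul_zero, Finset.sum_ite_eq',
    Finset.mem_univ, if_true, star_star, toeplitzOf_apply, hB]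
  conv_rhs => rw [Finset.sum_comm]
  refine Finset.sum_congr rfl fun s _ => ?_
  conv_rhs => rw [Finset.sum_comm]
  refine Finset.sum_congr rfl fun t _ => ?_
  rw [Finset.sum_mul]
  exact Finset.sum_congr rfl fun _ _ => by ring

end DualIsomorphism

/-! ### Rigidity of the Kraus operators. -/

section Intertwining

open scoped Matrix

variable {G : Type u} [Group G] [DecidableEq G] {S R : Finset G}

/-- A finite set is contained in a maximal one with the same differences. -/
theorem exists_maximal_same_diffs (hS : S.Nonempty) : ∃ R : Finset G, S ⊆ R ∧
    (∀ a ∈ R, ∀ b ∈ R, a * b⁻¹ ∈ diffs S) ∧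
    ∀ g, (∀ b ∈ R, g * b⁻¹ ∈ diffs S) → g ∈ R := by
  obtain ⟨s₀, hs₀⟩ := hS
  -- All candidates lie in the finite set (SS⁻¹)s₀, since they contain s₀.
  let 𝒰 : Finset (Finset G) := ((diffsFinset S).image (· * s₀)).powerset.filter
    fun R => S ⊆ R ∧ ∀ a ∈ R, ∀ b ∈ R, a * b⁻¹ ∈ diffsFinset S
  have hS : S ∈ 𝒰 := by
    simp only [𝒰, Finset.mem_filter, Finset.mem_powerset, mem_diffsFinset]
    exact ⟨fun s hs => Finset.mem_image.2 ⟨s * s₀⁻¹,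
      mem_diffsFinset.2 (mul_inv_mem_diffs ⟨s, hs⟩ ⟨s₀, hs₀⟩), by simp⟩, subset_rfl,
      fun a ha b hb => mul_inv_mem_diffs ⟨a, ha⟩ ⟨b, hb⟩⟩
  obtain ⟨R, hR, hmax⟩ := 𝒰.exists_max_image Finset.card ⟨S, hS⟩
  obtain ⟨-, hSR, hRR⟩ := Finset.mem_filter.1 hR
  refine ⟨R, hSR, fun a ha b hb => mem_diffsFinset.1 (hRR a ha b hb), fun g hg => ?_⟩
  by_contra hgR
  have h1 : insert g R ∈ 𝒰 := by
    simp only [𝒰, Finset.mem_filter, Finset.mem_powerset, mem_diffsFinset]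
    have h2 : ∀ a ∈ insert g R, ∀ b ∈ insert g R, a * b⁻¹ ∈ diffs S := by
      intro a ha b hb
      rw [Finset.mem_insert] at ha hb
      rcases ha with rfl | ha <;> rcases hb with rfl | hb
      · exact ⟨⟨s₀, hs₀⟩, ⟨s₀, hs₀⟩, by simp⟩
      · exact hg b hb
      · simpa using inv_mem_diffs (hg a ha)
      · exact mem_diffsFinset.1 (hRR a ha b hb)
    refine ⟨fun a ha => Finset.mem_image.2 ⟨a * s₀⁻¹, mem_diffsFinset.2
      (h2 a ha s₀ (Finset.mem_insert_of_mem (hSR hs₀))), by simp⟩,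
      hSR.trans (Finset.subset_insert _ _), h2⟩
  have := hmax _ h1
  rw [Finset.card_insert_of_notMem hgR] at this
  omega

/-- Positive semi-definiteness of the kernel and the normalisation of the compressions force
`Ψ g U = Ψ 1 U shift g`. -/
theorem mul_eq_mul_shift {κ : Type*} [Fintype κ] {Ψ : G → Matrix S S ℂ}
    (hΨ : (Matrix.of fun p q : G × S => Ψ (p.1 * q.1⁻¹) p.2 q.2).PosSemidef)
    (hΨ0 : ∀ g ∉ diffs S, Ψ g = 0) {U : κ → Matrix S R ℂ}
    (hU : ∀ (g : G) (a b : R), ∑ k, ∑ s, ∑ t, star (U k s a) * Ψ g s t * U k t b =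
      if (a : G) * (b : G)⁻¹ = g then 1 else 0)
    (hmax : ∀ g, (∀ b ∈ R, g * b⁻¹ ∈ diffs S) → g ∈ R) (g : G) (k : κ) :
    Ψ g * U k = Ψ 1 * U k * shift R g := by
  obtain ⟨E, _, _, _, e, he, -⟩ := exists_hilbert_of_posSemidef _ hΨ
  let w : κ → R → G → E := fun k a p => ∑ s, U k s a • e (p, s)
  have hew : ∀ k p s (b : R) q, inner ℂ (e (p, s)) (w k b q) = ∑ t, Ψ (p * q⁻¹) s t * U k t b := by
    intro k p s b q
    simp only [w, inner_sum, inner_smul_right, he, Matrix.of_apply]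
    exact Finset.sum_congr rfl fun _ _ => mul_comm _ _
  have hww : ∀ (a b : R) p q, ∑ k, inner ℂ (w k a p) (w k b q) =
      if (a : G) * (b : G)⁻¹ = p * q⁻¹ then (1 : ℂ) else 0 := by
    intro a b p q
    rw [← hU]
    refine Finset.sum_congr rfl fun k _ => ?_
    conv_lhs => simp only [w]
    rw [sum_inner]
    refine Finset.sum_congr rfl fun s _ => ?_
    rw [inner_smul_left, hew, Finset.mul_sum]
    exact Finset.sum_congr rfl fun t _ => (mul_assoc _ _ _).symm
  have hw : ∀ k (a b : R) p q, (a : G) * (b : G)⁻¹ = p * q⁻¹ → w k a p = w k b q := by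
    intro k a b p q h
    have h' : (b : G) * (a : G)⁻¹ = q * p⁻¹ := by
      have := congrArg (·⁻¹) h
      simpa using this
    -- When ab⁻¹ = pq⁻¹ all four expanded terms equal 1 up to sign and cancel, so the vectors
    -- coincide for every k.
    have h0 : ∑ k, inner ℂ (w k a p - w k b q) (w k a p - w k b q) = (0 : ℂ) := by
      simp only [inner_sub_left, inner_sub_right, Finset.sum_sub_distrib, hww, h, h']
      simp
    have h1 : ∑ k, ‖w k a p - w k b q‖ ^ 2 = 0 := by
      have := congrArg RCLike.re h0
      simpa only [map_sum, inner_self_eq_norm_sq, map_zero] using this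
    have h2 := (Finset.sum_eq_zero_iff_of_nonneg fun _ _ => sq_nonneg _).1 h1 k (Finset.mem_univ _)
    exact sub_eq_zero.1 (norm_eq_zero.1 (pow_eq_zero_iff two_ne_zero |>.1 h2))
  ext s b
  rw [Matrix.mul_apply, Matrix.mul_apply]
  have h1 := hew k g s b 1
  rw [inv_one, mul_one] at h1
  rw [← h1]
  by_cases hgb : g * b ∈ R
  · rw [Finset.sum_eq_single ⟨g * b, hgb⟩]
    · rw [hw k b ⟨g * b, hgb⟩ 1 g (by simp), hew, mul_inv_cancel, ← Matrix.mul_apply]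
      simp [shift]
    · intro a _ ha
      rw [shift, Matrix.of_apply, if_neg, mul_zero]
      exact fun h => ha (Subtype.ext (mul_inv_eq_iff_eq_mul.1 h))
    · simp
  · rw [Finset.sum_eq_zero fun a _ => ?_]
    -- Maximality gives c ∈ R with gbc⁻¹ ∉ SS⁻¹. Moving the vector to c replaces Ψ(g) by Ψ(gbc⁻¹) =
    -- 0.
    · obtain ⟨c, hc⟩ := not_forall.1 fun h => hgb (hmax _ h)
      obtain ⟨hc, hgc⟩ := not_forall.1 hc
      rw [hw k b ⟨c, hc⟩ 1 (c * (b : G)⁻¹) (by simp), hew, hΨ0 _ (by simpa [mul_assoc] using hgc)]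
      simp
    · rw [shift, Matrix.of_apply, if_neg, mul_zero]
      exact fun h => hgb (mul_inv_eq_iff_eq_mul.1 h ▸ a.2)

/-- A null vector of Ψ(1) gives the zero vector in the GNS space, so it is killed by every Ψ(p), and
hence by the identity. -/
theorem isUnit_of_posSemidef_kernel {Ψ : G → Matrix S S ℂ}
    (hΨ : (Matrix.of fun p q : G × S => Ψ (p.1 * q.1⁻¹) p.2 q.2).PosSemidef)
    (hspan : (1 : Matrix S S ℂ) ∈ Submodule.span ℂ (Set.range Ψ)) : IsUnit (Ψ 1) := by
  obtain ⟨E, _, _, _, e, he, -⟩ := exists_hilbert_of_posSemidef _ hΨ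
  rw [← Matrix.mulVec_injective_iff_isUnit]
  refine (injective_iff_map_eq_zero (Ψ 1).mulVecLin).2 fun v hv => ?_
  let w : E := ∑ s, v s • e (1, s)
  have hew : ∀ p s, inner ℂ (e (p, s)) w = (Ψ p *ᵥ v) s := fun p s => by
    simp only [w, inner_sum, inner_smul_right, he, Matrix.of_apply, Matrix.mulVec, dotProduct,
      inv_one, mul_one]
    exact Finset.sum_congr rfl fun _ _ => mul_comm _ _
  have hw : w = 0 := by
    rw [← inner_self_eq_zero (𝕜 := ℂ)]
    nth_rewrite 1 [show w = ∑ s, v s • e (1, s) from rfl]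
    rw [sum_inner]
    refine Finset.sum_eq_zero fun s _ => ?_
    rw [inner_smul_left, hew, ← Matrix.mulVecLin_apply, hv, Pi.zero_apply, mul_zero]
  have h : ∀ T ∈ Submodule.span ℂ (Set.range Ψ), T *ᵥ v = 0 := fun T hT => by
    induction hT using Submodule.span_induction with
    | mem T hT =>
      obtain ⟨p, rfl⟩ := hT
      ext s
      rw [← hew, hw, inner_zero_right, Pi.zero_apply]
    | zero => exact Matrix.zero_mulVec v
    | add x y _ _ hx hy => rw [Matrix.add_mulVec, hx, hy, add_zero]
    | smul a x _ hx => rw [Matrix.smul_mulVec, hx, smul_zero]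
  simpa using h 1 hspan

end Intertwining

/-! ### Positivity through invertibility of matrix pencils. -/

section MatrixPencil

open scoped Matrix

open scoped MatrixOrder Matrix.Norms.L2Operator in
/-- A Hermitian matrix `Y` is positive semi-definite if the pencil `Y - lP` is invertible for all
`l < 0`. -/
theorem Matrix.PosDef.posSemidef_of_isUnit_sub {n : Type*} [Fintype n] [DecidableEq n]
    {P Y : Matrix n n ℂ} (hP : P.PosDef) (hY : Y.IsHermitian)
    (h : ∀ l : ℝ, l < 0 → IsUnit (Y - (l : ℂ) • P)) : Y.PosSemidef := by
  obtain ⟨C, D, hC, hD, hCP, hCD, hDC⟩ := hP.isStrictlyPositive.exists_normalise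
  have hZ : (C * Y * C).IsHermitian := by
    have := Matrix.isHermitian_conjTranspose_mul_mul C hY
    rwa [show Cᴴ = C from hC] at this
  have hZ' : (C * Y * C).PosSemidef := by
    rw [hZ.posSemidef_iff_eigenvalues_nonneg]
    intro i
    by_contra hi
    rw [Pi.zero_apply, not_le] at hi
    have h1 := hZ.eigenvalues_mem_spectrum_real i
    refine spectrum.mem_iff.1 h1 ?_
    -- With C = P^{-1/2}, an eigenvalue l of CYC makes Y − lP singular, so negative eigenvalues are
    -- excluded.
    have h2 : algebraMap ℝ (Matrix n n ℂ) (hZ.eigenvalues i) - C * Y * C =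
        -(C * (Y - (hZ.eigenvalues i : ℂ) • P) * C) := by
      rw [Matrix.mul_sub, Matrix.sub_mul, Matrix.mul_smul, Matrix.smul_mul, hCP, neg_sub,
        Algebra.algebraMap_eq_smul_one]
      congr 1
    have hCu : IsUnit C := ⟨⟨C, D, hCD, hDC⟩, rfl⟩
    rw [h2]
    exact ((hCu.mul (h _ hi)).mul hCu).neg
  have := hZ'.conjTranspose_mul_mul_same D
  rw [show Dᴴ = D from hD] at this
  convert this using 1
  calc Y = (D * C) * Y * (C * D) := by rw [hDC, hCD, one_mul, mul_one]
    _ = D * (C * Y * C) * D := by simp only [mul_assoc]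

variable {G : Type u} [Group G] [DecidableEq G] {S : Finset G} {ι : Type*} [Fintype ι]
  [DecidableEq ι]

/-- Matrices over the algebra of `S` are invertible if they are so as scalar matrices. -/
theorem isUnit_of_isUnit_comp (X : Matrix ι ι (toepAlg S))
    (hX : IsUnit (Matrix.compAlgEquiv ι S ℂ ℂ ((toepAlg S).val.mapMatrix X))) : IsUnit X := by
  let Φ : Matrix ι ι (toepAlg S) →ₐ[ℂ] Matrix (ι × S) (ι × S) ℂ :=
    (Matrix.compAlgEquiv ι S ℂ ℂ).toAlgHom.comp (toepAlg S).val.mapMatrix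
  have hΦ : Function.Injective Φ := fun X Y h => by
    have h1 : (toepAlg S).val.mapMatrix X = (toepAlg S).val.mapMatrix Y :=
      (Matrix.compAlgEquiv ι S ℂ ℂ).injective h
    exact Matrix.ext fun i j => Subtype.ext (congrFun (congrFun h1 i) j)
  obtain ⟨u, hu⟩ := hX
  have hu' : (u : Matrix (ι × S) (ι × S) ℂ) = Φ X := hu
  obtain ⟨Z, hZ⟩ := Subalgebra.inv_mem_of_finiteDimensional Φ.range (a := Φ X) ⟨X, rfl⟩
    (b := ((u⁻¹ : (Matrix (ι × S) (ι × S) ℂ)ˣ) : Matrix (ι × S) (ι × S) ℂ))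
    (by rw [← hu', Units.inv_mul])
  have hZ' : Φ Z = ((u⁻¹ : (Matrix (ι × S) (ι × S) ℂ)ˣ) : Matrix (ι × S) (ι × S) ℂ) := hZ
  refine ⟨⟨X, Z, hΦ ?_, hΦ ?_⟩, rfl⟩
  · rw [map_mul, map_one, hZ', ← hu', Units.mul_inv]
  · rw [map_mul, map_one, hZ', ← hu', Units.inv_mul]

/-- A homomorphism sending the shifts to `L (Ψ h)`, where `L` is the inverse of `Ψ 1`, transports
the positivity of `∑ shift h ⊗ K h` to that of `∑ Ψ h ⊗ K h`. -/
theorem posSemidef_sum_of_algHom {Ψ : G → Matrix S S ℂ} (hΨ : ∀ g, Ψ g⁻¹ = (Ψ g)ᴴ)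
    (hΨ1 : (Ψ 1).PosDef) {L : Matrix S S ℂ} (hL : L * Ψ 1 = 1) (η : toepAlg S →ₐ[ℂ] toepAlg S)
    (hη : ∀ (g : G) (h : shift S g ∈ toepAlg S), (η ⟨shift S g, h⟩ : Matrix S S ℂ) = L * Ψ g)
    {K : G → ι → ι → ℂ} (hK : (toeplitzMatrix S K).PosSemidef) :
    (Matrix.of fun p q : ι × S =>
      ∑ h ∈ diffsFinset S, K h p.1 q.1 * Ψ h p.2 q.2).PosSemidef := by
  have hL' : Ψ 1 * L = 1 := mul_eq_one_comm.1 hL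
  let X : Matrix ι ι (toepAlg S) := .of fun i j => ∑ h ∈ diffsFinset S,
    K h i j • ⟨shift S h, mem_toepAlg_of_isToeplitz (isToeplitz_shift h)⟩
  let Y : Matrix ι ι (Matrix S S ℂ) := .of fun i j => ∑ h ∈ diffsFinset S, K h i j • Ψ h
  let P : Matrix ι ι (Matrix S S ℂ) := .diagonal fun _ => Ψ 1
  let L' : Matrix ι ι (Matrix S S ℂ) := .diagonal fun _ => L
  have hPL : P * L' = 1 := by simp [P, L', Matrix.diagonal_mul_diagonal, hL']
  have hX : (Matrix.compAlgEquiv ι S ℂ ℂ ((toepAlg S).val.mapMatrix X)).PosSemidef := by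
    convert hK.submatrix Prod.swap using 1
    ext p q
    change (((∑ h ∈ diffsFinset S, K h p.1 q.1 • (⟨shift S h,
      mem_toepAlg_of_isToeplitz (isToeplitz_shift h)⟩ : toepAlg S) : toepAlg S)) :
        Matrix S S ℂ) p.2 q.2 = K (p.2 * (q.2 : G)⁻¹) p.1 q.1
    rw [AddSubmonoidClass.coe_finsetSum, Matrix.sum_apply]
    simp [shift, mem_diffsFinset.2 (mul_inv_mem_diffs p.2 q.2)]
  have hηX : (toepAlg S).val.mapMatrix (η.mapMatrix X) = L' * Y := by
    ext i j : 1
    rw [Matrix.diagonal_mul]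
    change ((η (∑ h ∈ diffsFinset S, K h i j • (⟨shift S h,
      mem_toepAlg_of_isToeplitz (isToeplitz_shift h)⟩ : toepAlg S)) : toepAlg S) :
        Matrix S S ℂ) = L * ∑ h ∈ diffsFinset S, K h i j • Ψ h
    rw [map_sum, AddSubmonoidClass.coe_finsetSum, Finset.mul_sum]
    refine Finset.sum_congr rfl fun h _ => ?_
    rw [map_smul, SetLike.val_smul, hη, Matrix.mul_smul]
  have hPd : (Matrix.compAlgEquiv ι S ℂ ℂ P).PosDef := by
    have : Matrix.compAlgEquiv ι S ℂ ℂ P =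
        Matrix.kroneckerMap (fun x y => x * y) (1 : Matrix ι ι ℂ) (Ψ 1) := by
      refine Matrix.ext fun p q => ?_
      change P p.1 q.1 p.2 q.2 = (1 : Matrix ι ι ℂ) p.1 q.1 * Ψ 1 p.2 q.2
      rcases eq_or_ne p.1 q.1 with h | h
      · rw [h, Matrix.one_apply_eq, one_mul]
        have h1 : P q.1 q.1 = Ψ 1 := Matrix.diagonal_apply_eq _ _
        rw [h1]
      · rw [Matrix.one_apply_ne h, zero_mul]
        have h1 : P p.1 q.1 = 0 := Matrix.diagonal_apply_ne _ h
        rw [h1, Matrix.zero_apply]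
    rw [this]
    exact Matrix.PosDef.one.kronecker hΨ1
  have hYh : (Matrix.compAlgEquiv ι S ℂ ℂ Y).IsHermitian := by
    refine Matrix.ext fun p q => ?_
    change star ((∑ h ∈ diffsFinset S, K h q.1 p.1 • Ψ h) q.2 p.2) =
      (∑ h ∈ diffsFinset S, K h p.1 q.1 • Ψ h) p.2 q.2
    rw [Matrix.sum_apply, Matrix.sum_apply, star_sum]
    refine Finset.sum_nbij' (·⁻¹) (·⁻¹) (fun h hh => mem_diffsFinset.2
      (inv_mem_diffs (mem_diffsFinset.1 hh))) (fun h hh => mem_diffsFinset.2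
      (inv_mem_diffs (mem_diffsFinset.1 hh))) (fun _ _ => inv_inv _) (fun _ _ => inv_inv _)
      fun h hh => ?_
    obtain ⟨s, t, rfl⟩ := mem_diffsFinset.1 hh
    have h1 : star (K ((s : G) * (t : G)⁻¹) q.1 p.1) = K ((t : G) * (s : G)⁻¹) p.1 q.1 :=
      hK.1.apply (t, p.1) (s, q.1)
    rw [hΨ, Matrix.smul_apply, Matrix.smul_apply, star_smul, h1, mul_inv_rev, inv_inv,
      Matrix.conjTranspose_apply]
  -- The homomorphism η need not preserve adjoints, so only invertibility is transported: X − l is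
  -- invertible for l < 0, hence so is P⁻¹Y − l, hence Y − lP.
  have hY := hPd.posSemidef_of_isUnit_sub hYh fun l hl => by
    have h1 : IsUnit (X - (l : ℂ) • 1) := isUnit_of_isUnit_comp _ <| by
      rw [map_sub, map_sub, map_smul, map_smul, map_one, map_one]
      have h0 : (0 : ℂ) < ((-l : ℝ) : ℂ) := by exact_mod_cast neg_pos.2 hl
      have := (Matrix.PosDef.posSemidef_add hX (Matrix.PosDef.one.smul h0)).isUnit
      rwa [Complex.ofReal_neg, neg_smul, ← sub_eq_add_neg] at this
    have h2 := (h1.map η.mapMatrix).map (toepAlg S).val.mapMatrix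
    rw [map_sub, map_sub, map_smul, map_smul, map_one, map_one, hηX] at h2
    have hPu : IsUnit P := ⟨⟨P, L', hPL, mul_eq_one_comm.1 hPL⟩, rfl⟩
    have h3 := (hPu.mul h2).map (Matrix.compAlgEquiv ι S ℂ ℂ)
    rwa [mul_sub, mul_smul_comm, mul_one, ← mul_assoc, hPL, one_mul, map_sub, map_smul] at h3
  convert hY using 1
  ext p q
  change _ = (∑ h ∈ diffsFinset S, K h p.1 q.1 • Ψ h) p.2 q.2
  rw [Matrix.sum_apply]
  rfl

end MatrixPencil

/-! ### The duality implies Fejér–Riesz. -/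

section FejerRieszOfIsomorphic

open scoped Matrix

variable {G : Type u} [Group G] {S : Finset G}

/-- Positive elements pair nonnegatively with the values of a positive matrix of functionals. -/
theorem symbPair_nonneg_of_mem_dualCones {n : ℕ} {K : G → Fin n → Fin n → ℂ}
    {F : Matrix (Fin n) (Fin n) (Module.Dual ℂ (fourierSystem S))}
    (hF : F ∈ dualCones (fourierCones S) n)
    (hFK : ∀ i j s t, F i j (fourierDelta s t) = K ((s : G) * (t : G)⁻¹) i j)
    {A : S → S → Matrix (Fin n) (Fin n) ℂ} (hA : 0 ≤ stretch S A) : 0 ≤ symbPair A K := by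
  let x : Matrix (Fin n) (Fin n) (fourierSystem S) :=
    .of fun i j => ∑ s, ∑ t, A s t i j • fourierDelta s t
  have hx : x ∈ fourierCones S n := by
    refine hA.trans_eq (CStarMatrix.ext fun i j => ?_)
    rw [stretch_apply]
    change _ = (fourierSystem S).subtype (∑ s, ∑ t, A s t i j • fourierDelta s t)
    simp [fourierDelta, map_sum]
  refine ((hF n x hx).submatrix fun i : Fin n => (i, i)).sum_nonneg.trans_eq ?_
  simp only [Matrix.submatrix_apply, Matrix.of_apply, x, map_sum, map_smul, hFK, symbPair]
  simp only [← Finset.sum_product', Finset.univ_product_univ]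
  exact Fintype.sum_equiv ⟨fun p : Fin n × Fin n × S × S => (p.2.2.1, p.2.2.2, p.1, p.2.1),
    fun p => (p.2.2.1, p.2.2.2, p.1, p.2.1), fun _ => rfl, fun _ => rfl⟩ _ _ fun _ => rfl

/-- It suffices that every positive Toeplitz kernel K over S, viewed as a matrix of functionals on
the Fourier system, is positive. The rigidity argument shows this although f need not be the
canonical map. -/
theorem completeFejerRiesz_of_isomorphic
    (h : CompletelyOrderIsomorphic (toeplitzCones S) (dualCones (fourierCones S))) :
    CompleteFejerRieszProperty S := by
  classical
  obtain ⟨f, hf, hf'⟩ := h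
  rintro n _ hx ⟨A, rfl⟩
  refine mem_sosCone_of_forall_symbPair fun K hK => ?_
  rcases S.eq_empty_or_nonempty with rfl | hS
  · simp [symbPair]
  obtain ⟨R, hSR, hRR, hmax⟩ := exists_maximal_same_diffs hS
  obtain ⟨U, hU⟩ := exists_factorization (R := R) hf fun a b => hRR a a.2 b b.2
  let Ψ : G → Matrix S S ℂ := fun g => (f.symm (coefDual S g) : toeplitzSystem S)
  have hΨ : (Matrix.of fun p q : G × S => Ψ (p.1 * q.1⁻¹) p.2 q.2).PosSemidef :=
    posSemidef_symm_coefDual hf'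
  have hΨT : ∀ g, IsToeplitz (Ψ g) := fun g => (f.symm (coefDual S g)).2
  have hΨ0 : ∀ g ∉ diffs S, Ψ g = 0 := fun g hg => by
    simp only [Ψ, coefDual_eq_zero hg, map_zero]
    rfl
  have hsum : ∀ k : G → ℂ, ∀ B : Finset G,
      ((f.symm (∑ h ∈ B, k h • coefDual S h) : toeplitzSystem S) : Matrix S S ℂ) =
        ∑ h ∈ B, k h • Ψ h := fun k B => by
    rw [map_sum, AddSubmonoidClass.coe_finsetSum]
    refine Finset.sum_congr rfl fun h _ => ?_
    rw [map_smul]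
    rfl
  have hspan : ∀ T : Matrix S S ℂ, IsToeplitz T → T ∈ Submodule.span ℂ (Set.range Ψ) :=
    fun T hT => by
      have h1 := hsum (fun g => f ⟨T, hT⟩ (fourierGen S g)) (diffsFinset S)
      rw [← eq_sum_coefDual, f.symm_apply_apply] at h1
      change T = _ at h1
      rw [h1]
      exact Submodule.sum_mem _ fun g _ =>
        Submodule.smul_mem _ _ (Submodule.subset_span ⟨g, rfl⟩)
  have hUΨ : ∀ (g : G) (a b : R), ∑ k, ∑ s, ∑ t, star (U k s a) * Ψ g s t * U k t b =
      if (a : G) * (b : G)⁻¹ = g then 1 else 0 := fun g a b => by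
    rw [← hU, f.apply_symm_apply, coefDual_fourierGen _ (hRR a a.2 b b.2)]
  have h1T : IsToeplitz (1 : Matrix S S ℂ) := fun s t s' t' h => by
    have : s = t ↔ s' = t' := by
      rw [Subtype.ext_iff, Subtype.ext_iff, ← mul_inv_eq_one, h, mul_inv_eq_one]
    simp [Matrix.one_apply, this]
  have hunit : IsUnit (Ψ 1) := isUnit_of_posSemidef_kernel hΨ (hspan 1 h1T)
  have hΨ1 : (Ψ 1).PosDef := by
    have : (Ψ 1).PosSemidef := by
      convert hΨ.submatrix fun s : S => ((1 : G), s) using 1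
      ext s t
      simp
    exact this.posDef_iff_isUnit.2 hunit
  obtain ⟨L, hL⟩ := hunit.exists_left_inv
  have hU1 : ∑ k, (U k)ᴴ * Ψ 1 * U k = 1 := by
    ext a b
    rw [Matrix.sum_apply, Matrix.one_apply]
    have := hUΨ 1 a b
    simp only [mul_inv_eq_one, ← Subtype.ext_iff] at this
    rw [← this]
    refine Finset.sum_congr rfl fun k _ => ?_
    rw [Matrix.mul_apply]
    simp only [Matrix.mul_apply, Finset.sum_mul, Matrix.conjTranspose_apply]
    exact Finset.sum_comm
  obtain ⟨η, hη⟩ := exists_algHom_shift hΨT hspan hL hS hSR hU1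
    (mul_eq_mul_shift hΨ hΨ0 hUΨ hmax)
  have hstar : ∀ g, Ψ g⁻¹ = (Ψ g)ᴴ := fun g => Matrix.ext fun s t => by
    have := hΨ.1.apply (1, s) (g, t)
    simp only [Matrix.of_apply, one_mul, inv_one, mul_one] at this
    exact this.symm
  have hY := posSemidef_sum_of_algHom hstar hΨ1 hL η hη hK
  -- The functionals with values K on the generators. Their preimage under f is ∑ K(h) ⊗ Ψ(h), just
  -- shown to be positive, so F is positive because f is completely positive.
  let F : Matrix (Fin n) (Fin n) (Module.Dual ℂ (fourierSystem S)) :=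
    .of fun i j => ∑ h ∈ diffsFinset S, K h i j • coefDual S h
  have hFT : F.map f.symm ∈ toeplitzCones S n := by
    change (Matrix.of fun p q : Fin n × S => ((f.symm (∑ h ∈ diffsFinset S,
      K h p.1 q.1 • coefDual S h) : toeplitzSystem S) : Matrix S S ℂ) p.2 q.2).PosSemidef
    simpa only [hsum, Matrix.sum_apply, Matrix.smul_apply, smul_eq_mul] using hY
  have hF : F ∈ dualCones (fourierCones S) n := by
    convert hf n _ hFT
    ext i j : 1
    exact (f.apply_symm_apply _).symm
  refine symbPair_nonneg_of_mem_dualCones hF (fun i j s t => ?_) hx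
  rw [← fourierGen_mul_inv]
  simp [F, LinearMap.sum_apply, coefDual_fourierGen _ (mul_inv_mem_diffs s t),
    mem_diffsFinset.2 (mul_inv_mem_diffs s t)]

end FejerRieszOfIsomorphic

end

theorem mainTheorem1 {G : Type u} [Group G] (S : Finset G) :
    [PositiveOperatorExtensionProperty.{u, v} S,
      BoundedOperatorExtensionProperty.{u, v} S,
      CompleteFejerRieszProperty S,
      CompletelyOrderIsomorphic (toeplitzCones S) (dualCones (fourierCones S))].TFAE := by
  tfae_have 1 → 3 := completeFejerRiesz_of_pos
  tfae_have 2 → 3 := completeFejerRiesz_of_bounded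
  tfae_have 3 → 1 := CompleteFejerRieszProperty.posExtension
  tfae_have 3 → 2 := CompleteFejerRieszProperty.boundedExtension
  tfae_have 3 → 4 := CompleteFejerRieszProperty.completelyOrderIsomorphic
  tfae_have 4 → 3 := completeFejerRiesz_of_isomorphic
  tfae_finish
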